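/- **Setting.** Let $K,d\in\mathbb{N}$, let $p=(p_1,\dots,p_K)$ be a probability vector and $\beta_1,\dots,\beta_K\in\mathbb{R}^d$ unknown coefficients. Let $X^1,X^2,\dots$ be i.i.d. copies of a random vector $X$ in $\mathbb{R}^d$, and let $\varepsilon^n_k$ ($n\ge 1$, $1\le k\le K$) be i.i.d. mean-zero noise terms that are independent of $\{X^n\}$. Let $g^*\in\mathbb{R}^K$ maximize $g\mapsto\mathbb{E}\left(\min_j(\beta_j^\top X-g_j)\right)+p^\top g$ over $\mathbb{R}^K$ (the Kantorovich dual of the semidiscrete optimal transport problem with costs $\beta_k^\top x$), and let $\pi^*(x)=\arg\min_j \beta_j^\top x-g^*_j$. Throughout, $\arg\min$ means the value of a fixed measurable rule that selects a minimizing index. Put $Z_{j,k}=(\beta_j^\top X-g^*_j)-(\beta_k^\top X-g^*_k)$. **Assumptions**, with constants $\kappa_1,\dots,\kappa_8>0$. For all $j\ne k$, the variable $\beta_j^\top X-\beta_k^\top X$ is absolutely continuous, $Z_{j,k}$ has a density with values in $[\kappa_2,\kappa_3]$ on $[-\kappa_1,\kappa_1]$, and $P\left(\min_{\ell\ne j,k}Z_{\ell,k}\ge\kappa_4\mid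 0<Z_{j,k}\le\kappa\right)\ge\kappa_5$ for all $0<\kappa<\kappa_1$; $\|X\|_2\le\kappa_6$ almost surely; $\mathbb{E}\left(\exp(t\varepsilon^n_k)\mid X^n\right)\le\exp(\tfrac12\kappa_7t^2)$ for all $n,k$ and $t\in\mathbb{R}$; and $\lambda_{\min}\left(\mathbb{E}(XX^\top 1_{\{\pi^*(X)=k\}})\right)\ge\kappa_8$ for all $k$. **Algorithm.** Fix $\alpha>0$, $a>0$, deterministic $g^0\in\mathbb{R}^K$ and $\hat\beta^0_1,\dots,\hat\beta^0_K\in\mathbb{R}^d$, and let $\mathcal{T}_k=\{\lceil\exp(a\,m^{1/9})\rceil : m\ge 1,\ (k+1)\mid m\}$. Since these sets overlap, fix also a deterministic rule $r$ that assigns to each $n\in\bigcup_k\mathcal{T}_k$ an index $r(n)$ with $n\in\mathcal{T}_{r(n)}$, such that every $k$ receives asymptotically a positive proportion: for some $c>0$ and all $k$, $\#\{n\le N: n\in\bigcup_j\mathcal{T}_j,\ r(n)=k\}\ge c\,\#\{n\le N: n\in\bigcup_j\mathcal{T}_j\}$ for all large $N$. For $n=0,1,2,\dots$ the plug-in decision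 is $\hat\pi^{n+1}=\arg\min_j(\hat\beta^n_j)^\top X^{n+1}-g^n_j$, and the semi-myopic decision is $\pi^{n+1}=r(n)$ if $n\in\bigcup_k\mathcal{T}_k$ and $\pi^{n+1}=\hat\pi^{n+1}$ otherwise. One observes $W^{n+1}_k=\beta_k^\top X^{n+1}+\varepsilon^{n+1}_k$ for $k=\pi^{n+1}$ only, and updates, for all $k$, with $\rho^n=1+(\log n)^3$, $$g^{n+1}_k=g^n_k+\frac{\alpha}{n+1}\left(-1_{\{k=\hat\pi^{n+1}\}}+p_k\right),$$ $$\hat\beta^{n+1}_k=\left(\rho^{n+1}I+\sum_{m=1}^{n+1}X^m(X^m)^\top1_{\{\pi^m=k\}}\right)^{-1}\sum_{m=1}^{n+1}W^m_kX^m1_{\{\pi^m=k\}}.$$ **Theorem.** There is $\bar\alpha>0$, depending only on $\kappa_1,\dots,\kappa_8$, such that if $\alpha>\bar\alpha$ then, for every $n\ge 1$, $$P\left(\hat\pi^n\ne\pi^*(X^n)\right)\le\frac{D}{\sqrt n},$$ where $D>0$ depends only on $\kappa_1,\dots,\kappa_8$, on $K$ and $d$, on the parameters $\alpha$, $a$,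 $r$ of the algorithm, and on an upper bound $R$ for all $\|\beta_k\|_2$ and $|g^0_k|$. -/

import Mathlib

open MeasureTheory ProbabilityTheory Filter
open scoped Classical

noncomputable section

namespace SemidiscreteOT

/-! ### The transport problem with linear costs -/

/-- The vector of adjusted costs `b_j^T x - g_j`, `j = 1, ..., K`. -/
def adjustedCost {K d : ℕ} (b : Fin K → EuclideanSpace ℝ (Fin d)) (g : Fin K → ℝ)
    (x : EuclideanSpace ℝ (Fin d)) : Fin K → ℝ :=
  fun j => inner ℝ (b j) x - g j

/-- `amin` returns, measurably, an index at which the given vector attains its minimum. Where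
the minimizer is not unique, an arbitrary but fixed rule is allowed. -/
structure IsArgminRule {K : ℕ} (amin : (Fin K → ℝ) → Fin K) : Prop where
  measurable : Measurable amin
  le : ∀ (c : Fin K → ℝ) (j : Fin K), c (amin c) ≤ c j

/-- The objective `E (min_j (β_j^T X - g_j)) + p^T g` of the Kantorovich dual. -/
def dualObjective {K d : ℕ} {Ω : Type*} [MeasurableSpace Ω] (P : Measure Ω)
    (p : Fin K → ℝ) (β : Fin K → EuclideanSpace ℝ (Fin d))
    (X : Ω → EuclideanSpace ℝ (Fin d)) (g : Fin K → ℝ) : ℝ :=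
  (∫ ω, ⨅ j, adjustedCost β g (X ω) j ∂P) + ∑ k, p k * g k

/-- `Z_{j,k} = (β_j^T x - g_j) - (β_k^T x - g_k)`. -/
def margin {K d : ℕ} (β : Fin K → EuclideanSpace ℝ (Fin d)) (g : Fin K → ℝ)
    (j k : Fin K) (x : EuclideanSpace ℝ (Fin d)) : ℝ :=
  adjustedCost β g x j - adjustedCost β g x k

/-- The smallest eigenvalue of a real (symmetric) matrix. -/
def lambdaMin {d : ℕ} (A : Matrix (Fin d) (Fin d) ℝ) : ℝ :=
  sInf (spectrum ℝ A)

/-- The matrix `E (X X^T 1_{π(X) = k})` for the policy `π(x) = argmin_j (b_j^T x - g_j)`. -/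
def restrictedMoment {K d : ℕ} {Ω : Type*} [MeasurableSpace Ω] (P : Measure Ω)
    (amin : (Fin K → ℝ) → Fin K) (b : Fin K → EuclideanSpace ℝ (Fin d)) (g : Fin K → ℝ)
    (X : Ω → EuclideanSpace ℝ (Fin d)) (k : Fin K) : Matrix (Fin d) (Fin d) ℝ :=
  Matrix.of fun i l =>
    ∫ ω, X ω i * X ω l * (if amin (adjustedCost b g (X ω)) = k then (1 : ℝ) else 0) ∂P

/-! ### Assumptions on the data

Time is shifted by one: `X n` and `ε n k` are the sample `X^{n+1}` and the noise `ε^{n+1}_k`. -/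

/-- The standing model: i.i.d. samples `X`, i.i.d. centred noise independent of the samples,
target probabilities `p`, and a solution `gstar` of the Kantorovich dual problem. -/
structure IsDataModel {K d : ℕ} {Ω : Type*} [MeasurableSpace Ω] (P : Measure Ω)
    (p : Fin K → ℝ) (β : Fin K → EuclideanSpace ℝ (Fin d)) (gstar : Fin K → ℝ)
    (X : ℕ → Ω → EuclideanSpace ℝ (Fin d)) (ε : ℕ → Fin K → Ω → ℝ) : Prop where
  p_mem : p ∈ stdSimplex ℝ (Fin K)
  measurable_X : ∀ n, Measurable (X n)
  measurable_noise : ∀ n k, Measurable (ε n k)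
  indep_X : iIndepFun X P
  ident_X : ∀ n, IdentDistrib (X n) (X 0) P P
  indep_noise : iIndepFun (fun q : ℕ × Fin K => ε q.1 q.2) P
  ident_noise : ∀ n m k l, IdentDistrib (ε n k) (ε m l) P P
  integrable_noise : ∀ n k, Integrable (ε n k) P
  noise_mean : ∀ n k, ∫ ω, ε n k ω ∂P = 0
  indep_X_noise :
    IndepFun (fun ω n => X n ω) (fun ω (q : ℕ × Fin K) => ε q.1 q.2 ω) P
  dual_optimal : ∀ g, dualObjective P p β (X 0) g ≤ dualObjective P p β (X 0) gstar

/-- Pairwise differences of costs are absolutely continuous with respect to Lebesgue measure. -/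
def AbsContDifferences {K d : ℕ} {Ω : Type*} [MeasurableSpace Ω] (P : Measure Ω)
    (β : Fin K → EuclideanSpace ℝ (Fin d)) (X : Ω → EuclideanSpace ℝ (Fin d)) : Prop :=
  ∀ j k, j ≠ k → P.map (fun ω => inner ℝ (β j) (X ω) - inner ℝ (β k) (X ω)) ≪ volume

/-- Richness of the distribution of the data near the decision boundaries, and boundedness. -/
structure IsRich {K d : ℕ} {Ω : Type*} [MeasurableSpace Ω] (P : Measure Ω)
    (κ₁ κ₂ κ₃ κ₄ κ₅ κ₆ : ℝ) (β : Fin K → EuclideanSpace ℝ (Fin d)) (gstar : Fin K → ℝ)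
    (X : Ω → EuclideanSpace ℝ (Fin d)) : Prop where
  density : ∀ j k, j ≠ k → ∃ h : ℝ → ENNReal, Measurable h ∧
    P.map (fun ω => margin β gstar j k (X ω)) = volume.withDensity h ∧
    ∀ z ∈ Set.Icc (-κ₁) κ₁, ENNReal.ofReal κ₂ ≤ h z ∧ h z ≤ ENNReal.ofReal κ₃
  separation : ∀ j k, j ≠ k → ∀ κ : ℝ, 0 < κ → κ < κ₁ →
    κ₅ ≤ (cond P {ω | 0 < margin β gstar j k (X ω) ∧ margin β gstar j k (X ω) ≤ κ}).real
      {ω | ∀ l, l ≠ j → l ≠ k → κ₄ ≤ margin β gstar l k (X ω)}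
  bounded : ∀ᵐ ω ∂P, ‖X ω‖ ≤ κ₆

/-- Given `X^n`, the noise is conditionally sub-Gaussian with variance proxy `κ₇`. -/
def IsCondSubGaussian {K d : ℕ} {Ω : Type*} [MeasurableSpace Ω] (P : Measure Ω) (κ₇ : ℝ)
    (X : ℕ → Ω → EuclideanSpace ℝ (Fin d)) (ε : ℕ → Fin K → Ω → ℝ) : Prop :=
  ∀ n k (t : ℝ), Integrable (fun ω => Real.exp (t * ε n k ω)) P ∧
    P[fun ω => Real.exp (t * ε n k ω) | MeasurableSpace.comap (X n) inferInstance]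
      ≤ᵐ[P] fun _ => Real.exp (1 / 2 * κ₇ * t ^ 2)

/-! ### The semi-myopic algorithm -/

/-- The set `{⌈exp (a m^{1/9})⌉ : m ≥ 1, (k + 1) ∣ m}` for `k = 1, ..., K`; the alternative `k`
is the element `k - 1` of `Fin K`. -/
def exploreSet {K : ℕ} (a : ℝ) (k : Fin K) : Set ℕ :=
  {n | ∃ m : ℕ, 0 < m ∧ ((k : ℕ) + 2) ∣ m ∧ n = ⌈Real.exp (a * (m : ℝ) ^ ((1 : ℝ) / 9))⌉₊}

/-- `n` is a period of forced exploration (of one of the alternatives). -/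
def IsForced (K : ℕ) (a : ℝ) (n : ℕ) : Prop :=
  ∃ k : Fin K, n ∈ exploreSet a k

/-- The exploration sets of different alternatives overlap. A resolution rule `r` names, for
each forced period `n`, one alternative `r n` whose exploration set contains `n`, in such a way
that each alternative receives asymptotically a positive proportion of the forced periods. -/
structure IsExplorationRule {K : ℕ} (a : ℝ) (r : ℕ → Fin K) : Prop where
  mem : ∀ n, IsForced K a n → n ∈ exploreSet a (r n)
  share : ∃ c : ℝ, 0 < c ∧ ∀ k, ∀ᶠ N : ℕ in atTop,
    c * ({n | n ≤ N ∧ IsForced K a n} : Set ℕ).ncard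
      ≤ ({n | n ≤ N ∧ IsForced K a n ∧ r n = k} : Set ℕ).ncard

/-- The state of the algorithm after `n` steps: the dual vector `g = g^n`, the regression
coefficients `b k`, and the accumulated sums
`V k = ∑_{m ≤ n} X^m (X^m)^T 1_{π^m = k}` and `u k = ∑_{m ≤ n} W^m_k X^m 1_{π^m = k}`. -/
structure State (K d : ℕ) where
  g : Fin K → ℝ
  b : Fin K → EuclideanSpace ℝ (Fin d)
  V : Fin K → Matrix (Fin d) (Fin d) ℝ
  u : Fin K → Fin d → ℝ

/-- The ridge parameter `1 + (log n)^3`. -/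
def ridgeParam (n : ℕ) : ℝ := 1 + Real.log n ^ 3

/-- The plug-in decision `argmin_j (b_j^T x - g_j)` in a given state. -/
def plugIn {K d : ℕ} (amin : (Fin K → ℝ) → Fin K) (s : State K d)
    (x : EuclideanSpace ℝ (Fin d)) : Fin K :=
  amin (adjustedCost s.b s.g x)

/-- The semi-myopic decision `π^{n+1}`. -/
def semiMyopic {K d : ℕ} (amin : (Fin K → ℝ) → Fin K) (a : ℝ) (r : ℕ → Fin K) (n : ℕ)
    (s : State K d) (x : EuclideanSpace ℝ (Fin d)) : Fin K :=
  if IsForced K a n then r n else plugIn amin s x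

/-- Step `n + 1` of the algorithm: `x` is the new sample `X^{n+1}`, `e` the noise vector. Only
the observation `W = β_π^T x + e_π` of the selected alternative `π` is used. -/
def step {K d : ℕ} (amin : (Fin K → ℝ) → Fin K) (α a : ℝ) (r : ℕ → Fin K)
    (p : Fin K → ℝ) (β : Fin K → EuclideanSpace ℝ (Fin d)) (n : ℕ) (s : State K d)
    (x : EuclideanSpace ℝ (Fin d)) (e : Fin K → ℝ) : State K d :=
  let hatπ := plugIn amin s x
  let π := semiMyopic amin a r n s x
  let W : ℝ := inner ℝ (β π) x + e π
  let V' : Fin K → Matrix (Fin d) (Fin d) ℝ := fun k =>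
    s.V k + if π = k then Matrix.vecMulVec x.ofLp x.ofLp else 0
  let u' : Fin K → Fin d → ℝ := fun k => s.u k + if π = k then W • x.ofLp else 0
  { g := fun k => s.g k + α / (n + 1) * (-(if k = hatπ then 1 else 0) + p k)
    b := fun k => WithLp.toLp 2
      ((ridgeParam (n + 1) • (1 : Matrix (Fin d) (Fin d) ℝ) + V' k)⁻¹.mulVec (u' k))
    V := V'
    u := u' }

/-- The state after `n` steps along a given sequence of samples and noise vectors, started from
`g^0 = g0` and `b^0 = b0`. -/
def run {K d : ℕ} (amin : (Fin K → ℝ) → Fin K) (α a : ℝ) (r : ℕ → Fin K)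
    (p : Fin K → ℝ) (β : Fin K → EuclideanSpace ℝ (Fin d)) (g0 : Fin K → ℝ)
    (b0 : Fin K → EuclideanSpace ℝ (Fin d)) (x : ℕ → EuclideanSpace ℝ (Fin d))
    (e : ℕ → Fin K → ℝ) : ℕ → State K d
  | 0 => { g := g0, b := b0, V := fun _ => 0, u := fun _ => 0 }
  | n + 1 => step amin α a r p β n (run amin α a r p β g0 b0 x e n) (x n) (e n)

end SemidiscreteOT

end

noncomputable section

namespace SemidiscreteOT

/-! ### Independence of the past and the present -/

/-! Write h for the centred deviation of the dual vector from `gstar` (`dev`) and e for the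
regression errors (`err`). A plug-in decision can be wrong only if some true margin is at most a
multiple of |h| + |e|. Margins have bounded densities near 0, so given the past the error
probability is O(|h| + |e|) (`prob_dec_ne_opt_le`). It therefore suffices that |h|² has mean O(1/n),
and |e|² as well outside an event of probability O(n⁻²).

The dual update is stochastic gradient ascent. First order optimality (`p_dot_eq`) identifies p_k as
the probability that the optimal decision is k, so the mean decrease of |h|²/2 per unit step is, to
first order, the drift E(h(dec) - h(opt)). With exact coefficients the integrand is nonnegative: a
decision deviates from the optimal one only in favour of a larger h. The lower density bound and the
separation condition make the drift at least κ₂κ₅|h|² - O(|e|²) near the origin (`drift_ge_local`),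
and at least a multiple of |h| outside any given ball once e is small (`exists_drift`). With step
α/(n+1) and ακ₂κ₅ ≥ 1 the local bound contracts E|h|² by 1 - 2/(n+1) up to errors O(n⁻²), whence
E|h|² = O(1/n) (`le_div_of_recursion`, `integral_nrm_dev_sq_le`). This explains the threshold
1/(κ₂κ₅).

The drift needs small e, while a small e at the rate 1/√n needs nearly optimal decisions. The circle
is broken in three stages. Forced exploration alone gives consistency: the self-normalised noise
inequality `lintegral_exp_noiseSum_le` and a net bound the accumulated squared prediction error by
O((log n)³), whereas about (log n)⁹ forced samples give a design matrix of that order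
(`prob_not_close_le`). Consistency then feeds an exponential Lyapunov function for |h|, run from
time about n^(1/N) to n, so h is small with probability 1 - O(n⁻³) (`prob_nrm_dev_gt_le`). Finally,
small h and e make the unforced decisions mostly optimal, so every alternative collects information
linearly in n (`prob_exists_quad_lt_le`); since the noise sum has second moment O(n), |e|² on the
good event has mean O(1/n) (`integral_goodSqErr_le`).

All constants are chosen for the parameters `q` before the instance `M` is introduced, which gives
the uniformity of D. -/

lemma iIndep_sumElim {ι₁ ι₂ Ω : Type*} {m0 : MeasurableSpace Ω} {P : Measure Ω}
    [IsProbabilityMeasure P]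
    {m₁ : ι₁ → MeasurableSpace Ω} {m₂ : ι₂ → MeasurableSpace Ω}
    (h₁ : iIndep m₁ P) (h₂ : iIndep m₂ P) (h : Indep (⨆ i, m₁ i) (⨆ i, m₂ i) P) :
    iIndep (Sum.elim m₁ m₂) P := by
  rw [iIndep_iff] at *
  intro s f hf
  have hs : (⋂ i ∈ s, f i) =
      (⋂ i ∈ s.toLeft, f (Sum.inl i)) ∩ (⋂ i ∈ s.toRight, f (Sum.inr i)) := by
    ext ω
    simp only [Set.mem_iInter, Set.mem_inter_iff, Finset.mem_toLeft, Finset.mem_toRight]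
    constructor
    · exact fun H => ⟨fun i hi => H _ hi, fun i hi => H _ hi⟩
    · rintro ⟨H1, H2⟩ (i | i) hi
      · exact H1 i hi
      · exact H2 i hi
  have hL : ∀ i ∈ s.toLeft, MeasurableSet[m₁ i] (f (Sum.inl i)) := fun i hi =>
    hf (Sum.inl i) (Finset.mem_toLeft.1 hi)
  have hR : ∀ i ∈ s.toRight, MeasurableSet[m₂ i] (f (Sum.inr i)) := fun i hi =>
    hf (Sum.inr i) (Finset.mem_toRight.1 hi)
  have e1 := h₁ s.toLeft (f := fun i => f (Sum.inl i)) hL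
  have e2 := h₂ s.toRight (f := fun i => f (Sum.inr i)) hR
  have e3 := (Indep_iff _ _ P).1 h (⋂ i ∈ s.toLeft, f (Sum.inl i))
    (⋂ i ∈ s.toRight, f (Sum.inr i))
    (Finset.measurableSet_biInter _ fun i hi => le_iSup m₁ i _ (hL i hi))
    (Finset.measurableSet_biInter _ fun i hi => le_iSup m₂ i _ (hR i hi))
  rw [hs, e3, e1, e2]
  conv_rhs => rw [← Finset.toLeft_disjSum_toRight (u := s), Finset.prod_disjSum]

/-! ### Constants, instances, and conditioning on the past -/

/-- Constants of the problem and parameters of the algorithm. -/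
structure Par (K d : ℕ) where
  κ₁ : ℝ
  κ₂ : ℝ
  κ₃ : ℝ
  κ₄ : ℝ
  κ₅ : ℝ
  κ₆ : ℝ
  κ₇ : ℝ
  κ₈ : ℝ
  α : ℝ
  a : ℝ
  R : ℝ
  r : ℕ → Fin K
  hκ₁ : 0 < κ₁
  hκ₂ : 0 < κ₂
  hκ₃ : 0 < κ₃
  hκ₄ : 0 < κ₄
  hκ₅ : 0 < κ₅
  hκ₆ : 0 < κ₆
  hκ₇ : 0 < κ₇
  hκ₈ : 0 < κ₈
  hα : 0 < α
  hα' : 1 ≤ α * (κ₂ * κ₅)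
  ha : 0 < a
  hR : 0 ≤ R
  rule : IsExplorationRule a r

/-- An instance of the problem with the given constants and parameters. -/
structure Model {K d : ℕ} (q : Par K d) where
  Ω : Type*
  [mΩ : MeasurableSpace Ω]
  P : Measure Ω
  [prob : IsProbabilityMeasure P]
  amin : (Fin K → ℝ) → Fin K
  p : Fin K → ℝ
  β : Fin K → EuclideanSpace ℝ (Fin d)
  gstar : Fin K → ℝ
  X : ℕ → Ω → EuclideanSpace ℝ (Fin d)
  ε : ℕ → Fin K → Ω → ℝ
  g0 : Fin K → ℝ
  b0 : Fin K → EuclideanSpace ℝ (Fin d)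
  hamin : IsArgminRule amin
  data : IsDataModel P p β gstar X ε
  rich : IsRich P q.κ₁ q.κ₂ q.κ₃ q.κ₄ q.κ₅ q.κ₆ β gstar (X 0)
  subG : IsCondSubGaussian P q.κ₇ X ε
  lam : ∀ k, q.κ₈ ≤ lambdaMin (restrictedMoment P amin β gstar (X 0) k)
  hβ : ∀ k, ‖β k‖ ≤ q.R
  hg0 : ∀ k, |g0 k| ≤ q.R

attribute [instance] Model.mΩ Model.prob

namespace Model

variable {K d : ℕ} {q : Par K d} (M : Model q)

/-- The pair of the sample and the noise vector of one period. -/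
def obs (n : ℕ) (ω : M.Ω) : EuclideanSpace ℝ (Fin d) × (Fin K → ℝ) :=
  (M.X n ω, fun k => M.ε n k ω)

/-- The information available after `n` periods. -/
@[reducible]
def past (n : ℕ) : MeasurableSpace M.Ω :=
  ⨆ i ∈ Finset.range n, MeasurableSpace.comap (M.obs i) inferInstance

lemma measurable_obs (n : ℕ) : Measurable (M.obs n) :=
  (M.data.measurable_X n).prodMk (measurable_pi_lambda _ fun k => M.data.measurable_noise n k)

lemma past_le (n : ℕ) : M.past n ≤ M.mΩ :=
  iSup₂_le fun i _ => (M.measurable_obs i).comap_le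

lemma past_mono {m n : ℕ} (h : m ≤ n) : M.past m ≤ M.past n :=
  biSup_mono fun i hi => by
    simp only [Finset.mem_range] at *
    omega

lemma measurable_obs_past {m n : ℕ} (h : m < n) : Measurable[M.past n] (M.obs m) := by
  have : MeasurableSpace.comap (M.obs m) inferInstance ≤ M.past n :=
    le_iSup₂_of_le m (Finset.mem_range.2 h) le_rfl
  exact (comap_measurable (M.obs m)).mono this le_rfl

/-- Samples and noises together form one independent family indexed by ℕ ⊕ (ℕ × Fin K); the past and
the present period use disjoint sets of indices. -/
lemma indep_past (n : ℕ) :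
    Indep (M.past n) (MeasurableSpace.comap (M.obs n) inferInstance) M.P := by
  set m₁ : ℕ → MeasurableSpace M.Ω := fun i => MeasurableSpace.comap (M.X i) inferInstance
    with hm₁
  set m₂ : ℕ × Fin K → MeasurableSpace M.Ω :=
    fun i => MeasurableSpace.comap (M.ε i.1 i.2) inferInstance with hm₂
  have c₁ : MeasurableSpace.comap (fun ω n => M.X n ω) inferInstance = ⨆ i, m₁ i := by
    simp only [hm₁, MeasurableSpace.pi, MeasurableSpace.comap_iSup, MeasurableSpace.comap_comp]
    rfl
  have c₂ : MeasurableSpace.comap (fun ω (q : ℕ × Fin K) => M.ε q.1 q.2 ω) inferInstance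
      = ⨆ i, m₂ i := by
    simp only [hm₂, MeasurableSpace.pi, MeasurableSpace.comap_iSup, MeasurableSpace.comap_comp]
    rfl
  have hI : iIndep (Sum.elim m₁ m₂) M.P := by
    refine iIndep_sumElim M.data.indep_X M.data.indep_noise ?_
    rw [← c₁, ← c₂]
    exact M.data.indep_X_noise
  have hle : ∀ i, Sum.elim m₁ m₂ i ≤ M.mΩ := by
    rintro (i | i)
    · exact (M.data.measurable_X i).comap_le
    · exact (M.data.measurable_noise i.1 i.2).comap_le
  have hobs : ∀ i, MeasurableSpace.comap (M.obs i) inferInstance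
      ≤ m₁ i ⊔ ⨆ k, m₂ (i, k) := by
    intro i
    have e : MeasurableSpace.comap (M.obs i) inferInstance
        = m₁ i ⊔ MeasurableSpace.comap (fun ω k => M.ε i k ω) inferInstance :=
      MeasurableSpace.comap_prodMk _ _
    rw [e]
    refine sup_le_sup_left ?_ _
    simp only [hm₂, MeasurableSpace.pi, MeasurableSpace.comap_iSup, MeasurableSpace.comap_comp]
    exact le_rfl
  have hd : Disjoint {i : ℕ ⊕ (ℕ × Fin K) | Sum.elim id Prod.fst i < n}
      {i | Sum.elim id Prod.fst i = n} := by
    rw [Set.disjoint_left]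
    intro i hi hj
    simp only [Set.mem_ofPred_eq] at hi hj
    omega
  have := indep_iSup_of_disjoint hle hI hd
  refine indep_of_indep_of_le_left (indep_of_indep_of_le_right this ?_) ?_
  · refine (hobs n).trans (sup_le ?_ (iSup_le fun k => ?_))
    · exact le_iSup₂_of_le (f := fun i (_ : i ∈ {i | Sum.elim id Prod.fst i = n}) =>
        Sum.elim m₁ m₂ i) (Sum.inl n) rfl le_rfl
    · exact le_iSup₂_of_le (f := fun i (_ : i ∈ {i | Sum.elim id Prod.fst i = n}) =>
        Sum.elim m₁ m₂ i) (Sum.inr (n, k)) rfl le_rfl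
  · refine iSup₂_le fun i hi => (hobs i).trans (sup_le ?_ (iSup_le fun k => ?_))
    · exact le_iSup₂_of_le (f := fun i (_ : i ∈ {i | Sum.elim id Prod.fst i < n}) =>
        Sum.elim m₁ m₂ i) (Sum.inl i) (Finset.mem_range.1 hi) le_rfl
    · exact le_iSup₂_of_le (f := fun i (_ : i ∈ {i | Sum.elim id Prod.fst i < n}) =>
        Sum.elim m₁ m₂ i) (Sum.inr (i, k)) (Finset.mem_range.1 hi) le_rfl

lemma indep_X_noise_at (n : ℕ) :
    IndepFun (M.X n) (fun ω k => M.ε n k ω) M.P := by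
  have hφ : Measurable fun x : ℕ → EuclideanSpace ℝ (Fin d) => x n := measurable_pi_apply n
  have hψ : Measurable fun (e : ℕ × Fin K → ℝ) (k : Fin K) => e (n, k) :=
    measurable_pi_lambda _ fun k => measurable_pi_apply (n, k)
  exact M.data.indep_X_noise.comp hφ hψ

lemma map_obs (n : ℕ) : M.P.map (M.obs n) = M.P.map (M.obs 0) := by
  have key : ∀ n, M.P.map (M.obs n)
      = (M.P.map (M.X n)).prod (Measure.pi fun k => M.P.map (M.ε n k)) := by
    intro n
    have h1 := (indepFun_iff_map_prod_eq_prod_map_map (M.data.measurable_X n).aemeasurable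
      (measurable_pi_lambda _ fun k => M.data.measurable_noise n k).aemeasurable).1
      (M.indep_X_noise_at n)
    have h2 : iIndepFun (fun k => M.ε n k) M.P :=
      M.data.indep_noise.precomp (g := fun k : Fin K => (n, k)) (fun a b h => by simpa using h)
    have h3 := (iIndepFun_iff_map_fun_eq_pi_map
      (fun k => (M.data.measurable_noise n k).aemeasurable)).1 h2
    rw [← h3]
    exact h1
  rw [key, key, (M.data.ident_X n).map_eq]
  congr 2
  funext k
  exact (M.data.ident_noise n 0 k k).map_eq

/-- This replaces conditional expectation given the past: anything determined by the past is frozen,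
and the fresh observation becomes an independent copy of the one of period 0. Every one-step
estimate below passes through it. -/
lemma lintegral_step {𝒜 : Type*} [MeasurableSpace 𝒜] {n : ℕ} {A : M.Ω → 𝒜}
    (hA : Measurable[M.past n] A)
    {f : 𝒜 → EuclideanSpace ℝ (Fin d) × (Fin K → ℝ) → ENNReal}
    (hf : Measurable (Function.uncurry f)) :
    ∫⁻ ω, f (A ω) (M.obs n ω) ∂M.P = ∫⁻ ω, ∫⁻ ω', f (A ω) (M.obs 0 ω') ∂M.P ∂M.P := by
  have hA' : Measurable A := hA.mono (M.past_le n) le_rfl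
  have hind : IndepFun A (M.obs n) M.P :=
    indep_of_indep_of_le_left (M.indep_past n) (measurable_iff_comap_le.1 hA)
  have h1 := (indepFun_iff_map_prod_eq_prod_map_map hA'.aemeasurable
    (M.measurable_obs n).aemeasurable).1 hind
  have h2 : ∫⁻ ω, f (A ω) (M.obs n ω) ∂M.P
      = ∫⁻ z, Function.uncurry f z ∂(M.P.map fun ω => (A ω, M.obs n ω)) :=
    (lintegral_map hf (hA'.prodMk (M.measurable_obs n))).symm
  have hp : IsProbabilityMeasure (M.P.map (M.obs 0)) :=
    Measure.isProbabilityMeasure_map (M.measurable_obs 0).aemeasurable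
  rw [h2, h1, M.map_obs n, lintegral_prod _ hf.aemeasurable,
    lintegral_map hf.lintegral_prod_right' hA']
  refine lintegral_congr fun ω => ?_
  exact lintegral_map (hf.comp measurable_prodMk_left) (M.measurable_obs 0)

lemma integral_step {𝒜 : Type*} [MeasurableSpace 𝒜] {n : ℕ} {A : M.Ω → 𝒜}
    (hA : Measurable[M.past n] A)
    {f : 𝒜 → EuclideanSpace ℝ (Fin d) × (Fin K → ℝ) → ℝ}
    (hf : Measurable (Function.uncurry f))
    (hi : Integrable (fun ω => f (A ω) (M.obs n ω)) M.P) :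
    Integrable (fun ω => ∫ ω', f (A ω) (M.obs 0 ω') ∂M.P) M.P ∧
    ∫ ω, f (A ω) (M.obs n ω) ∂M.P = ∫ ω, ∫ ω', f (A ω) (M.obs 0 ω') ∂M.P ∂M.P := by
  have hA' : Measurable A := hA.mono (M.past_le n) le_rfl
  have hind : IndepFun A (M.obs n) M.P :=
    indep_of_indep_of_le_left (M.indep_past n) (measurable_iff_comap_le.1 hA)
  have h1 := (indepFun_iff_map_prod_eq_prod_map_map hA'.aemeasurable
    (M.measurable_obs n).aemeasurable).1 hind
  have hm : Measurable fun ω => (A ω, M.obs n ω) := hA'.prodMk (M.measurable_obs n)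
  have h2 : ∫ ω, f (A ω) (M.obs n ω) ∂M.P
      = ∫ z, Function.uncurry f z ∂(M.P.map fun ω => (A ω, M.obs n ω)) :=
    (integral_map hm.aemeasurable hf.aestronglyMeasurable).symm
  have hi2 : Integrable (Function.uncurry f) (M.P.map fun ω => (A ω, M.obs n ω)) :=
    (integrable_map_measure hf.aestronglyMeasurable hm.aemeasurable).2 hi
  have hp : IsProbabilityMeasure (M.P.map (M.obs 0)) :=
    Measure.isProbabilityMeasure_map (M.measurable_obs 0).aemeasurable
  rw [h1, M.map_obs n] at hi2
  have e : ∀ ω, ∫ ω', f (A ω) (M.obs 0 ω') ∂M.P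
      = ∫ y, Function.uncurry f (A ω, y) ∂(M.P.map (M.obs 0)) := fun ω =>
    (integral_map (M.measurable_obs 0).aemeasurable
      (hf.comp measurable_prodMk_left).aestronglyMeasurable).symm
  simp_rw [e]
  have hi3 := hi2.integral_prod_left
  refine ⟨(integrable_map_measure hi3.aestronglyMeasurable hA'.aemeasurable).1 hi3, ?_⟩
  rw [h2, h1, M.map_obs n, integral_prod _ hi2,
    integral_map hA'.aemeasurable hi3.aestronglyMeasurable]

end Model

/-! ### The processes generated by the algorithm -/

lemma measurable_adjustedCost {K d : ℕ} {Ω : Type*} [MeasurableSpace Ω]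
    {b : Ω → Fin K → EuclideanSpace ℝ (Fin d)} {g : Ω → Fin K → ℝ}
    {x : Ω → EuclideanSpace ℝ (Fin d)} (hb : Measurable b) (hg : Measurable g)
    (hx : Measurable x) : Measurable fun ω => adjustedCost (b ω) (g ω) (x ω) := by
  refine measurable_pi_lambda _ fun j => ?_
  exact (((measurable_pi_apply j).comp hb).inner hx).sub ((measurable_pi_apply j).comp hg)

/-- The inverse is det⁻¹ times the adjugate, both measurable functions of the entries; the
convention 0⁻¹ = 0 makes this valid for singular matrices too. -/
lemma measurable_matrix_inv_apply {d : ℕ} {Ω : Type*} [MeasurableSpace Ω]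
    {A : Ω → Matrix (Fin d) (Fin d) ℝ} (hA : ∀ i j, Measurable fun ω => A ω i j) (i j : Fin d) :
    Measurable fun ω => (A ω)⁻¹ i j := by
  have hc : Continuous fun f : Fin d → Fin d → ℝ => (Matrix.of f : Matrix (Fin d) (Fin d) ℝ) :=
    continuous_matrix fun i j => (continuous_apply j).comp (continuous_apply i)
  have hF : Measurable fun f : Fin d → Fin d → ℝ =>
      (Matrix.of f : Matrix (Fin d) (Fin d) ℝ).det⁻¹
        * (Matrix.of f : Matrix (Fin d) (Fin d) ℝ).adjugate i j :=
    (Continuous.measurable hc.matrix_det).inv.mul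
      (Continuous.measurable (hc.matrix_adjugate.matrix_elem i j))
  have hA' : Measurable fun ω => (fun i j => A ω i j : Fin d → Fin d → ℝ) :=
    measurable_pi_lambda _ fun i => measurable_pi_lambda _ fun j => hA i j
  have h := hF.comp hA'
  have e : (fun ω => (A ω)⁻¹ i j) = (fun f : Fin d → Fin d → ℝ =>
      (Matrix.of f : Matrix (Fin d) (Fin d) ℝ).det⁻¹
        * (Matrix.of f : Matrix (Fin d) (Fin d) ℝ).adjugate i j)
        ∘ fun ω => (fun i j => A ω i j : Fin d → Fin d → ℝ) := by
    funext ω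
    rw [Matrix.inv_def, Ring.inverse_eq_inv', Matrix.smul_apply, smul_eq_mul]
    rfl
  rw [e]
  exact h

lemma measurable_comp₂ {Ω A B C : Type*} {m : MeasurableSpace Ω} [MeasurableSpace A]
    [MeasurableSpace B] [MeasurableSpace C] {F : A → B → C}
    (hF : Measurable (Function.uncurry F)) {f : Ω → A} {g : Ω → B} (hf : Measurable f)
    (hg : Measurable g) : Measurable fun ω => F (f ω) (g ω) :=
  hF.comp (hf.prodMk hg)

lemma measurable_sum_ite {Ω E : Type*} {K : ℕ} {m : MeasurableSpace Ω} [NormedAddCommGroup E]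
    [MeasurableSpace E] [BorelSpace E] [SecondCountableTopology E] {s : Finset ℕ}
    {F : ℕ → Ω → E} {J : ℕ → Ω → Fin K} (k : Fin K)
    (hF : ∀ i ∈ s, Measurable (F i)) (hJ : ∀ i ∈ s, Measurable (J i)) :
    Measurable fun ω => ∑ i ∈ s, if J i ω = k then F i ω else 0 :=
  Finset.measurable_sum _ fun i hi =>
    Measurable.ite (hJ i hi (measurableSet_singleton k)) (hF i hi) measurable_const

/-- Componentwise measurability of a random state. -/
structure MeasurableState {K d : ℕ} {Ω : Type*} (m : MeasurableSpace Ω) (s : Ω → State K d) :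
    Prop where
  g : Measurable[m] fun ω => (s ω).g
  b : Measurable[m] fun ω => (s ω).b
  V : ∀ k i j, Measurable[m] fun ω => (s ω).V k i j
  u : ∀ k i, Measurable[m] fun ω => (s ω).u k i

lemma MeasurableState.plugIn {K d : ℕ} {Ω : Type*} [m : MeasurableSpace Ω] {s : Ω → State K d}
    (hs : MeasurableState m s) {amin : (Fin K → ℝ) → Fin K} (ha : Measurable amin)
    {x : Ω → EuclideanSpace ℝ (Fin d)} (hx : Measurable x) :
    Measurable fun ω => plugIn amin (s ω) (x ω) :=
  ha.comp (measurable_adjustedCost hs.b hs.g hx)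

lemma MeasurableState.semiMyopic {K d : ℕ} {Ω : Type*} [m : MeasurableSpace Ω]
    {s : Ω → State K d}
    (hs : MeasurableState m s) {amin : (Fin K → ℝ) → Fin K} (ha : Measurable amin) (a : ℝ)
    (r : ℕ → Fin K) (n : ℕ) {x : Ω → EuclideanSpace ℝ (Fin d)} (hx : Measurable x) :
    Measurable fun ω => semiMyopic amin a r n (s ω) (x ω) := by
  unfold SemidiscreteOT.semiMyopic
  split_ifs
  · exact measurable_const
  · exact hs.plugIn ha hx

lemma MeasurableState.step {K d : ℕ} {Ω : Type*} [m : MeasurableSpace Ω] {s : Ω → State K d}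
    (hs : MeasurableState m s) {amin : (Fin K → ℝ) → Fin K} (ha : Measurable amin)
    (α a : ℝ) (r : ℕ → Fin K) (p : Fin K → ℝ) (β : Fin K → EuclideanSpace ℝ (Fin d)) (n : ℕ)
    {x : Ω → EuclideanSpace ℝ (Fin d)} (hx : Measurable x) {e : Ω → Fin K → ℝ}
    (he : Measurable e) :
    MeasurableState m fun ω => step amin α a r p β n (s ω) (x ω) (e ω) := by
  have hh := hs.plugIn ha hx
  have hπ := hs.semiMyopic ha a r n hx
  have hxi : ∀ i, Measurable fun ω => x ω i := fun i => by fun_prop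
  have hV : ∀ k i j, Measurable fun ω =>
      ((SemidiscreteOT.step amin α a r p β n (s ω) (x ω) (e ω)).V k i j) := by
    intro k i j
    have : (fun ω => (SemidiscreteOT.step amin α a r p β n (s ω) (x ω) (e ω)).V k i j)
        = fun ω => (s ω).V k i j +
          if SemidiscreteOT.semiMyopic amin a r n (s ω) (x ω) = k then x ω i * x ω j else 0 := by
      funext ω
      simp only [SemidiscreteOT.step, Matrix.add_apply]
      split_ifs <;> simp [Matrix.vecMulVec_apply]
    rw [this]
    exact (hs.V k i j).add (Measurable.ite (hπ (measurableSet_singleton k))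
      ((hxi i).mul (hxi j)) measurable_const)
  have hu : ∀ k i, Measurable fun ω =>
      ((SemidiscreteOT.step amin α a r p β n (s ω) (x ω) (e ω)).u k i) := by
    intro k i
    have : (fun ω => (SemidiscreteOT.step amin α a r p β n (s ω) (x ω) (e ω)).u k i)
        = fun ω => (s ω).u k i +
          if SemidiscreteOT.semiMyopic amin a r n (s ω) (x ω) = k
            then (inner ℝ (β k) (x ω) + e ω k) * x ω i else 0 := by
      funext ω
      simp only [SemidiscreteOT.step, Pi.add_apply]
      split_ifs with h <;> simp [h]
    rw [this]
    have hek : Measurable fun ω => e ω k := (measurable_pi_apply k).comp he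
    have hin : Measurable fun ω => (inner ℝ (β k) (x ω) : ℝ) := measurable_const.inner hx
    exact (hs.u k i).add (Measurable.ite (hπ (measurableSet_singleton k))
      ((hin.add hek).mul (hxi i)) measurable_const)
  refine ⟨?_, ?_, hV, hu⟩
  · refine measurable_pi_lambda _ fun k => ?_
    refine ((measurable_pi_apply k).comp hs.g).add (measurable_const.mul
      (Measurable.add (Measurable.neg (Measurable.ite ?_ measurable_const measurable_const))
        measurable_const))
    have : {ω | k = SemidiscreteOT.plugIn amin (s ω) (x ω)}
      = (fun ω => SemidiscreteOT.plugIn amin (s ω) (x ω)) ⁻¹' {k} := by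
      ext ω; simp [eq_comm]
    rw [this]
    exact hh (measurableSet_singleton k)
  · refine measurable_pi_lambda _ fun k => ?_
    refine (WithLp.measurable_toLp 2 _).comp (measurable_pi_lambda _ fun i => ?_)
    simp only [Matrix.mulVec, dotProduct]
    refine Finset.measurable_sum _ fun j _ => ?_
    refine Measurable.mul ?_ (hu k j)
    refine measurable_matrix_inv_apply (fun i j => ?_) i j
    simp only [Matrix.add_apply]
    exact measurable_const.add (hV k i j)

namespace Model

variable {K d : ℕ} {q : Par K d} (M : Model q)

/-- The state of the algorithm after `n` periods. -/
def state (n : ℕ) (ω : M.Ω) : State K d :=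
  run M.amin q.α q.a q.r M.p M.β M.g0 M.b0 (fun m => M.X m ω) (fun m k => M.ε m k ω) n

/-- The decision `argmin_j (b_j^T x - g_j)`. -/
def dec (s : (Fin K → ℝ) × (Fin K → EuclideanSpace ℝ (Fin d))) (x : EuclideanSpace ℝ (Fin d)) :
    Fin K :=
  M.amin (adjustedCost s.2 s.1 x)

/-- The optimal decision. -/
def opt (x : EuclideanSpace ℝ (Fin d)) : Fin K :=
  M.amin (adjustedCost M.β M.gstar x)

/-- The pair of the dual vector and the regression coefficients after `n` periods. -/
def est (n : ℕ) (ω : M.Ω) : (Fin K → ℝ) × (Fin K → EuclideanSpace ℝ (Fin d)) :=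
  ((M.state n ω).g, (M.state n ω).b)

/-- The semi-myopic decision in period `n`. -/
def policy (n : ℕ) (s : (Fin K → ℝ) × (Fin K → EuclideanSpace ℝ (Fin d)))
    (x : EuclideanSpace ℝ (Fin d)) : Fin K :=
  if IsForced K q.a n then q.r n else M.dec s x

/-- The alternative selected in period `n`. -/
def sel (n : ℕ) (ω : M.Ω) : Fin K :=
  M.policy n (M.est n ω) (M.X n ω)

/-- The deviation of `g` from `gstar`, shifted so that its components add up to zero when those
of `g` and `g0` have the same sum. -/
def shiftDev (g : Fin K → ℝ) (k : Fin K) : ℝ :=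
  g k - M.gstar k - (∑ j, (M.g0 j - M.gstar j)) / K

/-- The deviation of the dual vector after `n` periods. -/
def dev (n : ℕ) (ω : M.Ω) : Fin K → ℝ :=
  M.shiftDev (M.est n ω).1

/-- The accumulated squares of `θ^T X` over the selections of `k`. -/
def quad (n : ℕ) (k : Fin K) (θ : EuclideanSpace ℝ (Fin d)) (ω : M.Ω) : ℝ :=
  ∑ i ∈ Finset.range n, if M.sel i ω = k then (inner ℝ θ (M.X i ω) : ℝ) ^ 2 else 0

/-- The accumulated products of noise and sample over the selections of `k`. -/
def noiseSum (n : ℕ) (k : Fin K) (ω : M.Ω) : EuclideanSpace ℝ (Fin d) :=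
  ∑ i ∈ Finset.range n, if M.sel i ω = k then M.ε i k ω • M.X i ω else 0

/-- The estimation error of the regression coefficients after `n` periods. -/
def err (n : ℕ) (k : Fin K) (ω : M.Ω) : EuclideanSpace ℝ (Fin d) :=
  (M.est n ω).2 k - M.β k

lemma K_pos (q : Par K d) : 0 < K := Fin.pos (q.r 0)

/-- Period m uses only observation m, so the state after n periods depends on the first n
observations. This is what allows it to be frozen in `lintegral_step`. -/
lemma measurableState (n : ℕ) : MeasurableState (M.past n) (M.state n) := by
  induction n with
  | zero =>
    constructor
    · exact measurable_const
    · exact measurable_const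
    · exact fun k i j => measurable_const
    · exact fun k i => measurable_const
  | succ n ih =>
    have hle := M.past_mono n.le_succ
    have ih' : MeasurableState (M.past (n + 1)) (M.state n) :=
      ⟨ih.g.mono hle le_rfl, ih.b.mono hle le_rfl, fun k i j => (ih.V k i j).mono hle le_rfl,
        fun k i => (ih.u k i).mono hle le_rfl⟩
    have ho := M.measurable_obs_past n.lt_succ_self
    exact @MeasurableState.step K d M.Ω (M.past (n + 1)) (M.state n) ih' M.amin
      M.hamin.measurable q.α q.a q.r M.p M.β n (M.X n) (measurable_fst.comp ho)
      (fun ω k => M.ε n k ω) (measurable_snd.comp ho)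

lemma measurable_est (n : ℕ) : Measurable[M.past n] (M.est n) :=
  measurable_comp₂ (F := fun g b => (g, b)) measurable_id (M.measurableState n).g
    (M.measurableState n).b

lemma measurable_dec : Measurable (Function.uncurry M.dec) :=
  M.hamin.measurable.comp (measurable_adjustedCost (measurable_snd.comp measurable_fst)
    (measurable_fst.comp measurable_fst) measurable_snd)

lemma measurable_opt : Measurable M.opt :=
  M.hamin.measurable.comp (measurable_adjustedCost measurable_const measurable_const
    measurable_id)

lemma measurable_policy (n : ℕ) : Measurable (Function.uncurry (M.policy n)) := by
  have : Function.uncurry (M.policy n)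
      = fun z => if IsForced K q.a n then q.r n else Function.uncurry M.dec z := rfl
  rw [this]
  split_ifs
  · exact measurable_const
  · exact M.measurable_dec

lemma measurable_X_past {m n : ℕ} (h : m < n) : Measurable[M.past n] (M.X m) :=
  measurable_fst.comp (M.measurable_obs_past h)

lemma measurable_noise_past {m n : ℕ} (h : m < n) (k : Fin K) :
    Measurable[M.past n] (M.ε m k) :=
  (measurable_pi_apply k).comp (measurable_snd.comp (M.measurable_obs_past h))

lemma measurable_sel_past {m n : ℕ} (h : m < n) : Measurable[M.past n] (M.sel m) := by
  have h1 : Measurable[M.past n] (M.est m) := (M.measurable_est m).mono (M.past_mono h.le) le_rfl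
  exact measurable_comp₂ (M.measurable_policy m) h1 (M.measurable_X_past h)

lemma measurable_quad (n : ℕ) (k : Fin K) (θ : EuclideanSpace ℝ (Fin d)) :
    Measurable[M.past n] (M.quad n k θ) := by
  have : Measurable fun x : EuclideanSpace ℝ (Fin d) => (inner ℝ θ x : ℝ) ^ 2 := by fun_prop
  exact measurable_sum_ite (s := Finset.range n) k
    (fun i hi => this.comp (M.measurable_X_past (Finset.mem_range.1 hi)))
    fun i hi => M.measurable_sel_past (Finset.mem_range.1 hi)

lemma measurable_noiseSum (n : ℕ) (k : Fin K) : Measurable[M.past n] (M.noiseSum n k) := by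
  have : Measurable (Function.uncurry fun (c : ℝ) (x : EuclideanSpace ℝ (Fin d)) => c • x) := by
    fun_prop
  exact measurable_sum_ite (s := Finset.range n) k (fun i hi => measurable_comp₂ this
    (M.measurable_noise_past (Finset.mem_range.1 hi) k)
    (M.measurable_X_past (Finset.mem_range.1 hi)))
    fun i hi => M.measurable_sel_past (Finset.mem_range.1 hi)

lemma measurable_shiftDev : Measurable M.shiftDev :=
  measurable_pi_lambda _ fun k =>
    ((measurable_pi_apply k).sub measurable_const).sub measurable_const

lemma measurable_dev (n : ℕ) : Measurable[M.past n] (M.dev n) :=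
  M.measurable_shiftDev.comp (measurable_fst.comp (M.measurable_est n))

lemma measurable_err (n : ℕ) (k : Fin K) : Measurable[M.past n] (M.err n k) := by
  have : Measurable fun s : (Fin K → ℝ) × (Fin K → EuclideanSpace ℝ (Fin d)) =>
    s.2 k - M.β k := ((measurable_pi_apply k).comp measurable_snd).sub measurable_const
  exact this.comp (M.measurable_est n)

/-! ### The error of the ridge regression -/

lemma dotProduct_ofLp (x y : EuclideanSpace ℝ (Fin d)) :
    x.ofLp ⬝ᵥ y.ofLp = (inner ℝ x y : ℝ) := by
  rw [EuclideanSpace.inner_eq_star_dotProduct, dotProduct_comm]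
  simp

/-- Testing against vectors turns the accumulated matrices into sums of products, so that the matrix
inverse enters only once, in `err_identity`. -/
lemma V_bilin (n : ℕ) (k : Fin K) (x y : EuclideanSpace ℝ (Fin d)) (ω : M.Ω) :
    x.ofLp ⬝ᵥ ((M.state n ω).V k).mulVec y.ofLp
      = ∑ i ∈ Finset.range n, if M.sel i ω = k then
          (inner ℝ x (M.X i ω) : ℝ) * inner ℝ y (M.X i ω) else 0 := by
  induction n with
  | zero => simp [state, run]
  | succ n ih =>
    have : (M.state (n + 1) ω).V k = (M.state n ω).V k +
        if M.sel n ω = k then Matrix.vecMulVec (M.X n ω).ofLp (M.X n ω).ofLp else 0 := rfl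
    rw [this, Matrix.add_mulVec, dotProduct_add, ih, Finset.sum_range_succ]
    congr 1
    split_ifs
    · rw [Matrix.vecMulVec_mulVec, dotProduct_smul, dotProduct_ofLp, dotProduct_ofLp]
      rw [real_inner_comm y]
      rfl
    · simp

lemma u_inner (n : ℕ) (k : Fin K) (x : EuclideanSpace ℝ (Fin d)) (ω : M.Ω) :
    x.ofLp ⬝ᵥ (M.state n ω).u k
      = ∑ i ∈ Finset.range n, if M.sel i ω = k then
          ((inner ℝ (M.β k) (M.X i ω) : ℝ) + M.ε i k ω) * inner ℝ x (M.X i ω) else 0 := by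
  induction n with
  | zero => simp [state, run]
  | succ n ih =>
    have : (M.state (n + 1) ω).u k = (M.state n ω).u k +
        if M.sel n ω = k then ((inner ℝ (M.β (M.sel n ω)) (M.X n ω) : ℝ)
          + M.ε n (M.sel n ω) ω) • (M.X n ω).ofLp else 0 := rfl
    rw [this, dotProduct_add, ih, Finset.sum_range_succ]
    congr 1
    split_ifs with h
    · rw [dotProduct_smul, dotProduct_ofLp, h, smul_eq_mul]
    · simp

lemma ridgeParam_ge (n : ℕ) : 1 ≤ ridgeParam (n + 1) := by
  unfold ridgeParam
  have : 0 ≤ Real.log ((n + 1 : ℕ) : ℝ) := Real.log_natCast_nonneg _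
  have : 0 ≤ Real.log ((n + 1 : ℕ) : ℝ) ^ 3 := by positivity
  linarith

/-- The normal equation of the ridge regression, tested against the error itself. The noise enters
linearly on the right and the design quadratically on the left, so both the consistency and the rate
of the regression follow from it. -/
lemma err_identity (n : ℕ) (k : Fin K) (ω : M.Ω) :
    ridgeParam (n + 1) * ‖M.err (n + 1) k ω‖ ^ 2 + M.quad (n + 1) k (M.err (n + 1) k ω) ω
      = inner ℝ (M.err (n + 1) k ω) (M.noiseSum (n + 1) k ω)
        - ridgeParam (n + 1) * inner ℝ (M.err (n + 1) k ω) (M.β k) := by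
  set ρ := ridgeParam (n + 1) with hρ
  set A : Matrix (Fin d) (Fin d) ℝ :=
    ρ • (1 : Matrix (Fin d) (Fin d) ℝ) + (M.state (n + 1) ω).V k with hA
  set b := (M.est (n + 1) ω).2 k with hb
  have hbil : ∀ x y : EuclideanSpace ℝ (Fin d), x.ofLp ⬝ᵥ A.mulVec y.ofLp
      = ρ * inner ℝ x y + ∑ i ∈ Finset.range (n + 1), if M.sel i ω = k then
          (inner ℝ x (M.X i ω) : ℝ) * inner ℝ y (M.X i ω) else 0 := by
    intro x y
    rw [hA, Matrix.add_mulVec, dotProduct_add, V_bilin, Matrix.smul_mulVec, Matrix.one_mulVec,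
      dotProduct_smul, dotProduct_ofLp, smul_eq_mul]
  -- The ridge term makes the matrix positive definite: on a kernel vector the quadratic form would
  -- vanish, although it is at least ρ times the squared norm.
  have hdet : A.det ≠ 0 := by
    intro h0
    obtain ⟨v, hv, hv0⟩ := Matrix.exists_mulVec_eq_zero_iff.2 h0
    have := hbil (WithLp.toLp 2 v) (WithLp.toLp 2 v)
    simp only [hv0, dotProduct_zero] at this
    have h1 : 0 ≤ ∑ i ∈ Finset.range (n + 1), if M.sel i ω = k then
          (inner ℝ (WithLp.toLp 2 v) (M.X i ω) : ℝ) * inner ℝ (WithLp.toLp 2 v) (M.X i ω)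
            else 0 :=
      Finset.sum_nonneg fun i _ => by split_ifs; exacts [mul_self_nonneg _, le_rfl]
    have h2 : 0 < (inner ℝ (WithLp.toLp 2 v) (WithLp.toLp 2 v) : ℝ) := by
      rw [real_inner_self_eq_norm_sq]
      have : WithLp.toLp 2 v ≠ 0 := fun h => hv (by simpa using h)
      positivity
    have h3 := ridgeParam_ge n
    nlinarith
  have hAb : A.mulVec b.ofLp = (M.state (n + 1) ω).u k := by
    have : b.ofLp = A⁻¹.mulVec ((M.state (n + 1) ω).u k) := rfl
    rw [this, Matrix.mulVec_mulVec, Matrix.mul_nonsing_inv A (isUnit_iff_ne_zero.2 hdet),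
      Matrix.one_mulVec]
  set e := M.err (n + 1) k ω with he
  have hbe : b = e + M.β k := by simp [he, err, hb]
  have h1 : e.ofLp ⬝ᵥ A.mulVec b.ofLp = _ := hbil e b
  rw [hAb, u_inner, hbe] at h1
  simp only [quad, noiseSum]
  rw [inner_sum]
  have hsum : ∀ (F G : ℕ → ℝ), (∑ i ∈ Finset.range (n + 1), if M.sel i ω = k then F i + G i else 0)
      = (∑ i ∈ Finset.range (n + 1), if M.sel i ω = k then F i else 0)
        + ∑ i ∈ Finset.range (n + 1), if M.sel i ω = k then G i else 0 := by
    intro F G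
    rw [← Finset.sum_add_distrib]
    exact Finset.sum_congr rfl fun i _ => by split_ifs <;> simp
  simp only [add_mul, inner_add_left, mul_add, inner_add_right, hsum] at h1
  rw [real_inner_self_eq_norm_sq] at h1
  have e1 : (∑ i ∈ Finset.range (n + 1), if M.sel i ω = k then (inner ℝ e (M.X i ω) : ℝ) ^ 2 else 0)
      = ∑ i ∈ Finset.range (n + 1), if M.sel i ω = k then
        (inner ℝ e (M.X i ω) : ℝ) * inner ℝ e (M.X i ω) else 0 := by
    simp only [sq]
  have e2 : (∑ i ∈ Finset.range (n + 1),
        (inner ℝ e (if M.sel i ω = k then M.ε i k ω • M.X i ω else 0) : ℝ))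
      = ∑ i ∈ Finset.range (n + 1), if M.sel i ω = k then
        M.ε i k ω * inner ℝ e (M.X i ω) else 0 := by
    refine Finset.sum_congr rfl fun i _ => ?_
    split_ifs <;> simp [inner_smul_right]
  have e3 : (∑ i ∈ Finset.range (n + 1), if M.sel i ω = k then
        (inner ℝ e (M.X i ω) : ℝ) * inner ℝ (M.β k) (M.X i ω) else 0)
      = ∑ i ∈ Finset.range (n + 1), if M.sel i ω = k then
        (inner ℝ (M.β k) (M.X i ω) : ℝ) * inner ℝ e (M.X i ω) else 0 := by
    simp only [mul_comm]
  rw [e1, e2]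
  rw [e3] at h1
  linarith

end Model

/-! ### One period: margins, misclassification, optimality -/

lemma real_mono_ae {Ω : Type*} [MeasurableSpace Ω] {P : Measure Ω} [IsFiniteMeasure P]
    {s t : Set Ω} (h : ∀ᵐ ω ∂P, ω ∈ s → ω ∈ t) : P.real s ≤ P.real t :=
  ENNReal.toReal_mono (measure_ne_top P t) (measure_mono_ae h)

lemma integrable_comp_fin {Ω : Type*} [MeasurableSpace Ω] {P : Measure Ω} [IsFiniteMeasure P]
    {K : ℕ} (v : Fin K → ℝ) {J : Ω → Fin K} (hJ : Measurable J) :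
    Integrable (fun ω => v (J ω)) P := by
  refine Integrable.of_bound ((measurable_of_finite v).comp hJ).aestronglyMeasurable
    (∑ k, |v k|) (Eventually.of_forall fun ω => ?_)
  exact Finset.single_le_sum (f := fun k => |v k|) (fun k _ => abs_nonneg _) (Finset.mem_univ _)

lemma integral_indicator_const_real {Ω : Type*} [MeasurableSpace Ω] {P : Measure Ω}
    {s : Set Ω} (hs : MeasurableSet s) (c : ℝ) :
    ∫ ω, s.indicator (fun _ => c) ω ∂P = P.real s * c := by
  rw [integral_indicator hs, setIntegral_const, smul_eq_mul]

namespace Model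

variable {K d : ℕ} {q : Par K d} (M : Model q)

/-- The margin `Z_{j,k}` at the first sample. -/
def Z (j k : Fin K) (ω : M.Ω) : ℝ := margin M.β M.gstar j k (M.X 0 ω)

/-- The coefficients `b` are within `δ` of the true ones. -/
def Close (δ : ℝ) (s : (Fin K → ℝ) × (Fin K → EuclideanSpace ℝ (Fin d))) : Prop :=
  ∀ k, ‖s.2 k - M.β k‖ ≤ δ

lemma measurable_margin (j k : Fin K) : Measurable (margin M.β M.gstar j k) := by
  have h := measurable_adjustedCost (K := K) (d := d) (Ω := EuclideanSpace ℝ (Fin d))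
    (b := fun _ => M.β) (g := fun _ => M.gstar) (x := id) measurable_const measurable_const
    measurable_id
  exact ((measurable_pi_apply j).comp h).sub ((measurable_pi_apply k).comp h)

lemma measurable_X (n : ℕ) : Measurable (M.X n) := M.data.measurable_X n

lemma measurable_Z (j k : Fin K) : Measurable (M.Z j k) :=
  (M.measurable_margin j k).comp (M.measurable_X 0)

lemma margin_add (j k l : Fin K) (x : EuclideanSpace ℝ (Fin d)) :
    margin M.β M.gstar j l x = margin M.β M.gstar j k x + margin M.β M.gstar k l x := by
  simp [margin]

lemma opt_margin (x : EuclideanSpace ℝ (Fin d)) (l : Fin K) :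
    0 ≤ margin M.β M.gstar l (M.opt x) x := by
  have := M.hamin.le (adjustedCost M.β M.gstar x) l
  simpa [margin, opt] using this

/-- The chosen index minimises the estimated adjusted cost. Passing to the true cost changes each of
the two linear terms by at most κ₆δ, and the dual variables account for the difference of
deviations. -/
lemma dec_margin {δ : ℝ} {s : (Fin K → ℝ) × (Fin K → EuclideanSpace ℝ (Fin d))}
    (hs : M.Close δ s) {x : EuclideanSpace ℝ (Fin d)} (hx : ‖x‖ ≤ q.κ₆) (l : Fin K) :
    margin M.β M.gstar (M.dec s x) l x
      ≤ M.shiftDev s.1 (M.dec s x) - M.shiftDev s.1 l + 2 * q.κ₆ * δ := by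
  have h := M.hamin.le (adjustedCost s.2 s.1 x) l
  change adjustedCost s.2 s.1 x (M.dec s x) ≤ _ at h
  set j := M.dec s x
  have hb : ∀ k, |(inner ℝ (s.2 k) x : ℝ) - inner ℝ (M.β k) x| ≤ q.κ₆ * δ := by
    intro k
    rw [← inner_sub_left]
    calc |(inner ℝ (s.2 k - M.β k) x : ℝ)| ≤ ‖s.2 k - M.β k‖ * ‖x‖ := abs_real_inner_le_norm _ _
      _ ≤ δ * q.κ₆ := mul_le_mul (hs k) hx (norm_nonneg _) ((norm_nonneg _).trans (hs k))
      _ = q.κ₆ * δ := mul_comm _ _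
  have h1 := abs_le.1 (hb j)
  have h2 := abs_le.1 (hb l)
  simp only [margin, adjustedCost, shiftDev] at *
  linarith

/-- Since the optimal decision has the smaller true cost, a deviating decision must be favoured by
h, up to the regression error. This is the pointwise source of a nonnegative drift. -/
lemma dev_dec_sub {δ : ℝ} {s : (Fin K → ℝ) × (Fin K → EuclideanSpace ℝ (Fin d))}
    (hs : M.Close δ s) {x : EuclideanSpace ℝ (Fin d)} (hx : ‖x‖ ≤ q.κ₆) :
    -(2 * q.κ₆ * δ) ≤ M.shiftDev s.1 (M.dec s x) - M.shiftDev s.1 (M.opt x) := by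
  have h1 := M.dec_margin hs hx (M.opt x)
  have h2 := M.opt_margin x (M.dec s x)
  linarith

lemma prob_Z_Icc_le {j k : Fin K} (hjk : j ≠ k) {w : ℝ} (hw : 0 ≤ w) (hw1 : w ≤ q.κ₁) :
    M.P.real {ω | 0 ≤ M.Z j k ω ∧ M.Z j k ω ≤ w} ≤ q.κ₃ * w := by
  obtain ⟨h, hm, hP, hb⟩ := M.rich.density j k hjk
  have e : M.P {ω | 0 ≤ M.Z j k ω ∧ M.Z j k ω ≤ w}
      = (M.P.map (M.Z j k)) (Set.Icc 0 w) :=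
    (Measure.map_apply (M.measurable_Z j k) measurableSet_Icc).symm
  have hκ₁ := q.hκ₁
  have : M.P {ω | 0 ≤ M.Z j k ω ∧ M.Z j k ω ≤ w} ≤ ENNReal.ofReal (q.κ₃ * w) := by
    rw [e]
    change (M.P.map fun ω => margin M.β M.gstar j k (M.X 0 ω)) _ ≤ _
    rw [hP, withDensity_apply _ measurableSet_Icc]
    calc ∫⁻ z in Set.Icc 0 w, h z ≤ ∫⁻ z in Set.Icc 0 w, ENNReal.ofReal q.κ₃ :=
          setLIntegral_mono measurable_const fun z hz =>
            (hb z ⟨by linarith [hz.1], hz.2.trans hw1⟩).2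
      _ = ENNReal.ofReal (q.κ₃ * w) := by
          rw [setLIntegral_const, Real.volume_Icc, sub_zero, ← ENNReal.ofReal_mul q.hκ₃.le]
  exact ENNReal.toReal_le_of_le_ofReal (mul_nonneg q.hκ₃.le hw) this

lemma prob_Z_Ioc_ge {j k : Fin K} (hjk : j ≠ k) {w : ℝ} (hw1 : w ≤ q.κ₁) :
    q.κ₂ * w ≤ M.P.real {ω | 0 < M.Z j k ω ∧ M.Z j k ω ≤ w} := by
  obtain ⟨h, hm, hP, hb⟩ := M.rich.density j k hjk
  have e : M.P {ω | 0 < M.Z j k ω ∧ M.Z j k ω ≤ w}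
      = (M.P.map (M.Z j k)) (Set.Ioc 0 w) :=
    (Measure.map_apply (M.measurable_Z j k) measurableSet_Ioc).symm
  have hκ₁ := q.hκ₁
  have : ENNReal.ofReal (q.κ₂ * w) ≤ M.P {ω | 0 < M.Z j k ω ∧ M.Z j k ω ≤ w} := by
    rw [e]
    change _ ≤ (M.P.map fun ω => margin M.β M.gstar j k (M.X 0 ω)) _
    rw [hP, withDensity_apply _ measurableSet_Ioc]
    calc ENNReal.ofReal (q.κ₂ * w) = ∫⁻ z in Set.Ioc 0 w, ENNReal.ofReal q.κ₂ := by
          rw [setLIntegral_const, Real.volume_Ioc, sub_zero, ← ENNReal.ofReal_mul q.hκ₂.le]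
      _ ≤ ∫⁻ z in Set.Ioc 0 w, h z := 
          setLIntegral_mono hm fun z hz =>
            (hb z ⟨by linarith [hz.1], hz.2.trans hw1⟩).1
  exact (ENNReal.ofReal_le_iff_le_toReal (measure_ne_top _ _)).1 this

/-- The event that `Z_{j,k}` is in `(0, τ]` while all other alternatives are far from `k`. -/
def sepEvent (j k : Fin K) (τ : ℝ) : Set M.Ω :=
  {ω | (0 < M.Z j k ω ∧ M.Z j k ω ≤ τ) ∧ ∀ l, l ≠ j → l ≠ k → q.κ₄ ≤ M.Z l k ω}

lemma measurableSet_sepEvent (j k : Fin K) (τ : ℝ) : MeasurableSet (M.sepEvent j k τ) := by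
  have h1 : MeasurableSet {ω | 0 < M.Z j k ω} := measurableSet_lt measurable_const (M.measurable_Z j k)
  have h2 : MeasurableSet {ω | M.Z j k ω ≤ τ} := measurableSet_le (M.measurable_Z j k) measurable_const
  have h3 : MeasurableSet {ω | ∀ l, l ≠ j → l ≠ k → q.κ₄ ≤ M.Z l k ω} := by
    have : {ω | ∀ l, l ≠ j → l ≠ k → q.κ₄ ≤ M.Z l k ω}
        = ⋂ l, ⋂ (_ : l ≠ j), ⋂ (_ : l ≠ k), {ω | q.κ₄ ≤ M.Z l k ω} := by
      ext; simp
    rw [this]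
    exact MeasurableSet.iInter fun l => MeasurableSet.iInter fun _ => MeasurableSet.iInter fun _ =>
      measurableSet_le measurable_const (M.measurable_Z l k)
  exact (h1.inter h2).inter h3

lemma prob_sepEvent_ge {j k : Fin K} (hjk : j ≠ k) {τ : ℝ} (hτ : 0 < τ) (hτ1 : τ < q.κ₁) :
    q.κ₂ * q.κ₅ * τ ≤ M.P.real (M.sepEvent j k τ) := by
  have h := M.rich.separation j k hjk τ hτ hτ1
  have h1 := M.prob_Z_Ioc_ge hjk hτ1.le
  have hm : MeasurableSet {ω | 0 < M.Z j k ω ∧ M.Z j k ω ≤ τ} :=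
    (measurableSet_lt measurable_const (M.measurable_Z j k)).inter
      (measurableSet_le (M.measurable_Z j k) measurable_const)
  change q.κ₅ ≤ (cond M.P {ω | 0 < M.Z j k ω ∧ M.Z j k ω ≤ τ}).real
      {ω | ∀ l, l ≠ j → l ≠ k → q.κ₄ ≤ M.Z l k ω} at h
  rw [measureReal_def, cond_apply hm, ENNReal.toReal_mul, ENNReal.toReal_inv] at h
  change q.κ₅ ≤ (M.P.real _)⁻¹ * M.P.real _ at h
  set A := M.P.real {ω | 0 < M.Z j k ω ∧ M.Z j k ω ≤ τ}
  have hA : 0 < A := lt_of_lt_of_le (mul_pos q.hκ₂ hτ) h1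
  have e : M.P.real (M.sepEvent j k τ) = M.P.real ({ω | 0 < M.Z j k ω ∧ M.Z j k ω ≤ τ}
      ∩ {ω | ∀ l, l ≠ j → l ≠ k → q.κ₄ ≤ M.Z l k ω}) := rfl
  rw [e]
  have h2 : q.κ₅ * A ≤ M.P.real ({ω | 0 < M.Z j k ω ∧ M.Z j k ω ≤ τ}
      ∩ {ω | ∀ l, l ≠ j → l ≠ k → q.κ₄ ≤ M.Z l k ω}) := by
    calc q.κ₅ * A ≤ (A⁻¹ * _) * A := mul_le_mul_of_nonneg_right h hA.le
      _ = _ := by field_simp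
  refine le_trans ?_ h2
  nlinarith [q.hκ₅]

lemma measurable_dec_X (s : (Fin K → ℝ) × (Fin K → EuclideanSpace ℝ (Fin d))) (n : ℕ) :
    Measurable fun ω => M.dec s (M.X n ω) :=
  measurable_comp₂ M.measurable_dec measurable_const (M.measurable_X n)

lemma measurable_opt_X (n : ℕ) : Measurable fun ω => M.opt (M.X n ω) :=
  M.measurable_opt.comp (M.measurable_X n)

/-- The probability of a wrong decision is bounded by the size of the estimation error. -/
lemma prob_dec_ne_opt_le {δ w : ℝ} {s : (Fin K → ℝ) × (Fin K → EuclideanSpace ℝ (Fin d))}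
    (hs : M.Close δ s) (hw0 : 0 ≤ w)
    (hw : ∀ j l, M.shiftDev s.1 j - M.shiftDev s.1 l + 2 * q.κ₆ * δ ≤ w) :
    M.P.real {ω | M.dec s (M.X 0 ω) ≠ M.opt (M.X 0 ω)} ≤ ((K : ℝ) ^ 2 * q.κ₃ + 1 / q.κ₁) * w := by
  have hκ₁ := q.hκ₁
  have hκ₃ := q.hκ₃
  -- The density is controlled only on [-κ₁, κ₁]. For larger w the summand w/κ₁ already exceeds 1
  -- and the bound is trivial.
  rcases le_or_gt w q.κ₁ with h | h
  · have hsub : ∀ᵐ ω ∂M.P, ω ∈ {ω | M.dec s (M.X 0 ω) ≠ M.opt (M.X 0 ω)} →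
        ω ∈ ⋃ jk ∈ (Finset.univ.filter fun jk : Fin K × Fin K => jk.1 ≠ jk.2),
          {ω | 0 ≤ M.Z jk.1 jk.2 ω ∧ M.Z jk.1 jk.2 ω ≤ w} := by
      filter_upwards [M.rich.bounded] with ω hω hne
      -- A wrong decision forces the true margin between it and the optimal one into [0, w].
      refine Set.mem_iUnion₂.2 ⟨(M.dec s (M.X 0 ω), M.opt (M.X 0 ω)), by simpa using hne, ?_⟩
      exact ⟨M.opt_margin _ _, (M.dec_margin hs hω _).trans (hw _ _)⟩
    calc _ ≤ _ := real_mono_ae hsub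
      _ ≤ ∑ jk ∈ (Finset.univ.filter fun jk : Fin K × Fin K => jk.1 ≠ jk.2),
          M.P.real {ω | 0 ≤ M.Z jk.1 jk.2 ω ∧ M.Z jk.1 jk.2 ω ≤ w} :=
        measureReal_biUnion_finset_le _ _
      _ ≤ ∑ jk ∈ (Finset.univ.filter fun jk : Fin K × Fin K => jk.1 ≠ jk.2), q.κ₃ * w :=
        Finset.sum_le_sum fun jk hjk => M.prob_Z_Icc_le (by simpa using hjk) hw0 h
      _ ≤ ∑ jk : Fin K × Fin K, q.κ₃ * w :=
        Finset.sum_le_sum_of_subset_of_nonneg (Finset.filter_subset _ _)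
          fun _ _ _ => mul_nonneg hκ₃.le hw0
      _ = (K : ℝ) ^ 2 * q.κ₃ * w := by
        simp only [Finset.sum_const, Finset.card_univ, Fintype.card_prod, Fintype.card_fin,
          nsmul_eq_mul]
        push_cast
        ring
      _ ≤ _ := by
        have : 0 ≤ 1 / q.κ₁ * w := by positivity
        linarith
  · have h1 : 1 ≤ 1 / q.κ₁ * w := by
      rw [one_div, inv_mul_eq_div, one_le_div hκ₁]
      exact h.le
    have h2 : 0 ≤ (K : ℝ) ^ 2 * q.κ₃ * w := by positivity
    calc _ ≤ (1 : ℝ) := measureReal_le_one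
      _ ≤ _ := by linarith

lemma iInf_adjustedCost (b : Fin K → EuclideanSpace ℝ (Fin d)) (g : Fin K → ℝ)
    (x : EuclideanSpace ℝ (Fin d)) :
    ⨅ j, adjustedCost b g x j = adjustedCost b g x (M.dec (g, b) x) := by
  have : Nonempty (Fin K) := ⟨q.r 0⟩
  exact le_antisymm (ciInf_le (Set.finite_range _).bddBelow _)
    (le_ciInf fun j => M.hamin.le _ j)

lemma integrable_adjustedCost (g : Fin K → ℝ) {J : M.Ω → Fin K} (hJ : Measurable J) :
    Integrable (fun ω => adjustedCost M.β g (M.X 0 ω) (J ω)) M.P := by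
  have h := measurable_adjustedCost (K := K) (d := d)
    (b := fun _ => M.β) (g := fun _ => g) measurable_const measurable_const (M.measurable_X 0)
  have hm : Measurable fun ω => adjustedCost M.β g (M.X 0 ω) (J ω) := by
    have : (fun ω => adjustedCost M.β g (M.X 0 ω) (J ω))
        = fun ω => ∑ k, if J ω = k then adjustedCost M.β g (M.X 0 ω) k else 0 := by
      funext ω; simp
    rw [this]
    exact Finset.measurable_sum _ fun k _ => Measurable.ite (hJ (measurableSet_singleton k))
      ((measurable_pi_apply k).comp h) measurable_const
  refine Integrable.of_bound hm.aestronglyMeasurable (q.R * q.κ₆ + ∑ k, |g k|) ?_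
  filter_upwards [M.rich.bounded] with ω hω
  simp only [adjustedCost, Real.norm_eq_abs]
  refine (abs_sub _ _).trans (add_le_add ?_ ?_)
  · exact (abs_real_inner_le_norm _ _).trans
      (mul_le_mul (M.hβ _) hω (norm_nonneg _) q.hR)
  · exact Finset.single_le_sum (f := fun k => |g k|) (fun k _ => abs_nonneg _) (Finset.mem_univ _)

/-- A directional derivative of the dual objective at its maximiser, taken by hand. Moving `gstar`
by t·v and using the decision of the perturbed problem as a competitor yields p·v ≤ E v(J), where J
differs from the optimal decision only with probability O(t). Then t → 0; no differentiability of
the dual is needed. -/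
lemma p_dot_le (v : Fin K → ℝ) : ∑ k, M.p k * v k ≤ ∫ ω, v (M.opt (M.X 0 ω)) ∂M.P := by
  set B : ℝ := ∑ k, |v k| with hB
  have hB0 : 0 ≤ B := Finset.sum_nonneg fun k _ => abs_nonneg _
  have hvB : ∀ k, |v k| ≤ B := fun k =>
    Finset.single_le_sum (f := fun k => |v k|) (fun k _ => abs_nonneg _) (Finset.mem_univ _)
  set C : ℝ := (K : ℝ) ^ 2 * q.κ₃ + 1 / q.κ₁ with hC
  have hC0 : 0 ≤ C := by have := q.hκ₁; have := q.hκ₃; positivity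
  have key : ∀ t : ℝ, 0 < t →
      ∑ k, M.p k * v k ≤ ∫ ω, v (M.opt (M.X 0 ω)) ∂M.P + (2 * B * (C * (2 * B))) * t := by
    intro t ht
    set gt : Fin K → ℝ := fun k => M.gstar k + t * v k with hgt
    have hJm := M.measurable_dec_X (gt, M.β) 0
    have hJ0 := M.measurable_opt_X 0
    set J : M.Ω → Fin K := fun ω => M.dec (gt, M.β) (M.X 0 ω) with hJ
    have h1 := M.data.dual_optimal gt
    simp only [dualObjective, M.iInf_adjustedCost] at h1
    have h2 : ∫ ω, adjustedCost M.β gt (M.X 0 ω) (J ω) ∂M.P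
        ≥ ∫ ω, adjustedCost M.β M.gstar (M.X 0 ω) (M.opt (M.X 0 ω)) ∂M.P
          - t * ∫ ω, v (J ω) ∂M.P := by
      rw [← integral_const_mul, ← integral_sub (M.integrable_adjustedCost _ hJ0)
        ((integrable_comp_fin v hJm).const_mul t)]
      refine integral_mono ((M.integrable_adjustedCost _ hJ0).sub
        ((integrable_comp_fin v hJm).const_mul t)) (M.integrable_adjustedCost _ hJm) fun ω => ?_
      have := M.hamin.le (adjustedCost M.β M.gstar (M.X 0 ω)) (J ω)
      change adjustedCost M.β M.gstar (M.X 0 ω) (M.opt (M.X 0 ω)) ≤ _ at this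
      simp only [adjustedCost, hgt] at *
      linarith
    have h3 : ∑ k, M.p k * gt k = ∑ k, M.p k * M.gstar k + t * ∑ k, M.p k * v k := by
      rw [Finset.mul_sum, ← Finset.sum_add_distrib]
      exact Finset.sum_congr rfl fun k _ => by simp only [hgt]; ring
    have h4 : t * ∑ k, M.p k * v k ≤ t * ∫ ω, v (J ω) ∂M.P := by
      rw [h3] at h1
      change ∫ ω, adjustedCost M.β gt (M.X 0 ω) (J ω) ∂M.P + _
        ≤ ∫ ω, adjustedCost M.β M.gstar (M.X 0 ω) (M.opt (M.X 0 ω)) ∂M.P + _ at h1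
      linarith
    have h5 := le_of_mul_le_mul_left h4 ht
    have hE : MeasurableSet {ω | J ω ≠ M.opt (M.X 0 ω)} :=
      (measurableSet_eq_fun hJm hJ0).compl
    have h6 : ∫ ω, v (J ω) ∂M.P ≤ ∫ ω, v (M.opt (M.X 0 ω)) ∂M.P
        + M.P.real {ω | J ω ≠ M.opt (M.X 0 ω)} * (2 * B) := by
      rw [← integral_indicator_const_real hE, ← integral_add (integrable_comp_fin v hJ0)
        ((integrable_const _).indicator hE)]
      refine integral_mono (integrable_comp_fin v hJm) ((integrable_comp_fin v hJ0).add
        ((integrable_const _).indicator hE)) fun ω => ?_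
      by_cases h : J ω = M.opt (M.X 0 ω)
      · simp [Set.indicator, h]
      · simp only [Set.indicator, Set.mem_ofPred_eq, ne_eq, h, not_false_eq_true, if_true]
        have := abs_le.1 (hvB (J ω))
        have := abs_le.1 (hvB (M.opt (M.X 0 ω)))
        linarith
    have h7 : M.P.real {ω | J ω ≠ M.opt (M.X 0 ω)} ≤ C * (2 * B * t) := by
      refine M.prob_dec_ne_opt_le (δ := 0) (s := (gt, M.β)) (fun k => by simp) (by positivity) ?_
      intro j l
      have := abs_le.1 (hvB j)
      have := abs_le.1 (hvB l)
      simp only [shiftDev, hgt]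
      nlinarith
    have h8 := mul_le_mul_of_nonneg_right h7 (by positivity : (0:ℝ) ≤ 2 * B)
    linarith
  by_contra hlt
  push Not at hlt
  set A := ∑ k, M.p k * v k - ∫ ω, v (M.opt (M.X 0 ω)) ∂M.P
  have hA : 0 < A := by simp only [A]; linarith
  set G : ℝ := 2 * B * (C * (2 * B)) with hG
  have hG0 : 0 ≤ G := by positivity
  -- A value of t at which the error term G·t is smaller than the supposed gap A.
  have := key (A / (2 * (G + 1))) (by positivity)
  have h2 : G * (A / (2 * (G + 1))) < A := by
    rw [← mul_div_assoc, div_lt_iff₀ (by positivity)]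
    nlinarith
  simp only [A] at *
  linarith

/-- First order optimality of `gstar`. -/
lemma p_dot_eq (v : Fin K → ℝ) : ∑ k, M.p k * v k = ∫ ω, v (M.opt (M.X 0 ω)) ∂M.P := by
  refine le_antisymm (M.p_dot_le v) ?_
  have := M.p_dot_le (fun k => - v k)
  simp only [mul_neg, Finset.sum_neg_distrib, integral_neg] at this
  linarith

end Model

/-! ### Smallest eigenvalues -/

/-- Subtracting the smallest eigenvalue times the identity shifts the spectrum into [0, ∞), so the
difference is positive semidefinite. -/
lemma lambdaMin_mul_le {d : ℕ} {A : Matrix (Fin d) (Fin d) ℝ} (hA : A.IsHermitian)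
    (v : Fin d → ℝ) : lambdaMin A * (v ⬝ᵥ v) ≤ v ⬝ᵥ A.mulVec v := by
  set c := lambdaMin A with hc
  have hB : (A - algebraMap ℝ (Matrix (Fin d) (Fin d) ℝ) c).IsHermitian := by
    refine hA.sub ?_
    rw [Algebra.algebraMap_eq_smul_one]
    exact (Matrix.isHermitian_one).smul (IsSelfAdjoint.all c)
  have hpos : (A - algebraMap ℝ (Matrix (Fin d) (Fin d) ℝ) c).PosSemidef := by
    rw [hB.posSemidef_iff_eigenvalues_nonneg]
    intro i
    have h1 : hB.eigenvalues i ∈ spectrum ℝ (A - algebraMap ℝ (Matrix (Fin d) (Fin d) ℝ) c) := by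
      rw [hB.spectrum_real_eq_range_eigenvalues]
      exact ⟨i, rfl⟩
    rw [← spectrum.sub_singleton_eq] at h1
    obtain ⟨x, hx, y, hy, hxy⟩ := Set.mem_sub.1 h1
    rw [Set.mem_singleton_iff] at hy
    have h2 : c ≤ x := csInf_le (Matrix.finite_real_spectrum (A := A)).bddBelow hx
    rw [← hxy, hy]
    simpa using h2
  have h := hpos.dotProduct_mulVec_nonneg v
  rw [Matrix.sub_mulVec, dotProduct_sub, Algebra.algebraMap_eq_smul_one, Matrix.smul_mulVec,
    Matrix.one_mulVec, dotProduct_smul, smul_eq_mul] at h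
  simp only [star_trivial] at h
  linarith

/-! ### Second moments under the optimal policy, and size of the dual solution -/

namespace Model

variable {K d : ℕ} {q : Par K d} (M : Model q)

lemma ae_norm_X_le (n : ℕ) : ∀ᵐ ω ∂M.P, ‖M.X n ω‖ ≤ q.κ₆ := by
  have h := (M.data.ident_X n).symm.ae_snd (p := fun x => ‖x‖ ≤ q.κ₆)
    (measurableSet_le measurable_norm measurable_const) M.rich.bounded
  exact h

/-- In dimension 0 the spectrum is empty and its infimum is 0 by convention, which contradicts κ₈ >
0. -/
lemma d_pos (M : Model q) : 0 < d := by
  by_contra h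
  obtain rfl : d = 0 := by omega
  have h1 := M.lam (q.r 0)
  have h2 := q.hκ₈
  have : lambdaMin (restrictedMoment M.P M.amin M.β M.gstar (M.X 0) (q.r 0)) = 0 := by
    unfold lambdaMin
    have : spectrum ℝ (restrictedMoment M.P M.amin M.β M.gstar (M.X 0) (q.r 0)) = ∅ :=
      spectrum.of_subsingleton _
    rw [this, Real.sInf_empty]
  linarith

lemma integrable_sq_inner_ite (θ : EuclideanSpace ℝ (Fin d)) {J : M.Ω → Fin K}
    (hJ : Measurable J) (k : Fin K) :
    Integrable (fun ω => if J ω = k then (inner ℝ θ (M.X 0 ω) : ℝ) ^ 2 else 0) M.P := by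
  have hm : Measurable fun ω => (inner ℝ θ (M.X 0 ω) : ℝ) ^ 2 :=
    (measurable_const.inner (M.measurable_X 0)).pow_const 2
  refine Integrable.of_bound (Measurable.ite (hJ (measurableSet_singleton k)) hm
    measurable_const).aestronglyMeasurable ((‖θ‖ * q.κ₆) ^ 2) ?_
  filter_upwards [M.rich.bounded] with ω hω
  have : |(inner ℝ θ (M.X 0 ω) : ℝ)| ≤ ‖θ‖ * q.κ₆ :=
    (abs_real_inner_le_norm _ _).trans (mul_le_mul_of_nonneg_left hω (norm_nonneg _))
  split_ifs
  · rw [Real.norm_eq_abs, abs_pow]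
    exact pow_le_pow_left₀ (abs_nonneg _) this 2
  · simp only [norm_zero]
    positivity

lemma moment_ge (k : Fin K) (θ : EuclideanSpace ℝ (Fin d)) :
    q.κ₈ * ‖θ‖ ^ 2
      ≤ ∫ ω, (if M.opt (M.X 0 ω) = k then (inner ℝ θ (M.X 0 ω) : ℝ) ^ 2 else 0) ∂M.P := by
  set A := restrictedMoment M.P M.amin M.β M.gstar (M.X 0) k with hA
  have hH : A.IsHermitian := by
    ext i l
    simp only [hA, restrictedMoment, Matrix.conjTranspose_apply, Matrix.of_apply, star_trivial]
    simp only [mul_comm]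
  have h := lambdaMin_mul_le hH θ.ofLp
  have hmeas : ∀ i, Measurable fun ω => M.X 0 ω i := fun i => by
    have := M.measurable_X 0
    fun_prop
  have hint : ∀ i l, Integrable (fun ω => M.X 0 ω i * M.X 0 ω l *
      (if M.amin (adjustedCost M.β M.gstar (M.X 0 ω)) = k then (1 : ℝ) else 0)) M.P := by
    intro i l
    refine Integrable.of_bound (((hmeas i).mul (hmeas l)).mul
      (Measurable.ite (M.measurable_opt_X 0 (measurableSet_singleton k)) measurable_const
        measurable_const)).aestronglyMeasurable (q.κ₆ * q.κ₆ * 1) ?_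
    filter_upwards [M.rich.bounded] with ω hω
    rw [norm_mul, norm_mul]
    have h6 := q.hκ₆.le
    refine mul_le_mul (mul_le_mul ((PiLp.norm_apply_le _ i).trans hω)
      ((PiLp.norm_apply_le _ l).trans hω) (norm_nonneg _) h6) ?_ (norm_nonneg _) (by positivity)
    split_ifs <;> simp
  have e : θ.ofLp ⬝ᵥ A.mulVec θ.ofLp
      = ∫ ω, (if M.opt (M.X 0 ω) = k then (inner ℝ θ (M.X 0 ω) : ℝ) ^ 2 else 0) ∂M.P := by
    simp only [hA, restrictedMoment, Matrix.mulVec, dotProduct, Matrix.of_apply]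
    simp_rw [← integral_mul_const, Finset.mul_sum, ← integral_const_mul]
    have e1 : ∀ i, ∑ l, ∫ ω, θ i * (M.X 0 ω i * M.X 0 ω l *
        (if M.amin (adjustedCost M.β M.gstar (M.X 0 ω)) = k then (1 : ℝ) else 0) * θ l) ∂M.P
        = ∫ ω, ∑ l, θ i * (M.X 0 ω i * M.X 0 ω l *
        (if M.amin (adjustedCost M.β M.gstar (M.X 0 ω)) = k then (1 : ℝ) else 0) * θ l) ∂M.P :=
      fun i => (integral_finsetSum _ fun l _ =>
        ((hint i l).mul_const _).const_mul _).symm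
    simp_rw [e1]
    rw [← integral_finsetSum _ fun i _ => integrable_finsetSum _ fun l _ =>
        ((hint i l).mul_const _).const_mul _]
    refine integral_congr_ae (Eventually.of_forall fun ω => ?_)
    by_cases hk : M.opt (M.X 0 ω) = k
    · have hk' : M.amin (adjustedCost M.β M.gstar (M.X 0 ω)) = k := hk
      simp only [if_pos hk, if_pos hk']
      rw [← dotProduct_ofLp, sq, dotProduct, Finset.sum_mul_sum]
      exact Finset.sum_congr rfl fun i _ => Finset.sum_congr rfl fun l _ => by ring
    · have hk' : ¬ M.amin (adjustedCost M.β M.gstar (M.X 0 ω)) = k := hk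
      simp [hk, hk']
  rw [← e]
  refine le_trans ?_ h
  rw [dotProduct_ofLp, real_inner_self_eq_norm_sq]
  exact mul_le_mul_of_nonneg_right (M.lam k) (by positivity)

lemma sq_inner_le {θ x : EuclideanSpace ℝ (Fin d)} (hx : ‖x‖ ≤ q.κ₆) :
    (inner ℝ θ x : ℝ) ^ 2 ≤ q.κ₆ ^ 2 * ‖θ‖ ^ 2 := by
  have h := abs_real_inner_le_norm θ x
  have h2 : ‖θ‖ * ‖x‖ ≤ ‖θ‖ * q.κ₆ := mul_le_mul_of_nonneg_left hx (norm_nonneg _)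
  have := sq_le_sq' (by linarith [neg_abs_le (inner ℝ θ x : ℝ)]) ((le_abs_self _).trans (h.trans h2))
  linarith

/-- The restricted second moment of a policy that is close to the optimal one. -/
lemma moment_dec_ge (k : Fin K) (θ : EuclideanSpace ℝ (Fin d)) {J : M.Ω → Fin K}
    (hJ : Measurable J) :
    (q.κ₈ - q.κ₆ ^ 2 * M.P.real {ω | J ω ≠ M.opt (M.X 0 ω)}) * ‖θ‖ ^ 2
      ≤ ∫ ω, (if J ω = k then (inner ℝ θ (M.X 0 ω) : ℝ) ^ 2 else 0) ∂M.P := by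
  have hE : MeasurableSet {ω | J ω ≠ M.opt (M.X 0 ω)} :=
    (measurableSet_eq_fun hJ (M.measurable_opt_X 0)).compl
  have h1 := M.moment_ge k θ
  have h2 : ∫ ω, (if M.opt (M.X 0 ω) = k then (inner ℝ θ (M.X 0 ω) : ℝ) ^ 2 else 0) ∂M.P
      ≤ ∫ ω, (if J ω = k then (inner ℝ θ (M.X 0 ω) : ℝ) ^ 2 else 0) ∂M.P
        + M.P.real {ω | J ω ≠ M.opt (M.X 0 ω)} * (q.κ₆ ^ 2 * ‖θ‖ ^ 2) := by
    rw [← integral_indicator_const_real hE, ← integral_add (M.integrable_sq_inner_ite θ hJ k)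
        ((integrable_const _).indicator hE)]
    refine integral_mono_ae (M.integrable_sq_inner_ite θ (M.measurable_opt_X 0) k)
      ((M.integrable_sq_inner_ite θ hJ k).add ((integrable_const _).indicator hE)) ?_
    filter_upwards [M.rich.bounded] with ω hω
    by_cases h : J ω = M.opt (M.X 0 ω)
    · simp [Set.indicator, h]
    · simp only [Set.indicator, Set.mem_ofPred_eq, ne_eq, h, not_false_eq_true, if_true]
      have h3 := sq_inner_le (q := q) (θ := θ) hω
      split_ifs <;> nlinarith [sq_nonneg (inner ℝ θ (M.X 0 ω) : ℝ)]
  nlinarith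

/-- If alternative k were almost surely never optimal, its restricted second moment would vanish,
against κ₈ > 0. -/
lemma exists_opt_eq (k : Fin K) : ∃ ω, ‖M.X 0 ω‖ ≤ q.κ₆ ∧ M.opt (M.X 0 ω) = k := by
  by_contra hcon
  push Not at hcon
  have h := M.moment_ge k (EuclideanSpace.single ⟨0, M.d_pos⟩ (1 : ℝ))
  have h0 : ∫ ω, (if M.opt (M.X 0 ω) = k then
      (inner ℝ (EuclideanSpace.single (⟨0, M.d_pos⟩ : Fin d) (1 : ℝ)) (M.X 0 ω) : ℝ) ^ 2
        else 0) ∂M.P = 0 := by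
    rw [← integral_zero M.Ω ℝ (μ := M.P)]
    refine integral_congr_ae ?_
    filter_upwards [M.rich.bounded] with ω hω
    simp [hcon ω hω]
  rw [h0] at h
  simp only [PiLp.norm_single, norm_one, one_pow, mul_one] at h
  linarith [q.hκ₈]

/-- At a point where k is optimal, `gstar j - gstar k` is at most a difference of costs, hence
bounded through R and κ₆. This keeps `gstar` out of the final constant. -/
lemma gstar_sub_le (j k : Fin K) : M.gstar j - M.gstar k ≤ 2 * q.R * q.κ₆ := by
  obtain ⟨ω, hω, hk⟩ := M.exists_opt_eq k
  have h := M.opt_margin (M.X 0 ω) j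
  rw [hk] at h
  simp only [margin, adjustedCost] at h
  have hb : ∀ k, |(inner ℝ (M.β k) (M.X 0 ω) : ℝ)| ≤ q.R * q.κ₆ := fun k =>
    (abs_real_inner_le_norm _ _).trans (mul_le_mul (M.hβ k) hω (norm_nonneg _) q.hR)
  have := abs_le.1 (hb j)
  have := abs_le.1 (hb k)
  linarith

/-! ### The drift of the dual vector -/

lemma integrable_dev_diff (v : Fin K → ℝ)
    (s : (Fin K → ℝ) × (Fin K → EuclideanSpace ℝ (Fin d))) :
    Integrable (fun ω => v (M.dec s (M.X 0 ω)) - v (M.opt (M.X 0 ω))) M.P :=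
  (integrable_comp_fin v (M.measurable_dec_X s 0)).sub
    (integrable_comp_fin v (M.measurable_opt_X 0))

/-- A lower bound for the drift in terms of a single pair of alternatives. -/
lemma drift_ge_spread {δ m : ℝ} {s : (Fin K → ℝ) × (Fin K → EuclideanSpace ℝ (Fin d))}
    (hs : M.Close δ s) (hm : 0 < m) {J I : Fin K}
    (hJI : m ≤ M.shiftDev s.1 J - M.shiftDev s.1 I) :
    q.κ₂ * q.κ₅ * (min m q.κ₁ / 2) * (m / 2) - 2 * q.κ₆ * δ
      ≤ ∫ ω, (M.shiftDev s.1 (M.dec s (M.X 0 ω)) - M.shiftDev s.1 (M.opt (M.X 0 ω))) ∂M.P := by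
  have hκ₁ := q.hκ₁
  have hκ₆ := q.hκ₆
  have hne : J ≠ I := by
    rintro rfl
    linarith [sub_self (M.shiftDev s.1 J)]
  -- Half of the spread is spent on the margin Z_{J,I}; the other half remains as a gain in the
  -- drift. The cap by κ₁ keeps τ where the separation condition applies.
  set τ := min m q.κ₁ / 2 with hτ
  have hτ0 : 0 < τ := by positivity
  have hτ1 : τ < q.κ₁ := by
    have := min_le_right m q.κ₁
    rw [hτ]; linarith
  have hτm : τ ≤ m / 2 := by
    have := min_le_left m q.κ₁
    rw [hτ]; linarith
  have hP := M.prob_sepEvent_ge hne hτ0 hτ1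
  have hE := M.measurableSet_sepEvent J I τ
  have h1 : ∫ ω, ((M.sepEvent J I τ).indicator (fun _ => m / 2) ω - 2 * q.κ₆ * δ) ∂M.P
      ≤ ∫ ω, (M.shiftDev s.1 (M.dec s (M.X 0 ω)) - M.shiftDev s.1 (M.opt (M.X 0 ω))) ∂M.P := by
    refine integral_mono_ae (((integrable_const _).indicator hE).sub (integrable_const _))
      (M.integrable_dev_diff _ s) ?_
    filter_upwards [M.rich.bounded] with ω hω
    by_cases hω2 : ω ∈ M.sepEvent J I τ
    · simp only [Set.indicator, hω2, if_true]
      obtain ⟨⟨hZ0, hZ1⟩, hsep⟩ := hω2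
      have ho : M.opt (M.X 0 ω) = I := by
        by_contra hoI
        have h2 := M.opt_margin (M.X 0 ω) I
        have h3 : 0 < M.Z (M.opt (M.X 0 ω)) I ω := by
          by_cases hoJ : M.opt (M.X 0 ω) = J
          · rw [hoJ]; exact hZ0
          · exact q.hκ₄.trans_le (hsep _ hoJ hoI)
        simp only [Z, margin] at h2 h3
        linarith
      -- Here I is optimal and J is at most τ worse. The decision beats J in estimated cost and not
      -- I in true cost, so its deviation is at least h(J) - τ - 2κ₆δ.
      have h4 := M.dec_margin hs hω J
      have h5 := M.opt_margin (M.X 0 ω) (M.dec s (M.X 0 ω))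
      have h6 := M.margin_add (M.dec s (M.X 0 ω)) J I (M.X 0 ω)
      rw [ho] at h5 ⊢
      simp only [Z] at hZ1 hZ0
      linarith
    · simp only [Set.indicator, hω2, if_false]
      have := M.dev_dec_sub hs hω
      linarith
  rw [integral_sub ((integrable_const _).indicator hE) (integrable_const _),
    integral_indicator_const_real hE, integral_const] at h1
  simp only [probReal_univ, smul_eq_mul] at h1
  refine le_trans ?_ h1
  have := mul_le_mul_of_nonneg_right hP (by positivity : 0 ≤ m / 2)
  linarith

/-- Each unordered pair contributes its squared difference in exactly one of its two orders, and for
a centred vector all squared differences add up to 2K times the squared norm. -/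
lemma sum_pos_sq {K : ℕ} (h : Fin K → ℝ) (h0 : ∑ k, h k = 0) :
    ∑ j, ∑ k, (max (h j - h k) 0) ^ 2 = K * ∑ k, h k ^ 2 := by
  have e1 : ∑ j, ∑ k, (max (h j - h k) 0) ^ 2 = ∑ j, ∑ k, (max (h k - h j) 0) ^ 2 :=
    Finset.sum_comm
  have e2 : ∀ j k, (max (h j - h k) 0) ^ 2 + (max (h k - h j) 0) ^ 2 = (h j - h k) ^ 2 := by
    intro j k
    rcases le_total (h j) (h k) with h | h
    · rw [max_eq_right (by linarith), max_eq_left (by linarith)]; ring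
    · rw [max_eq_left (by linarith), max_eq_right (by linarith)]; ring
  have e3 : ∑ j, ∑ k, (h j - h k) ^ 2 = 2 * (K * ∑ k, h k ^ 2) := by
    have : ∀ j k, (h j - h k) ^ 2 = h j ^ 2 - 2 * (h j * h k) + h k ^ 2 := fun j k => by ring
    simp only [this, Finset.sum_add_distrib, Finset.sum_sub_distrib, ← Finset.mul_sum, h0,
      mul_zero, sub_zero, Finset.sum_const, Finset.card_univ,
      Fintype.card_fin, nsmul_eq_mul]
    ring
  have e4 : ∑ j, ∑ k, (max (h j - h k) 0) ^ 2 + ∑ j, ∑ k, (max (h k - h j) 0) ^ 2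
      = ∑ j, ∑ k, (h j - h k) ^ 2 := by
    simp only [← Finset.sum_add_distrib, e2]
  linarith

/-- For K = 1 a centred vector is zero, and otherwise K ≥ 2. This removes K from the monotonicity
constant, so that the threshold for α depends on κ₂ and κ₅ only. -/
lemma two_mul_sum_sq_le {K : ℕ} (h : Fin K → ℝ) (h0 : ∑ k, h k = 0) :
    2 * ∑ k, h k ^ 2 ≤ K * ∑ k, h k ^ 2 := by
  have hnn : 0 ≤ ∑ k, h k ^ 2 := Finset.sum_nonneg fun k _ => sq_nonneg _
  rcases Nat.lt_or_ge K 2 with hK | hK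
  · have : ∑ k, h k ^ 2 = 0 := by
      interval_cases K
      · simp
      · simp only [Finset.univ_unique, Finset.sum_singleton] at h0 ⊢
        rw [h0]; simp
    rw [this]; simp
  · exact mul_le_mul_of_nonneg_right (by exact_mod_cast hK) hnn

/-- Local strong monotonicity of the drift, with a constant that does not depend on `K`. -/
lemma drift_ge_local {δ w : ℝ} (hδ : 0 ≤ δ) {s : (Fin K → ℝ) × (Fin K → EuclideanSpace ℝ (Fin d))}
    (hs : M.Close δ s) (h0 : ∑ k, M.shiftDev s.1 k = 0)
    (hw : ∀ j k, M.shiftDev s.1 j - M.shiftDev s.1 k ≤ w) (hw1 : w < q.κ₁)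
    (hw4 : w + 2 * q.κ₆ * δ < q.κ₄) (hδ1 : 2 * q.κ₆ * δ ≤ q.κ₁) :
    q.κ₂ * q.κ₅ * ∑ k, M.shiftDev s.1 k ^ 2
        - (K : ℝ) ^ 2 * (2 * q.κ₂ * q.κ₅ + q.κ₃) * (2 * q.κ₆ * δ) ^ 2
      ≤ ∫ ω, (M.shiftDev s.1 (M.dec s (M.X 0 ω)) - M.shiftDev s.1 (M.opt (M.X 0 ω))) ∂M.P := by
  have hκ₁ := q.hκ₁
  have hκ₂ := q.hκ₂
  have hκ₃ := q.hκ₃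
  have hκ₅ := q.hκ₅
  have hκ₆ := q.hκ₆
  set h := M.shiftDev s.1 with hh
  set D := 2 * q.κ₆ * δ with hD
  have hD0 : 0 ≤ D := by positivity
  have hdm := M.measurable_dec_X s 0
  have hom := M.measurable_opt_X 0
  set A : Fin K → Fin K → Set M.Ω := fun j k =>
    {ω | M.dec s (M.X 0 ω) = j ∧ M.opt (M.X 0 ω) = k} with hAdef
  have hA : ∀ j k, MeasurableSet (A j k) := fun j k =>
    (hdm (measurableSet_singleton j)).inter (hom (measurableSet_singleton k))
  have e1 : ∫ ω, (h (M.dec s (M.X 0 ω)) - h (M.opt (M.X 0 ω))) ∂M.P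
      = ∑ j, ∑ k, M.P.real (A j k) * (h j - h k) := by
    have : (fun ω => h (M.dec s (M.X 0 ω)) - h (M.opt (M.X 0 ω)))
        = fun ω => ∑ j, ∑ k, (A j k).indicator (fun _ => h j - h k) ω := by
      funext ω
      rw [Finset.sum_eq_single (M.dec s (M.X 0 ω)), Finset.sum_eq_single (M.opt (M.X 0 ω))]
      · simp [A, Set.indicator]
      · intro k _ hk
        simp [A, Set.indicator, hk.symm]
      · simp
      · intro j _ hj
        exact Finset.sum_eq_zero fun k _ => by simp [A, Set.indicator, hj.symm]
      · simp
    rw [this, integral_finsetSum _ fun j _ => integrable_finsetSum _ fun k _ =>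
      (integrable_const _).indicator (hA j k)]
    refine Finset.sum_congr rfl fun j _ => ?_
    rw [integral_finsetSum _ fun k _ => (integrable_const _).indicator (hA j k)]
    exact Finset.sum_congr rfl fun k _ => integral_indicator_const_real (hA j k) _
  -- The drift is split by the pair (decision, optimum) = (j, k). If h(j) < h(k), such a decision is
  -- due to regression error: it needs a gap and a margin of at most D, so it costs at most κ₃D². If
  -- h(j) exceeds h(k) by at most 2D, the square is absorbed by the error term. For a larger gap,
  -- the separation event with width gap/2 lies inside the cell and has probability at least
  -- κ₂κ₅·gap/2.
  have term : ∀ j k, q.κ₂ * q.κ₅ / 2 * (max (h j - h k) 0) ^ 2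
      - (2 * q.κ₂ * q.κ₅ + q.κ₃) * D ^ 2 ≤ M.P.real (A j k) * (h j - h k) := by
    intro j k
    have hPnn : 0 ≤ M.P.real (A j k) := measureReal_nonneg
    have hcc : 0 ≤ q.κ₂ * q.κ₅ := by positivity
    rcases lt_trichotomy (h j) (h k) with hlt | heq | hgt
    · rw [max_eq_right (by linarith)]
      have hjk : j ≠ k := by rintro rfl; exact lt_irrefl _ hlt
      by_cases hbig : D < h k - h j
      · have : M.P.real (A j k) ≤ M.P.real (∅ : Set M.Ω) := by
          refine real_mono_ae ?_
          filter_upwards [M.rich.bounded] with ω hω hωA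
          have := M.dev_dec_sub hs hω
          rw [hωA.1, hωA.2] at this
          simp only [← hh, ← hD] at this
          linarith
        simp only [measureReal_empty] at this
        have h0 : M.P.real (A j k) = 0 := le_antisymm this hPnn
        rw [h0]
        nlinarith [sq_nonneg D]
      · have hP : M.P.real (A j k) ≤ q.κ₃ * D := by
          refine le_trans (real_mono_ae ?_) (M.prob_Z_Icc_le hjk hD0 hδ1)
          filter_upwards [M.rich.bounded] with ω hω hωA
          have h1 := M.dec_margin hs hω k
          have h2 := M.opt_margin (M.X 0 ω) j
          rw [hωA.2] at h2
          rw [hωA.1] at h1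
          simp only [← hh, ← hD] at h1
          exact ⟨h2, by simp only [Z]; linarith⟩
        have h3 : M.P.real (A j k) * (h k - h j) ≤ q.κ₃ * D * D :=
          mul_le_mul hP (by linarith) (by linarith) (by positivity)
        nlinarith [sq_nonneg D]
    · rw [heq, sub_self, mul_zero, max_self]
      nlinarith [sq_nonneg D]
    · rw [max_eq_left (by linarith)]
      have hjk : j ≠ k := by rintro rfl; exact lt_irrefl _ hgt
      by_cases hbig : h j - h k ≤ 2 * D
      · have h1 : (h j - h k) ^ 2 ≤ 4 * D ^ 2 := by nlinarith
        have h2 : 0 ≤ M.P.real (A j k) * (h j - h k) := mul_nonneg hPnn (by linarith)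
        have h3 := mul_le_mul_of_nonneg_left h1 hcc
        nlinarith [sq_nonneg D]
      · push Not at hbig
        have hτ0 : 0 < (h j - h k) / 2 := by linarith
        have hwjk := hw j k
        have hP := M.prob_sepEvent_ge hjk hτ0 (by linarith)
        have hsub : M.P.real (M.sepEvent j k ((h j - h k) / 2)) ≤ M.P.real (A j k) := by
          refine real_mono_ae ?_
          filter_upwards [M.rich.bounded] with ω hω hω2
          obtain ⟨⟨hZ0, hZ1⟩, hsep⟩ := hω2
          constructor
          · by_contra hdj
            have h4 := M.dec_margin hs hω j
            have h6 := M.margin_add (M.dec s (M.X 0 ω)) j k (M.X 0 ω)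
            simp only [← hh, ← hD] at h4
            -- Choosing k is excluded because the advantage gap - D given to j exceeds the margin
            -- gap/2; choosing a third alternative is excluded because it is κ₄ away, more than w +
            -- D.
            by_cases hdk : M.dec s (M.X 0 ω) = k
            · rw [hdk] at h4 h6
              simp only [Z] at hZ0 hZ1
              have : margin M.β M.gstar k k (M.X 0 ω) = 0 := by simp [margin]
              linarith
            · have h7 := hsep _ hdj hdk
              have h8 := M.dec_margin hs hω k
              have h9 := hw (M.dec s (M.X 0 ω)) k
              simp only [Z, ← hh, ← hD] at h7 h8
              linarith
          · by_contra hoI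
            have h2 := M.opt_margin (M.X 0 ω) k
            have h3 : 0 < M.Z (M.opt (M.X 0 ω)) k ω := by
              by_cases hoJ : M.opt (M.X 0 ω) = j
              · rw [hoJ]; exact hZ0
              · exact q.hκ₄.trans_le (hsep _ hoJ hoI)
            simp only [Z, margin] at h2 h3
            linarith
        have h5 := mul_le_mul_of_nonneg_right (hP.trans hsub) (by linarith : 0 ≤ h j - h k)
        nlinarith [sq_nonneg D]
  rw [e1]
  have hsum := Finset.sum_le_sum fun j (_ : j ∈ Finset.univ) =>
    Finset.sum_le_sum fun k (_ : k ∈ Finset.univ) => term j k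
  refine le_trans ?_ hsum
  simp only [Finset.sum_sub_distrib, ← Finset.mul_sum, Finset.sum_const, Finset.card_univ,
    Fintype.card_fin, nsmul_eq_mul]
  rw [sum_pos_sq h h0]
  have h2 := two_mul_sum_sq_le h h0
  have h3 : 0 ≤ q.κ₂ * q.κ₅ := by positivity
  have := mul_le_mul_of_nonneg_left h2 h3
  nlinarith

end Model

/-! ### Counting the periods of forced exploration -/

lemma eventually_mul_pow_le_exp {a : ℝ} (ha : 0 < a) (C : ℝ) :
    ∀ᶠ x : ℝ in atTop, C * x ^ 8 ≤ Real.exp (a * x) := by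
  have h := (tendsto_exp_mul_div_rpow_atTop 8 a ha).eventually_ge_atTop C
  filter_upwards [h, eventually_gt_atTop 0] with x hx hx0
  rw [le_div_iff₀ (by positivity)] at hx
  exact_mod_cast hx

/-- The exploration times. -/
def forcedTime (a : ℝ) (m : ℕ) : ℕ := ⌈Real.exp (a * (m : ℝ) ^ ((1 : ℝ) / 9))⌉₊

/-- The exponent 1/9 is inverted here: about (log N / a)⁹ parameters m have their exploration time
within the first N periods. -/
lemma forcedTime_le_iff {a : ℝ} (ha : 0 < a) {m N : ℕ} (hN : 0 < N) :
    forcedTime a m ≤ N ↔ (m : ℝ) ≤ (Real.log N / a) ^ 9 := by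
  have hN' : (0 : ℝ) < N := by exact_mod_cast hN
  have hl : 0 ≤ Real.log N := Real.log_natCast_nonneg N
  rw [forcedTime, Nat.ceil_le, ← Real.le_log_iff_exp_le hN', mul_comm, ← le_div_iff₀ ha]
  have h9 : ((m : ℝ) ^ ((1 : ℝ) / 9)) ^ 9 = m := by
    rw [← Real.rpow_natCast, ← Real.rpow_mul (Nat.cast_nonneg m)]
    norm_num
  have hnn : 0 ≤ (m : ℝ) ^ ((1 : ℝ) / 9) := by positivity
  constructor
  · intro h
    calc (m : ℝ) = ((m : ℝ) ^ ((1 : ℝ) / 9)) ^ 9 := h9.symm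
      _ ≤ _ := pow_le_pow_left₀ hnn h 9
  · intro h
    rw [← h9] at h
    exact le_of_pow_le_pow_left₀ (by norm_num) (by positivity) h

/-- Rounding could merge exploration times. Consecutive even parameters differ by 2, so their ninth
roots differ by at least 2/(9A⁸), and the exponential growth eventually turns this into a distance
of at least 1. -/
lemma exists_forcedTime_succ_le {a : ℝ} (ha : 0 < a) :
    ∃ j₀ : ℕ, 0 < j₀ ∧ ∀ j, j₀ ≤ j → forcedTime a (2 * j) + 1 ≤ forcedTime a (2 * (j + 1)) := by
  have hB : Tendsto (fun j : ℕ => ((2 * j : ℕ) : ℝ) ^ ((1 : ℝ) / 9)) atTop atTop := by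
    refine (tendsto_rpow_atTop (by norm_num)).comp (tendsto_natCast_atTop_atTop.comp ?_)
    exact tendsto_id.const_mul_atTop' (by norm_num)
  -- The constant is 2304 = 9 · 256: nine terms in the factorisation of A⁹ - B⁹, and A⁸ ≤ (2B)⁸.
  obtain ⟨j₁, hj₁⟩ := eventually_atTop.1
    (hB.eventually (eventually_mul_pow_le_exp ha (2304 / (2 * a))))
  refine ⟨max j₁ 1, by positivity, fun j hj => ?_⟩
  have h1 := hj₁ j ((le_max_left _ _).trans hj)
  have hj1 : 1 ≤ j := (le_max_right _ _).trans hj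
  have hj1' : (1 : ℝ) ≤ j := by exact_mod_cast hj1
  set B := ((2 * j : ℕ) : ℝ) ^ ((1 : ℝ) / 9) with hBdef
  set A := ((2 * (j + 1) : ℕ) : ℝ) ^ ((1 : ℝ) / 9) with hAdef
  have h9 : ∀ m : ℕ, ((m : ℝ) ^ ((1 : ℝ) / 9)) ^ 9 = m := by
    intro m
    rw [← Real.rpow_natCast, ← Real.rpow_mul (Nat.cast_nonneg m)]
    norm_num
  have hB9 : B ^ 9 = 2 * j := by rw [hBdef, h9]; push_cast; ring
  have hA9 : A ^ 9 = 2 * j + 2 := by rw [hAdef, h9]; push_cast; ring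
  have hB0 : 0 < B := by rw [hBdef]; positivity
  have hA0 : 0 < A := by rw [hAdef]; positivity
  have hAB : B ≤ A := by
    refine le_of_pow_le_pow_left₀ (n := 9) (by norm_num) hA0.le ?_
    rw [hB9, hA9]; linarith
  have hA2 : A ≤ 2 * B := by
    refine le_of_pow_le_pow_left₀ (n := 9) (by norm_num) (by positivity) ?_
    rw [mul_pow, hB9, hA9]; linarith
  have hdiff : 2 ≤ 9 * A ^ 8 * (A - B) := by
    have hfac : A ^ 9 - B ^ 9 = (A - B) * (A ^ 8 + A ^ 7 * B + A ^ 6 * B ^ 2 + A ^ 5 * B ^ 3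
      + A ^ 4 * B ^ 4 + A ^ 3 * B ^ 5 + A ^ 2 * B ^ 6 + A * B ^ 7 + B ^ 8) := by ring
    have hi : ∀ i ≤ 8, A ^ (8 - i) * B ^ i ≤ A ^ 8 := by
      intro i hi
      calc A ^ (8 - i) * B ^ i ≤ A ^ (8 - i) * A ^ i :=
            mul_le_mul_of_nonneg_left (pow_le_pow_left₀ hB0.le hAB i) (by positivity)
        _ = A ^ 8 := by rw [← pow_add]; congr 1; omega
    have i1 := hi 1 (by norm_num)
    have i2 := hi 2 (by norm_num)
    have i3 := hi 3 (by norm_num)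
    have i4 := hi 4 (by norm_num)
    have i5 := hi 5 (by norm_num)
    have i6 := hi 6 (by norm_num)
    have i7 := hi 7 (by norm_num)
    have i8 := hi 8 (by norm_num)
    norm_num at i1 i2 i3 i4 i5 i6 i7 i8
    have h2 : A ^ 9 - B ^ 9 = 2 := by rw [hA9, hB9]; ring
    have hle : (A - B) * (A ^ 8 + A ^ 7 * B + A ^ 6 * B ^ 2 + A ^ 5 * B ^ 3
      + A ^ 4 * B ^ 4 + A ^ 3 * B ^ 5 + A ^ 2 * B ^ 6 + A * B ^ 7 + B ^ 8)
      ≤ (A - B) * (9 * A ^ 8) := mul_le_mul_of_nonneg_left (by linarith) (by linarith)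
    linarith
  have hA8 : A ^ 8 ≤ 256 * B ^ 8 := by
    calc A ^ 8 ≤ (2 * B) ^ 8 := pow_le_pow_left₀ hA0.le hA2 8
      _ = _ := by ring
  have hexp : Real.exp (a * B) + 1 ≤ Real.exp (a * A) := by
    have e1 : Real.exp (a * A) = Real.exp (a * B) * Real.exp (a * (A - B)) := by
      rw [← Real.exp_add]; congr 1; ring
    have e2 := Real.add_one_le_exp (a * (A - B))
    have e3 : 1 ≤ Real.exp (a * B) * (a * (A - B)) := by
      have h4 : 2304 * B ^ 8 ≤ 2 * a * Real.exp (a * B) := by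
        rw [div_mul_eq_mul_div, div_le_iff₀ (by positivity)] at h1
        linarith
      have h5 : 9 * A ^ 8 ≤ 2 * a * Real.exp (a * B) := by linarith
      have h6 : 9 * A ^ 8 * (A - B) ≤ 2 * a * Real.exp (a * B) * (A - B) :=
        mul_le_mul_of_nonneg_right h5 (by linarith)
      linarith
    have e4 := mul_le_mul_of_nonneg_left e2 (Real.exp_pos (a * B)).le
    rw [e1]
    linarith
  unfold forcedTime
  rw [← Nat.ceil_add_one (Real.exp_pos _).le]
  exact Nat.ceil_mono hexp

/-- Only even parameters are counted: they explore the first alternative (divisor 2), their times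
are eventually distinct, and they already give half of the maximal order. -/
lemma card_forced_ge {K : ℕ} (hK : 0 < K) {a : ℝ} (ha : 0 < a) :
    ∃ C : ℝ, ∀ N : ℕ, 0 < N → (Real.log N / a) ^ 9 / 2 - C
      ≤ (((Finset.range (N + 1)).filter fun i => IsForced K a i).card : ℝ) := by
  obtain ⟨j₀, hj₀, hsucc⟩ := exists_forcedTime_succ_le ha
  refine ⟨j₀ + 1, fun N hN => ?_⟩
  set L : ℝ := (Real.log N / a) ^ 9 / 2 with hL
  have hL0 : 0 ≤ L := by
    have : 0 ≤ Real.log N := Real.log_natCast_nonneg N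
    positivity
  have hmono : StrictMono fun i : ℕ => forcedTime a (2 * (j₀ + i)) :=
    strictMono_nat_of_lt_succ fun i => hsucc (j₀ + i) (by omega)
  have hsub : (Finset.range (⌊L⌋₊ - j₀)).image (fun i : ℕ => forcedTime a (2 * (j₀ + i)))
      ⊆ (Finset.range (N + 1)).filter fun i => IsForced K a i := by
    intro n hn
    obtain ⟨i, hi, rfl⟩ := Finset.mem_image.1 hn
    rw [Finset.mem_range] at hi
    rw [Finset.mem_filter, Finset.mem_range, Nat.lt_succ_iff]
    constructor
    · rw [forcedTime_le_iff ha hN]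
      have : ((j₀ + i : ℕ) : ℝ) ≤ L := by
        refine le_trans ?_ (Nat.floor_le hL0)
        exact_mod_cast (by omega : j₀ + i ≤ ⌊L⌋₊)
      push_cast at this ⊢
      linarith
    · refine ⟨⟨0, hK⟩, 2 * (j₀ + i), by omega, ?_, rfl⟩
      exact Nat.dvd_mul_right 2 _
  have hcard := Finset.card_le_card hsub
  rw [Finset.card_image_of_injective _ hmono.injective, Finset.card_range] at hcard
  have h1 : L < ⌊L⌋₊ + 1 := Nat.lt_floor_add_one L
  have h2 : (⌊L⌋₊ : ℝ) ≤ (((Finset.range (N + 1)).filter fun i => IsForced K a i).card : ℝ) + j₀ := by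
    exact_mod_cast (by omega : ⌊L⌋₊ ≤ ((Finset.range (N + 1)).filter fun i => IsForced K a i).card + j₀)
  linarith

lemma card_forced_le {K : ℕ} {a : ℝ} (ha : 0 < a) {n : ℕ} (hn : 0 < n) :
    (((Finset.range n).filter fun i => IsForced K a i).card : ℝ) ≤ (Real.log n / a) ^ 9 + 1 := by
  set L : ℝ := (Real.log n / a) ^ 9 with hL
  have hL0 : 0 ≤ L := by
    have : 0 ≤ Real.log n := Real.log_natCast_nonneg n
    positivity
  have hsub : ((Finset.range n).filter fun i => IsForced K a i)
      ⊆ (Finset.range (⌊L⌋₊ + 1)).image (forcedTime a) := by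
    intro i hi
    rw [Finset.mem_filter, Finset.mem_range] at hi
    obtain ⟨hin, k, m, hm, -, rfl⟩ := hi
    refine Finset.mem_image.2 ⟨m, ?_, rfl⟩
    rw [Finset.mem_range, Nat.lt_succ_iff]
    exact Nat.le_floor ((forcedTime_le_iff ha hn).1 hin.le)
  have h := (Finset.card_le_card hsub).trans Finset.card_image_le
  rw [Finset.card_range] at h
  have h2 : (((Finset.range n).filter fun i => IsForced K a i).card : ℝ) ≤ ⌊L⌋₊ + 1 := by
    exact_mod_cast h
  linarith [Nat.floor_le hL0]

lemma eventually_card_forced_le {K : ℕ} {a : ℝ} (ha : 0 < a) {c : ℝ} (hc : 0 < c) :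
    ∀ᶠ n : ℕ in atTop, (((Finset.range n).filter fun i => IsForced K a i).card : ℝ) ≤ c * n := by
  have h1 : ∀ᶠ x : ℝ in atTop, Real.log x ^ 9 ≤ a ^ 9 * (c / 2) * x := by
    have := (Real.isLittleO_pow_log_id_atTop (n := 9)).def (by positivity : 0 < a ^ 9 * (c / 2))
    filter_upwards [this, eventually_ge_atTop 0] with x hx hx0
    rw [id, Real.norm_eq_abs, Real.norm_eq_abs, abs_of_nonneg hx0] at hx
    exact (le_abs_self _).trans hx
  have h2 := tendsto_natCast_atTop_atTop.eventually h1
  have h3 := tendsto_natCast_atTop_atTop.eventually (eventually_ge_atTop (2 / c))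
  filter_upwards [h2, h3, eventually_gt_atTop 0] with n hn hn2 hn0
  refine (card_forced_le ha hn0).trans ?_
  rw [div_le_iff₀ hc] at hn2
  have : (Real.log n / a) ^ 9 ≤ c / 2 * n := by
    rw [div_pow, div_le_iff₀ (by positivity)]
    linarith
  linarith

/-- The number of forced explorations of `k` before `n`. -/
def forcedSet {K : ℕ} (a : ℝ) (r : ℕ → Fin K) (k : Fin K) (n : ℕ) : Finset ℕ :=
  (Finset.range n).filter fun i => IsForced K a i ∧ r i = k

/-- The total number of forced periods is of order (log n)⁹ and each alternative gets a fixed share,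
so every multiple of (log n)³ is eventually exceeded. That is the scale of the regression bound to
be beaten. -/
lemma eventually_le_card_forcedSet {K : ℕ} {a : ℝ} (ha : 0 < a) {r : ℕ → Fin K}
    (hr : IsExplorationRule a r) (k : Fin K) {A : ℝ} (hA : 0 < A) :
    ∀ᶠ n : ℕ in atTop, A * (1 + Real.log n) ^ 3 ≤ ((forcedSet a r k n).card : ℝ) := by
  obtain ⟨c, hc, hshare⟩ := hr.share
  obtain ⟨C, hC⟩ := card_forced_ge (K := K) (Fin.pos k) ha
  set c' : ℝ := c / (2 * a ^ 9) with hc'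
  have hc'0 : 0 < c' := by positivity
  -- The 2 in place of 1 absorbs log(N + 1) ≤ 1 + log N: the share counts periods up to N inclusive,
  -- `forcedSet` those before n = N + 1.
  have key : ∀ᶠ x : ℝ in atTop, A * (2 + x) ^ 3 ≤ c * ((x / a) ^ 9 / 2 - C) := by
    filter_upwards [eventually_ge_atTop 2, eventually_ge_atTop ((8 * A + c * |C|) / c')] with x h2 h3
    rw [div_le_iff₀ hc'0] at h3
    have e1 : c * ((x / a) ^ 9 / 2 - C) = c' * x ^ 9 - c * C := by
      rw [hc', div_pow]; field_simp
    have e2 : (2 + x) ^ 3 ≤ 8 * x ^ 3 := by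
      calc (2 + x) ^ 3 ≤ (2 * x) ^ 3 := pow_le_pow_left₀ (by linarith) (by linarith) 3
        _ = _ := by ring
    have hx3 : 1 ≤ x ^ 3 := one_le_pow₀ (by linarith)
    have e3 : (8 * A + c * |C|) * x ^ 3 ≤ c' * x ^ 9 := by
      have h5 : x ≤ x ^ 6 := le_self_pow₀ (by linarith) (by norm_num)
      calc (8 * A + c * |C|) * x ^ 3 ≤ (x * c') * x ^ 3 :=
            mul_le_mul_of_nonneg_right h3 (by positivity)
        _ ≤ (x ^ 6 * c') * x ^ 3 := by gcongr
        _ = _ := by ring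
    have e4 : A * (2 + x) ^ 3 ≤ A * (8 * x ^ 3) := mul_le_mul_of_nonneg_left e2 hA.le
    have e5 : c * C ≤ c * |C| * x ^ 3 := by
      have h6 : c * C ≤ c * |C| := mul_le_mul_of_nonneg_left (le_abs_self C) hc.le
      have h7 : c * |C| * 1 ≤ c * |C| * x ^ 3 := mul_le_mul_of_nonneg_left hx3 (by positivity)
      linarith
    rw [e1]
    linarith
  have key2 := (Real.tendsto_log_atTop.comp tendsto_natCast_atTop_atTop).eventually key
  have : ∀ᶠ N : ℕ in atTop,
      A * (1 + Real.log ((N + 1 : ℕ) : ℝ)) ^ 3 ≤ ((forcedSet a r k (N + 1)).card : ℝ) := by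
    filter_upwards [key2, hshare k, eventually_gt_atTop 0] with N h1 h2 h3
    simp only [Function.comp_apply] at h1
    have f1 : ({n | n ≤ N ∧ IsForced K a n} : Set ℕ)
        = ↑((Finset.range (N + 1)).filter fun i => IsForced K a i) := by
      ext; simp
    have f2 : ({n | n ≤ N ∧ IsForced K a n ∧ r n = k} : Set ℕ)
        = ↑(forcedSet a r k (N + 1)) := by
      ext; simp [forcedSet]
    rw [f1, f2, Set.ncard_coe_finset, Set.ncard_coe_finset] at h2
    have h4 := mul_le_mul_of_nonneg_left (hC N h3) hc.le
    refine le_trans ?_ (h1.trans (h4.trans h2))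
    have hN1 : (1 : ℝ) ≤ N := by exact_mod_cast h3
    have hlog : Real.log ((N + 1 : ℕ) : ℝ) ≤ 1 + Real.log N := by
      have : ((N + 1 : ℕ) : ℝ) ≤ Real.exp 1 * N := by
        have := Real.add_one_le_exp (1 : ℝ)
        push_cast
        nlinarith
      calc Real.log ((N + 1 : ℕ) : ℝ) ≤ Real.log (Real.exp 1 * N) :=
            Real.log_le_log (by positivity) this
        _ = _ := by rw [Real.log_mul (Real.exp_pos 1).ne' (by positivity), Real.log_exp]
    have hl0 : 0 ≤ Real.log ((N + 1 : ℕ) : ℝ) := Real.log_natCast_nonneg _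
    have : (1 + Real.log ((N + 1 : ℕ) : ℝ)) ^ 3 ≤ (2 + Real.log N) ^ 3 :=
      pow_le_pow_left₀ (by linarith) (by linarith) 3
    exact mul_le_mul_of_nonneg_left this hA.le
  obtain ⟨N, hN⟩ := eventually_atTop.1 this
  refine eventually_atTop.2 ⟨N + 1, fun n hn => ?_⟩
  obtain ⟨m, rfl⟩ : ∃ m, n = m + 1 := ⟨n - 1, by omega⟩
  exact hN m (by omega)

/-! ### Finite nets -/

lemma norm_le_of_abs_le {d : ℕ} {x : EuclideanSpace ℝ (Fin d)} {c : ℝ} (hc : 0 ≤ c)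
    (h : ∀ i, |x i| ≤ c) : ‖x‖ ≤ d * c := by
  refine le_of_sq_le_sq ?_ (by positivity)
  rw [EuclideanSpace.norm_sq_eq]
  calc ∑ i, ‖x i‖ ^ 2 ≤ ∑ i : Fin d, c ^ 2 :=
        Finset.sum_le_sum fun i _ => pow_le_pow_left₀ (norm_nonneg _) (h i) 2
    _ = d * c ^ 2 := by simp
    _ ≤ (d * c) ^ 2 := by
        rw [mul_pow]
        refine mul_le_mul_of_nonneg_right ?_ (by positivity)
        exact_mod_cast Nat.le_self_pow (by norm_num) d

/-- A grid of mesh 1/M. All that matters is a cardinality polynomial in the radius and in the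
inverse mesh; the crude error d/M suffices. -/
lemma exists_net (d B M : ℕ) (hM : 0 < M) :
    ∃ G : Finset (EuclideanSpace ℝ (Fin d)), G.card ≤ (2 * (B * M) + 1) ^ d ∧
      ∀ θ : EuclideanSpace ℝ (Fin d), ‖θ‖ ≤ B → ∃ θ' ∈ G, ‖θ - θ'‖ ≤ d / M := by
  have hM' : (0 : ℝ) < M := by exact_mod_cast hM
  set T : ℤ := ((B * M : ℕ) : ℤ) with hT
  set pt : (Fin d → ℤ) → EuclideanSpace ℝ (Fin d) := fun i =>
    WithLp.toLp 2 fun l => (i l : ℝ) / M with hpt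
  refine ⟨(Fintype.piFinset fun _ : Fin d => Finset.Icc (-T) T).image pt, ?_, ?_⟩
  · refine Finset.card_image_le.trans ?_
    rw [Fintype.card_piFinset]
    simp only [Int.card_Icc, Finset.prod_const, Finset.card_univ, Fintype.card_fin]
    refine Nat.pow_le_pow_left ?_ d
    omega
  · intro θ hθ
    refine ⟨pt fun l => ⌊θ l * M⌋, Finset.mem_image.2 ⟨_, ?_, rfl⟩, ?_⟩
    · rw [Fintype.mem_piFinset]
      intro l
      have h1 : |θ l| ≤ B := (PiLp.norm_apply_le θ l).trans hθ
      have h2 := abs_le.1 h1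
      have e : ((T : ℤ) : ℝ) = B * M := by rw [hT]; push_cast; ring
      rw [Finset.mem_Icc]
      constructor
      · rw [Int.le_floor]
        push_cast
        rw [e]
        nlinarith
      · have : (⌊θ l * M⌋ : ℝ) ≤ (T : ℝ) := by
          refine (Int.floor_le _).trans ?_
          rw [e]
          nlinarith
        exact_mod_cast this
    · have := norm_le_of_abs_le (x := θ - pt fun l => ⌊θ l * M⌋) (c := 1 / M) (by positivity) ?_
      · rwa [mul_one_div] at this
      · intro l
        have h1 := Int.floor_le (θ l * M)
        have h2 := Int.lt_floor_add_one (θ l * M)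
        have e : (θ - pt fun l => ⌊θ l * M⌋) l = (θ l * M - ⌊θ l * M⌋) / M := by
          simp only [hpt, PiLp.sub_apply]
          field_simp
        rw [e, abs_div, abs_of_pos hM', abs_of_nonneg (by linarith)]
        gcongr
        linarith

/-! ### Exponential inequalities for the noise -/

lemma sq_le_exp_add_exp_neg (x : ℝ) : x ^ 2 ≤ Real.exp x + Real.exp (-x) := by
  have h : ∀ y : ℝ, 0 ≤ y → y ^ 2 ≤ Real.exp y + Real.exp (-y) := by
    intro y hy
    have h1 := Real.one_sub_le_exp_neg y
    have h2 := Real.quadratic_le_exp_of_nonneg hy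
    have h3 := (Real.exp_pos (-y)).le
    rcases le_or_gt y 2 with h4 | h4
    · nlinarith
    · have h5 : Real.exp y = Real.exp (y / 2) ^ 2 := by rw [← Real.exp_nat_mul]; congr 1; push_cast; ring
      have h6 := Real.quadratic_le_exp_of_nonneg (by linarith : 0 ≤ y / 2)
      have h7 : y ≤ Real.exp (y / 2) := by nlinarith
      have h8 : y ^ 2 ≤ Real.exp (y / 2) ^ 2 := pow_le_pow_left₀ hy h7 2
      linarith
  rcases le_total 0 x with hx | hx
  · exact h x hx
  · have := h (-x) (by linarith)
    rw [neg_neg, neg_sq] at this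
    linarith

namespace Model

variable {K d : ℕ} {q : Par K d} (M : Model q)

lemma ae_norm_X_le_all : ∀ᵐ ω ∂M.P, ∀ n, ‖M.X n ω‖ ≤ q.κ₆ :=
  ae_all_iff.2 M.ae_norm_X_le

/-- Integrating the conditional bound over the sample loses nothing that is needed, since noise and
sample of a period are independent. -/
lemma lintegral_exp_noise_le (n : ℕ) (k : Fin K) (t : ℝ) :
    ∫⁻ ω, ENNReal.ofReal (Real.exp (t * M.ε n k ω)) ∂M.P
      ≤ ENNReal.ofReal (Real.exp (q.κ₇ / 2 * t ^ 2)) := by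
  obtain ⟨hi, hc⟩ := M.subG n k t
  have hle : MeasurableSpace.comap (M.X n) inferInstance ≤ M.mΩ := (M.measurable_X n).comap_le
  rw [← ofReal_integral_eq_lintegral_ofReal hi (Eventually.of_forall fun _ => (Real.exp_pos _).le)]
  refine ENNReal.ofReal_le_ofReal ?_
  rw [← integral_condExp hle]
  calc _ ≤ ∫ _, Real.exp (1 / 2 * q.κ₇ * t ^ 2) ∂M.P :=
        integral_mono_ae integrable_condExp (integrable_const _) hc
    _ = Real.exp (q.κ₇ / 2 * t ^ 2) := by
        simp only [integral_const, probReal_univ, smul_eq_mul, one_mul]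
        congr 1
        ring

lemma lintegral_obs {f : EuclideanSpace ℝ (Fin d) → (Fin K → ℝ) → ENNReal}
    (hf : Measurable (Function.uncurry f)) :
    ∫⁻ ω, f (M.X 0 ω) (fun k => M.ε 0 k ω) ∂M.P
      = ∫⁻ ω, ∫⁻ ω', f (M.X 0 ω) (fun k => M.ε 0 k ω') ∂M.P ∂M.P := by
  have hX := M.measurable_X 0
  have hE : Measurable fun ω (k : Fin K) => M.ε 0 k ω :=
    measurable_pi_lambda _ fun k => M.data.measurable_noise 0 k
  have h1 := (indepFun_iff_map_prod_eq_prod_map_map hX.aemeasurable hE.aemeasurable).1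
    (M.indep_X_noise_at 0)
  have h2 : ∫⁻ ω, f (M.X 0 ω) (fun k => M.ε 0 k ω) ∂M.P
      = ∫⁻ z, Function.uncurry f z ∂(M.P.map fun ω => (M.X 0 ω, fun k => M.ε 0 k ω)) :=
    (lintegral_map hf (hX.prodMk hE)).symm
  have hp : IsProbabilityMeasure (M.P.map fun ω (k : Fin K) => M.ε 0 k ω) :=
    Measure.isProbabilityMeasure_map hE.aemeasurable
  rw [h2, h1, lintegral_prod _ hf.aemeasurable, lintegral_map hf.lintegral_prod_right' hX]
  refine lintegral_congr fun ω => ?_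
  exact lintegral_map (hf.comp measurable_prodMk_left) hE

/-! ### Self-normalised exponential inequality -/

lemma quad_succ (n : ℕ) (k : Fin K) (θ : EuclideanSpace ℝ (Fin d)) (ω : M.Ω) :
    M.quad (n + 1) k θ ω = M.quad n k θ ω
      + if M.sel n ω = k then (inner ℝ θ (M.X n ω) : ℝ) ^ 2 else 0 :=
  Finset.sum_range_succ _ _

lemma inner_noiseSum_succ (n : ℕ) (k : Fin K) (θ : EuclideanSpace ℝ (Fin d)) (ω : M.Ω) :
    (inner ℝ θ (M.noiseSum (n + 1) k ω) : ℝ) = inner ℝ θ (M.noiseSum n k ω)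
      + if M.sel n ω = k then M.ε n k ω * (inner ℝ θ (M.X n ω) : ℝ) else 0 := by
  rw [noiseSum, Finset.sum_range_succ, inner_add_right]
  congr 1
  split_ifs <;> simp [inner_smul_right]

lemma measurable_inner_noiseSum (n : ℕ) (k : Fin K) (θ : EuclideanSpace ℝ (Fin d)) :
    Measurable[M.past n] fun ω => (inner ℝ θ (M.noiseSum n k ω) : ℝ) := by
  have : Measurable fun x : EuclideanSpace ℝ (Fin d) => (inner ℝ θ x : ℝ) := by fun_prop
  exact this.comp (M.measurable_noiseSum n k)

/-- The integrand is a nonnegative supermartingale started at 1. Whether k is selected is decided by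
the past and the current sample, independently of the current noise, so each factor has mean at most
1 by sub-Gaussianity. The compensator is the design itself, which makes the bound self-normalised.
-/
lemma lintegral_exp_noiseSum_le (n : ℕ) (k : Fin K) (θ : EuclideanSpace ℝ (Fin d)) :
    ∫⁻ ω, ENNReal.ofReal (Real.exp (inner ℝ θ (M.noiseSum n k ω)
      - q.κ₇ / 2 * M.quad n k θ ω)) ∂M.P ≤ 1 := by
  induction n with
  | zero => simp [noiseSum, quad]
  | succ n ih =>
    refine le_trans (le_of_eq (b := ∫⁻ ω, ∫⁻ ω', ENNReal.ofReal (Real.exp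
        ((inner ℝ θ (M.noiseSum n k ω) - q.κ₇ / 2 * M.quad n k θ ω)
          + if M.policy n (M.est n ω) (M.X 0 ω') = k then
            M.ε 0 k ω' * (inner ℝ θ (M.X 0 ω') : ℝ)
              - q.κ₇ / 2 * (inner ℝ θ (M.X 0 ω') : ℝ) ^ 2 else 0)) ∂M.P ∂M.P) ?_)
      (le_trans ?_ ih)
    · set A : M.Ω → ℝ × ((Fin K → ℝ) × (Fin K → EuclideanSpace ℝ (Fin d))) := fun ω =>
        (inner ℝ θ (M.noiseSum n k ω) - q.κ₇ / 2 * M.quad n k θ ω, M.est n ω) with hA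
      have hAm : Measurable[M.past n] A := by
        have h1 : Measurable[M.past n] fun ω =>
            (inner ℝ θ (M.noiseSum n k ω) : ℝ) - q.κ₇ / 2 * M.quad n k θ ω :=
          measurable_comp₂ (F := fun a b : ℝ => a - q.κ₇ / 2 * b) (by fun_prop)
            (M.measurable_inner_noiseSum n k θ) (M.measurable_quad n k θ)
        exact measurable_comp₂ (F := fun a b => (a, b)) measurable_id h1 (M.measurable_est n)
      set f : ℝ × ((Fin K → ℝ) × (Fin K → EuclideanSpace ℝ (Fin d))) →
          EuclideanSpace ℝ (Fin d) × (Fin K → ℝ) → ENNReal := fun y z =>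
        ENNReal.ofReal (Real.exp (y.1 + if M.policy n y.2 z.1 = k then
          z.2 k * (inner ℝ θ z.1 : ℝ) - q.κ₇ / 2 * (inner ℝ θ z.1 : ℝ) ^ 2 else 0)) with hf
      have hfm : Measurable (Function.uncurry f) := by
        refine (Real.measurable_exp.comp ((measurable_fst.comp measurable_fst).add
          (Measurable.ite ?_ (by fun_prop) measurable_const))).ennreal_ofReal
        exact measurable_comp₂ (M.measurable_policy n) (measurable_snd.comp measurable_fst)
          (measurable_fst.comp measurable_snd) (measurableSet_singleton k)
      refine Eq.trans ?_ (M.lintegral_step hAm hfm)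
      refine lintegral_congr fun ω => ?_
      simp only [hf, hA, obs]
      rw [inner_noiseSum_succ, quad_succ]
      change ENNReal.ofReal (Real.exp (_ + (if M.sel n ω = k then _ else _)
        - q.κ₇ / 2 * (_ + if M.sel n ω = k then _ else _))) = ENNReal.ofReal (Real.exp (_ +
          if M.sel n ω = k then _ else _))
      congr 2
      split_ifs <;> ring
    · refine lintegral_mono fun ω => ?_
      set y : ℝ := inner ℝ θ (M.noiseSum n k ω) - q.κ₇ / 2 * M.quad n k θ ω
      set F : EuclideanSpace ℝ (Fin d) → (Fin K → ℝ) → ENNReal := fun x e =>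
        ENNReal.ofReal (Real.exp (y + if M.policy n (M.est n ω) x = k then
          e k * (inner ℝ θ x : ℝ) - q.κ₇ / 2 * (inner ℝ θ x : ℝ) ^ 2 else 0)) with hF
      have hFm : Measurable (Function.uncurry F) := by
        refine (Real.measurable_exp.comp (measurable_const.add
          (Measurable.ite ?_ (by fun_prop) measurable_const))).ennreal_ofReal
        exact measurable_comp₂ (M.measurable_policy n) measurable_const
          measurable_fst (measurableSet_singleton k)
      change ∫⁻ ω', F (M.X 0 ω') (fun k => M.ε 0 k ω') ∂M.P ≤ _
      rw [M.lintegral_obs hFm]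
      -- For a fixed sample the selection is determined, and only the noise is integrated.
      have hpt : ∀ x, ∫⁻ ω', F x (fun k => M.ε 0 k ω') ∂M.P ≤ ENNReal.ofReal (Real.exp y) := by
        intro x
        simp only [hF]
        split_ifs
        · set t : ℝ := inner ℝ θ x
          have e : ∀ u : ℝ, ENNReal.ofReal (Real.exp (y + (u * t - q.κ₇ / 2 * t ^ 2)))
              = ENNReal.ofReal (Real.exp (y - q.κ₇ / 2 * t ^ 2))
                * ENNReal.ofReal (Real.exp (t * u)) := by
            intro u
            rw [← ENNReal.ofReal_mul (Real.exp_pos _).le, ← Real.exp_add]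
            congr 2
            ring
          simp only [e]
          rw [lintegral_const_mul' _ _ ENNReal.ofReal_ne_top]
          calc _ ≤ ENNReal.ofReal (Real.exp (y - q.κ₇ / 2 * t ^ 2))
                * ENNReal.ofReal (Real.exp (q.κ₇ / 2 * t ^ 2)) := by
                gcongr
                exact M.lintegral_exp_noise_le 0 k t
            _ = _ := by
                rw [← ENNReal.ofReal_mul (Real.exp_pos _).le, ← Real.exp_add]
                congr 2
                ring
        · simp
      calc _ ≤ ∫⁻ _, ENNReal.ofReal (Real.exp y) ∂M.P := lintegral_mono fun ω' => hpt _
        _ = _ := by simp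

lemma prob_le_of_lintegral_exp {Y : M.Ω → ℝ} (hY : Measurable Y) {c : ℝ}
    (h : ∫⁻ ω, ENNReal.ofReal (Real.exp (Y ω)) ∂M.P ≤ ENNReal.ofReal (Real.exp c)) (L : ℝ) :
    M.P.real {ω | L < Y ω} ≤ Real.exp (c - L) := by
  have h1 := mul_meas_ge_le_lintegral (μ := M.P)
    (Real.measurable_exp.comp hY).ennreal_ofReal (ENNReal.ofReal (Real.exp L))
  have h2 : M.P {ω | L < Y ω} ≤ M.P {ω | ENNReal.ofReal (Real.exp L)
      ≤ ENNReal.ofReal ((Real.exp ∘ Y) ω)} := by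
    refine measure_mono fun ω hω => ?_
    exact ENNReal.ofReal_le_ofReal (Real.exp_le_exp.2 (le_of_lt hω))
  have h3 : ENNReal.ofReal (Real.exp L) * M.P {ω | L < Y ω} ≤ ENNReal.ofReal (Real.exp c) :=
    (mul_le_mul_right h2 _).trans (h1.trans h)
  have h4 := ENNReal.toReal_mono ENNReal.ofReal_ne_top h3
  rw [ENNReal.toReal_mul, ENNReal.toReal_ofReal (Real.exp_pos _).le,
    ENNReal.toReal_ofReal (Real.exp_pos _).le] at h4
  rw [Real.exp_sub, le_div_iff₀ (Real.exp_pos _), mul_comm]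
  exact h4

lemma prob_noiseSum_gt_le (n : ℕ) (k : Fin K) (θ : EuclideanSpace ℝ (Fin d)) (L : ℝ) :
    M.P.real {ω | q.κ₇ / 2 * M.quad n k θ ω + L < inner ℝ θ (M.noiseSum n k ω)}
      ≤ Real.exp (-L) := by
  have h1 := ((M.measurable_inner_noiseSum n k θ).mono (M.past_le n) le_rfl).sub
    (((M.measurable_quad n k θ).mono (M.past_le n) le_rfl).const_mul (q.κ₇ / 2))
  have h := M.prob_le_of_lintegral_exp (c := 0) h1
    (by simpa using M.lintegral_exp_noiseSum_le n k θ) L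
  rw [zero_sub] at h
  refine le_trans (le_of_eq ?_) h
  congr 1
  ext ω
  simp only [Set.mem_ofPred_eq, Pi.sub_apply]
  constructor <;> intro h <;> linarith

/-! ### Bounds for `quad` and second moments of the noise -/

lemma quad_nonneg (n : ℕ) (k : Fin K) (θ : EuclideanSpace ℝ (Fin d)) (ω : M.Ω) :
    0 ≤ M.quad n k θ ω :=
  Finset.sum_nonneg fun i _ => by split_ifs <;> positivity

lemma quad_smul (n : ℕ) (k : Fin K) (c : ℝ) (θ : EuclideanSpace ℝ (Fin d)) (ω : M.Ω) :
    M.quad n k (c • θ) ω = c ^ 2 * M.quad n k θ ω := by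
  unfold quad
  rw [Finset.mul_sum]
  refine Finset.sum_congr rfl fun i _ => ?_
  split_ifs
  · rw [inner_smul_left]
    simp only [conj_trivial]
    ring
  · simp

lemma quad_le (n : ℕ) (k : Fin K) (θ : EuclideanSpace ℝ (Fin d)) {ω : M.Ω}
    (hω : ∀ i, ‖M.X i ω‖ ≤ q.κ₆) : M.quad n k θ ω ≤ n * (q.κ₆ ^ 2 * ‖θ‖ ^ 2) := by
  unfold quad
  calc _ ≤ ∑ i ∈ Finset.range n, q.κ₆ ^ 2 * ‖θ‖ ^ 2 := by
        refine Finset.sum_le_sum fun i _ => ?_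
        split_ifs
        · exact sq_inner_le (hω i)
        · positivity
    _ = _ := by simp

lemma sq_inner_sub_le {θ θ' x : EuclideanSpace ℝ (Fin d)} (hx : ‖x‖ ≤ q.κ₆) :
    (inner ℝ θ x : ℝ) ^ 2
      ≤ (inner ℝ θ' x : ℝ) ^ 2 + q.κ₆ ^ 2 * (‖θ - θ'‖ * (‖θ‖ + ‖θ'‖)) := by
  have e : (inner ℝ θ x : ℝ) ^ 2 - (inner ℝ θ' x : ℝ) ^ 2
      = inner ℝ (θ - θ') x * inner ℝ (θ + θ') x := by
    rw [inner_sub_left, inner_add_left]; ring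
  have h1 : |(inner ℝ (θ - θ') x : ℝ)| ≤ ‖θ - θ'‖ * q.κ₆ :=
    (abs_real_inner_le_norm _ _).trans (mul_le_mul_of_nonneg_left hx (norm_nonneg _))
  have h2 : |(inner ℝ (θ + θ') x : ℝ)| ≤ (‖θ‖ + ‖θ'‖) * q.κ₆ :=
    (abs_real_inner_le_norm _ _).trans
      (mul_le_mul (norm_add_le _ _) hx (norm_nonneg _) (by positivity))
  have h3 : inner ℝ (θ - θ') x * inner ℝ (θ + θ') x
      ≤ (‖θ - θ'‖ * q.κ₆) * ((‖θ‖ + ‖θ'‖) * q.κ₆) := by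
    refine (le_abs_self _).trans ?_
    rw [abs_mul]
    exact mul_le_mul h1 h2 (abs_nonneg _) ((abs_nonneg _).trans h1)
  nlinarith

lemma quad_le_quad (n : ℕ) (k : Fin K) (θ θ' : EuclideanSpace ℝ (Fin d)) {ω : M.Ω}
    (hω : ∀ i, ‖M.X i ω‖ ≤ q.κ₆) :
    M.quad n k θ ω ≤ M.quad n k θ' ω + n * (q.κ₆ ^ 2 * (‖θ - θ'‖ * (‖θ‖ + ‖θ'‖))) := by
  have : (n : ℝ) * (q.κ₆ ^ 2 * (‖θ - θ'‖ * (‖θ‖ + ‖θ'‖)))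
      = ∑ i ∈ Finset.range n, q.κ₆ ^ 2 * (‖θ - θ'‖ * (‖θ‖ + ‖θ'‖)) := by simp
  unfold quad
  rw [this, ← Finset.sum_add_distrib]
  refine Finset.sum_le_sum fun i _ => ?_
  split_ifs
  · exact sq_inner_sub_le (hω i)
  · positivity

/-- A bound for the second moment of `noiseSum` in terms of the number of periods. -/
def noiseConst (q : Par K d) : ℝ := d * (2 * Real.exp (q.κ₇ / 2 * q.κ₆ ^ 2))

lemma noiseConst_nonneg (q : Par K d) : 0 ≤ noiseConst q := by unfold noiseConst; positivity

/-- Scaling θ by 1/√n bounds the compensator by a constant, hence also the exponential moments of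
both signs; then x² ≤ eˣ + e⁻ˣ gives a second moment of order n. -/
lemma lintegral_inner_noiseSum_sq_le {n : ℕ} (hn : 0 < n) (k : Fin K)
    {θ : EuclideanSpace ℝ (Fin d)} (hθ : ‖θ‖ = 1) :
    ∫⁻ ω, ENNReal.ofReal ((inner ℝ θ (M.noiseSum n k ω) : ℝ) ^ 2) ∂M.P
      ≤ ENNReal.ofReal (n * (2 * Real.exp (q.κ₇ / 2 * q.κ₆ ^ 2))) := by
  have hn' : (0 : ℝ) < n := by exact_mod_cast hn
  have hκ₇ := q.hκ₇
  set c : ℝ := (Real.sqrt n)⁻¹ with hc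
  have hc2 : n * c ^ 2 = 1 := by
    rw [hc, inv_pow, Real.sq_sqrt hn'.le]
    field_simp
  have hexp : ∀ s : ℝ, s ^ 2 = c ^ 2 →
      ∫⁻ ω, ENNReal.ofReal (Real.exp (s * inner ℝ θ (M.noiseSum n k ω))) ∂M.P
        ≤ ENNReal.ofReal (Real.exp (q.κ₇ / 2 * q.κ₆ ^ 2)) := by
    intro s hs
    have h := M.lintegral_exp_noiseSum_le n k (s • θ)
    calc ∫⁻ ω, ENNReal.ofReal (Real.exp (s * inner ℝ θ (M.noiseSum n k ω))) ∂M.P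
        ≤ ∫⁻ ω, ENNReal.ofReal (Real.exp (q.κ₇ / 2 * q.κ₆ ^ 2))
          * ENNReal.ofReal (Real.exp (inner ℝ (s • θ) (M.noiseSum n k ω)
            - q.κ₇ / 2 * M.quad n k (s • θ) ω)) ∂M.P := by
          refine lintegral_mono_ae ?_
          filter_upwards [M.ae_norm_X_le_all] with ω hω
          rw [← ENNReal.ofReal_mul (Real.exp_pos _).le, ← Real.exp_add]
          refine ENNReal.ofReal_le_ofReal (Real.exp_le_exp.2 ?_)
          have h1 := M.quad_le n k (s • θ) hω
          have h2 : (n : ℝ) * (q.κ₆ ^ 2 * ‖s • θ‖ ^ 2) = q.κ₆ ^ 2 := by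
            rw [norm_smul, hθ, mul_one, Real.norm_eq_abs, sq_abs, hs]
            linear_combination q.κ₆ ^ 2 * hc2
          rw [h2] at h1
          rw [inner_smul_left]
          simp only [conj_trivial]
          nlinarith
      _ ≤ _ := by
          rw [lintegral_const_mul' _ _ ENNReal.ofReal_ne_top]
          exact (mul_le_mul_right h _).trans (by rw [mul_one])
  have h1 := hexp c rfl
  have h2 := hexp (-c) (by ring)
  have hmeas : ∀ s : ℝ, Measurable fun ω =>
      ENNReal.ofReal (Real.exp (s * inner ℝ θ (M.noiseSum n k ω))) := fun s =>
    (Real.measurable_exp.comp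
      (((M.measurable_inner_noiseSum n k θ).mono (M.past_le n) le_rfl).const_mul s)).ennreal_ofReal
  calc ∫⁻ ω, ENNReal.ofReal ((inner ℝ θ (M.noiseSum n k ω) : ℝ) ^ 2) ∂M.P
      ≤ ∫⁻ ω, ENNReal.ofReal n * (ENNReal.ofReal (Real.exp (c * inner ℝ θ (M.noiseSum n k ω)))
        + ENNReal.ofReal (Real.exp (-c * inner ℝ θ (M.noiseSum n k ω)))) ∂M.P := by
        refine lintegral_mono fun ω => ?_
        rw [← ENNReal.ofReal_add (Real.exp_pos _).le (Real.exp_pos _).le,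
          ← ENNReal.ofReal_mul hn'.le]
        refine ENNReal.ofReal_le_ofReal ?_
        have h3 := sq_le_exp_add_exp_neg (c * inner ℝ θ (M.noiseSum n k ω))
        rw [← neg_mul] at h3
        calc (inner ℝ θ (M.noiseSum n k ω) : ℝ) ^ 2
            = n * (c * inner ℝ θ (M.noiseSum n k ω)) ^ 2 := by
              linear_combination (-(inner ℝ θ (M.noiseSum n k ω) : ℝ) ^ 2) * hc2
          _ ≤ _ := mul_le_mul_of_nonneg_left h3 hn'.le
    _ = ENNReal.ofReal n * (∫⁻ ω, ENNReal.ofReal (Real.exp (c * inner ℝ θ (M.noiseSum n k ω))) ∂M.P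
        + ∫⁻ ω, ENNReal.ofReal (Real.exp (-c * inner ℝ θ (M.noiseSum n k ω))) ∂M.P) := by
        rw [lintegral_const_mul' _ _ ENNReal.ofReal_ne_top, lintegral_add_left (hmeas c)]
    _ ≤ ENNReal.ofReal n * (ENNReal.ofReal (Real.exp (q.κ₇ / 2 * q.κ₆ ^ 2))
        + ENNReal.ofReal (Real.exp (q.κ₇ / 2 * q.κ₆ ^ 2))) := by gcongr
    _ = _ := by
        rw [← ENNReal.ofReal_add (Real.exp_pos _).le (Real.exp_pos _).le,
          ← ENNReal.ofReal_mul hn'.le]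
        congr 1
        ring

lemma lintegral_norm_noiseSum_sq_le {n : ℕ} (hn : 0 < n) (k : Fin K) :
    ∫⁻ ω, ENNReal.ofReal (‖M.noiseSum n k ω‖ ^ 2) ∂M.P ≤ ENNReal.ofReal (noiseConst q * n) := by
  have e : ∀ ω, ENNReal.ofReal (‖M.noiseSum n k ω‖ ^ 2)
      = ∑ i : Fin d, ENNReal.ofReal
        ((inner ℝ (EuclideanSpace.single i (1 : ℝ)) (M.noiseSum n k ω) : ℝ) ^ 2) := by
    intro ω
    rw [← ENNReal.ofReal_sum_of_nonneg fun i _ => sq_nonneg _, EuclideanSpace.norm_sq_eq]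
    congr 1
    refine Finset.sum_congr rfl fun i _ => ?_
    rw [EuclideanSpace.inner_single_left]
    simp
  simp only [e]
  rw [lintegral_finsetSum _ fun i _ =>
    (((M.measurable_inner_noiseSum n k _).mono (M.past_le n) le_rfl).pow_const 2).ennreal_ofReal]
  calc _ ≤ ∑ i : Fin d, ENNReal.ofReal (n * (2 * Real.exp (q.κ₇ / 2 * q.κ₆ ^ 2))) :=
        Finset.sum_le_sum fun i _ => M.lintegral_inner_noiseSum_sq_le hn k (by simp)
    _ = _ := by
        rw [Finset.sum_const, Finset.card_univ, Fintype.card_fin, nsmul_eq_mul,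
          ← ENNReal.ofReal_natCast d, ← ENNReal.ofReal_mul (by positivity)]
        congr 1
        unfold noiseConst
        ring

lemma integrable_norm_noiseSum_sq {n : ℕ} (hn : 0 < n) (k : Fin K) :
    Integrable (fun ω => ‖M.noiseSum n k ω‖ ^ 2) M.P ∧
      ∫ ω, ‖M.noiseSum n k ω‖ ^ 2 ∂M.P ≤ noiseConst q * n := by
  have h := M.lintegral_norm_noiseSum_sq_le hn k
  have hm : Measurable fun ω => ‖M.noiseSum n k ω‖ ^ 2 :=
    ((M.measurable_noiseSum n k).mono (M.past_le n) le_rfl).norm.pow_const 2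
  have hi : Integrable (fun ω => ‖M.noiseSum n k ω‖ ^ 2) M.P := by
    refine ⟨hm.aestronglyMeasurable, ?_⟩
    rw [hasFiniteIntegral_iff_ofReal (Eventually.of_forall fun ω => sq_nonneg _)]
    exact h.trans_lt ENNReal.ofReal_lt_top
  refine ⟨hi, ?_⟩
  rw [← ofReal_integral_eq_lintegral_ofReal hi (Eventually.of_forall fun ω => sq_nonneg _)] at h
  exact (ENNReal.ofReal_le_ofReal_iff (mul_nonneg (noiseConst_nonneg q) (Nat.cast_nonneg n))).1 h

lemma prob_noiseSum_norm_gt_le {n : ℕ} (hn : 0 < n) (k : Fin K) {T : ℝ} (hT : 0 < T) :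
    M.P.real {ω | T < ‖M.noiseSum n k ω‖} ≤ noiseConst q * n / T ^ 2 := by
  obtain ⟨hi, h⟩ := M.integrable_norm_noiseSum_sq hn k
  have h1 := mul_meas_ge_le_integral_of_nonneg (Eventually.of_forall fun ω => sq_nonneg _) hi (T ^ 2)
  rw [le_div_iff₀ (by positivity), mul_comm]
  refine le_trans ?_ (h1.trans h)
  refine mul_le_mul_of_nonneg_left (measureReal_mono fun ω hω => ?_) (by positivity)
  exact pow_le_pow_left₀ hT.le (le_of_lt hω) 2

end Model

/-! ### Growth of the design matrices -/

lemma exp_neg_le_quadratic {x : ℝ} (hx : 0 ≤ x) : Real.exp (-x) ≤ 1 - x + x ^ 2 := by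
  have h1 := Real.add_one_le_exp x
  have h2 : Real.exp (-x) * Real.exp x = 1 := by rw [← Real.exp_add]; simp
  have h3 := Real.exp_pos (-x)
  have h4 : 1 ≤ (1 - x + x ^ 2) * (1 + x) := by nlinarith [pow_nonneg hx 3]
  have h5 : Real.exp (-x) * (1 + x) ≤ 1 := by nlinarith
  by_contra hcon
  push Not at hcon
  nlinarith

namespace Model

variable {K d : ℕ} {q : Par K d} (M : Model q)

/-- The squares of `θ^T X` accumulated over the selections of `k` in the periods of `J`. -/
def quadOn (J : Finset ℕ) (k : Fin K) (θ : EuclideanSpace ℝ (Fin d)) (ω : M.Ω) : ℝ :=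
  ∑ i ∈ J, if M.sel i ω = k then (inner ℝ θ (M.X i ω) : ℝ) ^ 2 else 0

lemma quadOn_smul (J : Finset ℕ) (k : Fin K) (c : ℝ) (θ : EuclideanSpace ℝ (Fin d)) (ω : M.Ω) :
    M.quadOn J k (c • θ) ω = c ^ 2 * M.quadOn J k θ ω := by
  unfold quadOn
  rw [Finset.mul_sum]
  refine Finset.sum_congr rfl fun i _ => ?_
  split_ifs
  · rw [inner_smul_left]
    simp only [conj_trivial]
    ring
  · simp

lemma quadOn_le_quadOn (J : Finset ℕ) (k : Fin K) (θ θ' : EuclideanSpace ℝ (Fin d)) {ω : M.Ω}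
    (hω : ∀ i, ‖M.X i ω‖ ≤ q.κ₆) :
    M.quadOn J k θ ω
      ≤ M.quadOn J k θ' ω + J.card * (q.κ₆ ^ 2 * (‖θ - θ'‖ * (‖θ‖ + ‖θ'‖))) := by
  have : (J.card : ℝ) * (q.κ₆ ^ 2 * (‖θ - θ'‖ * (‖θ‖ + ‖θ'‖)))
      = ∑ i ∈ J, q.κ₆ ^ 2 * (‖θ - θ'‖ * (‖θ‖ + ‖θ'‖)) := by simp
  unfold quadOn
  rw [this, ← Finset.sum_add_distrib]
  refine Finset.sum_le_sum fun i _ => ?_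
  split_ifs
  · exact sq_inner_sub_le (hω i)
  · positivity

lemma quadOn_le_quad {J : Finset ℕ} {n : ℕ} (hJ : J ⊆ Finset.range n) (k : Fin K)
    (θ : EuclideanSpace ℝ (Fin d)) (ω : M.Ω) : M.quadOn J k θ ω ≤ M.quad n k θ ω :=
  Finset.sum_le_sum_of_subset_of_nonneg hJ fun i _ _ => by split_ifs <;> positivity

/-- The periods in which the decision is informative about `k`, given the past: on `G` the
conditional second moment of the samples assigned to `k` is nondegenerate. -/
def Informative (k : Fin K) (i : ℕ) (G : Set M.Ω) : Prop :=
  MeasurableSet[M.past i] G ∧ ∀ ω ∈ G, ∀ θ : EuclideanSpace ℝ (Fin d),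
    q.κ₈ / 2 * ‖θ‖ ^ 2 ≤ ∫ ω', (if M.policy i (M.est i ω) (M.X 0 ω') = k then
      (inner ℝ θ (M.X 0 ω') : ℝ) ^ 2 else 0) ∂M.P

lemma measurable_policy_X (i : ℕ) (s : (Fin K → ℝ) × (Fin K → EuclideanSpace ℝ (Fin d))) (n : ℕ) :
    Measurable fun ω => M.policy i s (M.X n ω) :=
  measurable_comp₂ (M.measurable_policy i) measurable_const (M.measurable_X n)

/-- For ηY ≤ 1/2 one has exp(-ηY) ≤ 1 - ηY/2; the condition on η ensures this because Y ≤ 4κ₆² for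
‖θ‖ ≤ 2. Taking means turns a lower bound for EY into exponential decay. -/
lemma integral_exp_neg_le {J : M.Ω → Fin K} (hJ : Measurable J) (k : Fin K)
    {θ : EuclideanSpace ℝ (Fin d)} (hθ : ‖θ‖ ≤ 2) {η v : ℝ} (hη0 : 0 ≤ η)
    (hη : 8 * q.κ₆ ^ 2 * η ≤ 1)
    (hv : 2 * v ≤ ∫ ω, (if J ω = k then (inner ℝ θ (M.X 0 ω) : ℝ) ^ 2 else 0) ∂M.P) :
    ∫⁻ ω, ENNReal.ofReal (Real.exp (-(η * if J ω = k then (inner ℝ θ (M.X 0 ω) : ℝ) ^ 2 else 0)))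
      ∂M.P ≤ ENNReal.ofReal (Real.exp (-(η * v))) := by
  set Y : M.Ω → ℝ := fun ω => if J ω = k then (inner ℝ θ (M.X 0 ω) : ℝ) ^ 2 else 0 with hY
  have hYi : Integrable Y M.P := M.integrable_sq_inner_ite θ hJ k
  have hY0 : ∀ ω, 0 ≤ Y ω := fun ω => by simp only [hY]; split_ifs <;> positivity
  have hYb : ∀ᵐ ω ∂M.P, 2 * η * Y ω ≤ 1 := by
    filter_upwards [M.rich.bounded] with ω hω
    have h1 := sq_inner_le (q := q) (θ := θ) hω
    have h2 : ‖θ‖ ^ 2 ≤ 4 := by nlinarith [norm_nonneg θ]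
    have h3 : Y ω ≤ q.κ₆ ^ 2 * 4 := by
      simp only [hY]
      split_ifs
      · exact h1.trans (mul_le_mul_of_nonneg_left h2 (by positivity))
      · positivity
    nlinarith
  have hle : ∀ᵐ ω ∂M.P, Real.exp (-(η * Y ω)) ≤ 1 - η / 2 * Y ω := by
    filter_upwards [hYb] with ω hω
    have h1 := exp_neg_le_quadratic (mul_nonneg hη0 (hY0 ω))
    nlinarith [mul_nonneg hη0 (hY0 ω)]
  have hi : Integrable (fun ω => 1 - η / 2 * Y ω) M.P :=
    (integrable_const _).sub (hYi.const_mul _)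
  calc _ ≤ ∫⁻ ω, ENNReal.ofReal (1 - η / 2 * Y ω) ∂M.P :=
        lintegral_mono_ae (hle.mono fun ω h => ENNReal.ofReal_le_ofReal h)
    _ = ENNReal.ofReal (∫ ω, (1 - η / 2 * Y ω) ∂M.P) :=
        (ofReal_integral_eq_lintegral_ofReal hi
          (hle.mono fun ω h => (Real.exp_pos _).le.trans h)).symm
    _ ≤ _ := by
        refine ENNReal.ofReal_le_ofReal ?_
        rw [integral_sub (integrable_const _) (hYi.const_mul _), integral_const_mul]
        simp only [integral_const, probReal_univ, smul_eq_mul, one_mul]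
        have h1 := Real.add_one_le_exp (-(η * v))
        have h2 := mul_le_mul_of_nonneg_left hv (by positivity : 0 ≤ η / 2)
        linarith

/-- A supermartingale for the lower tail of the design. Since `G i` is known before period i, a
period enters the exponent only if it is informative, and its factor then has conditional mean at
most 1. -/
lemma lintegral_exp_quadOn_le {k : Fin K} {J : Finset ℕ} {G : ℕ → Set M.Ω}
    (hG : ∀ i ∈ J, M.Informative k i (G i)) {θ : EuclideanSpace ℝ (Fin d)} (hθ : ‖θ‖ ≤ 2)
    {η : ℝ} (hη0 : 0 ≤ η) (hη : 8 * q.κ₆ ^ 2 * η ≤ 1) (n : ℕ) :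
    Measurable[M.past n] (fun ω => ∑ i ∈ (Finset.range n).filter (· ∈ J), (G i).indicator (fun ω =>
        η * (q.κ₈ / 4 * ‖θ‖ ^ 2)
          - η * if M.sel i ω = k then (inner ℝ θ (M.X i ω) : ℝ) ^ 2 else 0) ω) ∧
    ∫⁻ ω, ENNReal.ofReal (Real.exp (∑ i ∈ (Finset.range n).filter (· ∈ J),
      (G i).indicator (fun ω => η * (q.κ₈ / 4 * ‖θ‖ ^ 2)
          - η * if M.sel i ω = k then (inner ℝ θ (M.X i ω) : ℝ) ^ 2 else 0) ω)) ∂M.P ≤ 1 := by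
  set c : ℝ := η * (q.κ₈ / 4 * ‖θ‖ ^ 2) with hc
  have hmeas : ∀ n, Measurable[M.past n] (fun ω =>
      ∑ i ∈ (Finset.range n).filter (· ∈ J), (G i).indicator (fun ω =>
        c - η * if M.sel i ω = k then (inner ℝ θ (M.X i ω) : ℝ) ^ 2 else 0) ω) := by
    intro n
    have hone : ∀ i ∈ (Finset.range n).filter (· ∈ J), Measurable[M.past n]
        ((G i).indicator fun ω =>
          c - η * if M.sel i ω = k then (inner ℝ θ (M.X i ω) : ℝ) ^ 2 else 0) := by
      intro i hi
      rw [Finset.mem_filter, Finset.mem_range] at hi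
      have h0 : Measurable (Function.uncurry fun (j : Fin K) (x : EuclideanSpace ℝ (Fin d)) =>
          c - η * if j = k then (inner ℝ θ x : ℝ) ^ 2 else 0) :=
        measurable_const.sub (Measurable.const_mul (Measurable.ite
          (measurable_fst (measurableSet_singleton k)) (by fun_prop) measurable_const) η)
      exact (measurable_comp₂ h0 (M.measurable_sel_past hi.1) (M.measurable_X_past hi.1)).indicator
        (M.past_mono hi.1.le _ (hG i hi.2).1)
    exact Finset.measurable_sum (m := M.past n) _ hone
  refine ⟨hmeas n, ?_⟩
  induction n with
  | zero => simp
  | succ n ih =>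
    by_cases hn : n ∈ J
    swap
    · rw [Finset.range_add_one, Finset.filter_insert, if_neg hn]
      exact ih
    rw [Finset.range_add_one, Finset.filter_insert, if_pos hn]
    have hnot : n ∉ (Finset.range n).filter (· ∈ J) := by simp
    simp only [Finset.sum_insert hnot]
    set S : M.Ω → ℝ := fun ω => ∑ i ∈ (Finset.range n).filter (· ∈ J), (G i).indicator (fun ω =>
        c - η * if M.sel i ω = k then (inner ℝ θ (M.X i ω) : ℝ) ^ 2 else 0) ω with hS
    have hGm := (hG n hn).1
    set A : M.Ω → (ℝ × ℝ) × ((Fin K → ℝ) × (Fin K → EuclideanSpace ℝ (Fin d))) := fun ω =>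
        (((G n).indicator (fun _ => (1 : ℝ)) ω, S ω), M.est n ω) with hA
    have hAm : Measurable[M.past n] A := by
      have h1 : Measurable[M.past n] ((G n).indicator fun _ => (1 : ℝ)) :=
        (@measurable_const _ _ _ (M.past n) _).indicator hGm
      have h2 : Measurable[M.past n] fun ω => ((G n).indicator (fun _ => (1 : ℝ)) ω, S ω) :=
        measurable_comp₂ (F := fun a b => (a, b)) measurable_id h1 (hmeas n)
      exact measurable_comp₂ (F := fun a b => (a, b)) measurable_id h2 (M.measurable_est n)
    set f : (ℝ × ℝ) × ((Fin K → ℝ) × (Fin K → EuclideanSpace ℝ (Fin d))) →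
        EuclideanSpace ℝ (Fin d) × (Fin K → ℝ) → ENNReal := fun y z =>
      ENNReal.ofReal (Real.exp (y.1.1 * (c - η * if M.policy n y.2 z.1 = k then
        (inner ℝ θ z.1 : ℝ) ^ 2 else 0) + y.1.2)) with hf
    have hfm : Measurable (Function.uncurry f) := by
      have h1 : Measurable fun z : ((ℝ × ℝ) × ((Fin K → ℝ) × (Fin K → EuclideanSpace ℝ (Fin d)))) ×
          (EuclideanSpace ℝ (Fin d) × (Fin K → ℝ)) =>
          if M.policy n z.1.2 z.2.1 = k then (inner ℝ θ z.2.1 : ℝ) ^ 2 else 0 := by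
        refine Measurable.ite ?_ (by fun_prop) measurable_const
        exact measurable_comp₂ (M.measurable_policy n) (measurable_snd.comp measurable_fst)
          (measurable_fst.comp measurable_snd) (measurableSet_singleton k)
      exact (Real.measurable_exp.comp (Measurable.add (Measurable.mul (by fun_prop)
        (measurable_const.sub (h1.const_mul η))) (by fun_prop))).ennreal_ofReal
    calc _ = ∫⁻ ω, f (A ω) (M.obs n ω) ∂M.P := by
          refine lintegral_congr fun ω => ?_
          simp only [hf, hA, obs]
          congr 3
          by_cases hω : ω ∈ G n
          · rw [Set.indicator_of_mem hω, Set.indicator_of_mem hω, one_mul]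
            rfl
          · rw [Set.indicator_of_notMem hω, Set.indicator_of_notMem hω, zero_mul]
      _ = ∫⁻ ω, ∫⁻ ω', f (A ω) (M.obs 0 ω') ∂M.P ∂M.P := M.lintegral_step hAm hfm
      _ ≤ ∫⁻ ω, ENNReal.ofReal (Real.exp (S ω)) ∂M.P := by
          refine lintegral_mono fun ω => ?_
          simp only [hf, hA, obs]
          by_cases hω : ω ∈ G n
          · simp only [Set.indicator, hω, if_true, one_mul]
            have hv := (hG n hn).2 ω hω θ
            have h1 := M.integral_exp_neg_le (M.measurable_policy_X n (M.est n ω) 0) k hθ hη0 hη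
              (v := q.κ₈ / 4 * ‖θ‖ ^ 2) (by linarith)
            have e : ∀ u : ℝ, ENNReal.ofReal (Real.exp (c - u + S ω))
                = ENNReal.ofReal (Real.exp (c + S ω)) * ENNReal.ofReal (Real.exp (-u)) := by
              intro u
              rw [← ENNReal.ofReal_mul (Real.exp_pos _).le, ← Real.exp_add]
              congr 2
              ring
            simp only [e]
            rw [lintegral_const_mul' _ _ ENNReal.ofReal_ne_top]
            refine (mul_le_mul_right h1 _).trans (le_of_eq ?_)
            rw [← ENNReal.ofReal_mul (Real.exp_pos _).le, ← Real.exp_add]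
            congr 2
            rw [hc]
            ring
          · simp [Set.indicator, hω]
      _ ≤ 1 := ih

/-- Constants in the growth of the design matrices. -/
def growthEta (q : Par K d) : ℝ := 1 / (8 * q.κ₆ ^ 2)

lemma growthEta_pos (q : Par K d) : 0 < growthEta q := by
  have := q.hκ₆
  unfold growthEta
  positivity

lemma prob_quadOn_lt_le {k : Fin K} {J : Finset ℕ} {G : ℕ → Set M.Ω}
    (hG : ∀ i ∈ J, M.Informative k i (G i)) {θ : EuclideanSpace ℝ (Fin d)} (hθ : ‖θ‖ ≤ 2)
    (hθ' : 1 / 2 ≤ ‖θ‖) :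
    M.P.real {ω | (∀ i ∈ J, ω ∈ G i) ∧ M.quadOn J k θ ω < q.κ₈ / 32 * J.card}
      ≤ Real.exp (-(growthEta q * (q.κ₈ / 32) * J.card)) := by
  set η := growthEta q with hη
  have hη0 : 0 < η := growthEta_pos q
  have hη1 : 8 * q.κ₆ ^ 2 * η ≤ 1 := by
    have := q.hκ₆
    rw [hη, growthEta, mul_one_div, div_self (by positivity)]
  obtain ⟨n, hn⟩ : ∃ n, J ⊆ Finset.range n := Finset.exists_nat_subset_range J
  have hJ : (Finset.range n).filter (· ∈ J) = J := by
    ext i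
    simp only [Finset.mem_filter, and_iff_right_iff_imp]
    exact fun h => hn h
  obtain ⟨hm, hle⟩ := M.lintegral_exp_quadOn_le hG hθ hη0.le hη1 n
  rw [hJ] at hm hle
  -- The level is the value of the exponent when `quadOn` equals κ₈/32 times the number of periods.
  -- For ‖θ‖ ≥ 1/2 it is at least η·κ₈/32 per period.
  have h := M.prob_le_of_lintegral_exp (c := 0) (hm.mono (M.past_le n) le_rfl) (by simpa using hle)
    (η * (q.κ₈ / 32) * J.card * (8 * ‖θ‖ ^ 2 - 1))
  have hθ2 : 1 ≤ 4 * ‖θ‖ ^ 2 := by nlinarith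
  have hnn : 0 ≤ η * (q.κ₈ / 32) * J.card := by
    have := q.hκ₈
    positivity
  refine le_trans (measureReal_mono ?_) (h.trans (Real.exp_le_exp.2 (by nlinarith)))
  rintro ω ⟨hωG, hω⟩
  simp only [Set.mem_ofPred_eq]
  have e : ∑ i ∈ J, (G i).indicator (fun ω => η * (q.κ₈ / 4 * ‖θ‖ ^ 2)
          - η * if M.sel i ω = k then (inner ℝ θ (M.X i ω) : ℝ) ^ 2 else 0) ω
      = J.card * (η * (q.κ₈ / 4 * ‖θ‖ ^ 2)) - η * M.quadOn J k θ ω := by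
    rw [quadOn, Finset.mul_sum, ← nsmul_eq_mul, ← Finset.sum_const, ← Finset.sum_sub_distrib]
    exact Finset.sum_congr rfl fun i hi => by rw [Set.indicator_of_mem (hωG i hi)]
  rw [e]
  have := mul_lt_mul_of_pos_left hω hη0
  linarith

/-- Homogeneity reduces to unit vectors, where a net of fixed mesh suffices because signal and
discretisation error both grow linearly in the number of periods. The net, and so C and c, is
independent of the instance. -/
lemma prob_exists_quadOn_lt_le (q : Par K d) : ∃ C c : ℝ, 0 < C ∧ 0 < c ∧ ∀ (M : Model q)
    (k : Fin K) (J : Finset ℕ) (G : ℕ → Set M.Ω), (∀ i ∈ J, M.Informative k i (G i)) →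
    M.P.real {ω | (∀ i ∈ J, ω ∈ G i) ∧ ∃ θ, M.quadOn J k θ ω < c * J.card * ‖θ‖ ^ 2}
      ≤ C * Real.exp (-(c * J.card)) := by
  have hκ₆ := q.hκ₆
  have hκ₈ := q.hκ₈
  set η := growthEta q with hη
  have hη0 : 0 < η := growthEta_pos q
  -- The Lipschitz error is at most κ₆²·μ·5/2 ≤ κ₈/64 per period, half of the threshold κ₈/32; μ ≤
  -- 1/2 keeps the relevant net points in the annulus 1/2 ≤ ‖θ‖ ≤ 2.
  set μ : ℝ := min (1 / 2) (q.κ₈ / (160 * q.κ₆ ^ 2)) with hμ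
  have hμ0 : 0 < μ := by positivity
  obtain ⟨m, hm⟩ := exists_nat_gt (d / μ)
  have hm0 : 0 < m := by
    have : (0 : ℝ) < m := lt_of_le_of_lt (by positivity) hm
    exact_mod_cast this
  have hmμ : (d : ℝ) / m ≤ μ := by
    rw [div_lt_iff₀ hμ0] at hm
    rw [div_le_iff₀ (by exact_mod_cast hm0)]
    linarith
  obtain ⟨N, -, hN⟩ := exists_net d 1 m hm0
  set N' := N.filter fun θ => 1 / 2 ≤ ‖θ‖ ∧ ‖θ‖ ≤ 2 with hN'
  refine ⟨N'.card + 1, min (q.κ₈ / 64) (η * (q.κ₈ / 32)), by positivity, by positivity,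
    fun M k J G hG => ?_⟩
  set c := min (q.κ₈ / 64) (η * (q.κ₈ / 32)) with hc
  have hsub : ∀ᵐ ω ∂M.P, ω ∈ {ω | (∀ i ∈ J, ω ∈ G i) ∧
        ∃ θ, M.quadOn J k θ ω < c * J.card * ‖θ‖ ^ 2} →
      ω ∈ ⋃ θ ∈ N', {ω | (∀ i ∈ J, ω ∈ G i) ∧ M.quadOn J k θ ω < q.κ₈ / 32 * J.card} := by
    filter_upwards [M.ae_norm_X_le_all] with ω hX hω
    obtain ⟨hωG, θ, hθ⟩ := hω
    have hθ0 : 0 < ‖θ‖ := by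
      rw [norm_pos_iff]
      rintro rfl
      simp [quadOn] at hθ
    set u := ‖θ‖⁻¹ • θ with hu
    have hu1 : ‖u‖ = 1 := by rw [hu, norm_smul, norm_inv, norm_norm, inv_mul_cancel₀ hθ0.ne']
    obtain ⟨θ', hθ'N, hθ'⟩ := hN u (by rw [hu1]; simp)
    have h1 := hθ'.trans hmμ
    have hμ2 : μ ≤ 1 / 2 := min_le_left _ _
    have h2 : ‖θ'‖ ≤ 3 / 2 := by
      have := norm_sub_norm_le θ' u
      rw [norm_sub_rev] at this
      linarith
    have h3 : 1 / 2 ≤ ‖θ'‖ := by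
      have := norm_sub_norm_le u θ'
      linarith
    refine Set.mem_iUnion₂.2 ⟨θ', by
      rw [hN', Finset.mem_filter]; exact ⟨hθ'N, h3, by linarith⟩, hωG, ?_⟩
    have h4 := M.quadOn_le_quadOn J k θ' u hX
    have h5 : M.quadOn J k u ω < c * J.card := by
      rw [hu, quadOn_smul, inv_pow, inv_mul_lt_iff₀ (by positivity)]
      linarith
    have h6 : ‖θ' - u‖ * (‖θ'‖ + ‖u‖) ≤ μ * (5 / 2) := by
      rw [norm_sub_rev]
      exact mul_le_mul h1 (by linarith) (by positivity) hμ0.le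
    have h7 : q.κ₆ ^ 2 * (‖θ' - u‖ * (‖θ'‖ + ‖u‖)) ≤ q.κ₈ / 64 := by
      have h8 : μ ≤ q.κ₈ / (160 * q.κ₆ ^ 2) := min_le_right _ _
      rw [le_div_iff₀ (by positivity)] at h8
      have := mul_le_mul_of_nonneg_left h6 (by positivity : 0 ≤ q.κ₆ ^ 2)
      nlinarith
    have h9 : c ≤ q.κ₈ / 64 := min_le_left _ _
    have hJ0 : (0 : ℝ) ≤ J.card := Nat.cast_nonneg _
    nlinarith
  have hexp : Real.exp (-(η * (q.κ₈ / 32) * J.card)) ≤ Real.exp (-(c * J.card)) := by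
    refine Real.exp_le_exp.2 (neg_le_neg ?_)
    exact mul_le_mul_of_nonneg_right (min_le_right _ _) (Nat.cast_nonneg _)
  calc _ ≤ _ := real_mono_ae hsub
    _ ≤ ∑ θ ∈ N', M.P.real
        {ω | (∀ i ∈ J, ω ∈ G i) ∧ M.quadOn J k θ ω < q.κ₈ / 32 * J.card} :=
      measureReal_biUnion_finset_le _ _
    _ ≤ ∑ θ ∈ N', Real.exp (-(c * J.card)) := by
      refine Finset.sum_le_sum fun θ hθ => ?_
      rw [hN', Finset.mem_filter] at hθ
      exact (M.prob_quadOn_lt_le hG hθ.2.2 hθ.2.1).trans hexp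
    _ ≤ _ := by
      rw [Finset.sum_const, nsmul_eq_mul]
      have := Real.exp_pos (-(c * J.card))
      nlinarith

/-- Growth of the design matrices through forced exploration. -/
lemma prob_exists_quad_lt_forced_le (q : Par K d) : ∃ C c : ℝ, 0 < C ∧ 0 < c ∧
    ∀ (M : Model q) (k : Fin K) (n : ℕ),
    M.P.real {ω | ∃ θ, M.quad n k θ ω < c * (forcedSet q.a q.r k n).card * ‖θ‖ ^ 2}
      ≤ C * Real.exp (-(c * (forcedSet q.a q.r k n).card)) := by
  obtain ⟨C, c, hC, hc, h⟩ := prob_exists_quadOn_lt_le q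
  refine ⟨C, c, hC, hc, fun M k n => ?_⟩
  refine le_trans (measureReal_mono ?_) (h M k (forcedSet q.a q.r k n) (fun _ => Set.univ) ?_)
  · rintro ω ⟨θ, hθ⟩
    exact ⟨fun i _ => Set.mem_univ ω, θ,
      (M.quadOn_le_quad (Finset.filter_subset _ _) k θ ω).trans_lt hθ⟩
  · intro i hi
    rw [forcedSet, Finset.mem_filter] at hi
    refine ⟨@MeasurableSet.univ _ (M.past i), fun ω _ θ => ?_⟩
    -- A forced period selects k whatever the sample is, so the full second moment is available with
    -- no condition on the estimates.
    have hpol : ∀ x, M.policy i (M.est i ω) x = k := fun x => by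
      rw [policy, if_pos hi.2.1, hi.2.2]
    have h1 := M.moment_ge k θ
    have h2 : ∫ ω, (if M.opt (M.X 0 ω) = k then (inner ℝ θ (M.X 0 ω) : ℝ) ^ 2 else 0) ∂M.P
        ≤ ∫ ω', (if M.policy i (M.est i ω) (M.X 0 ω') = k then
      (inner ℝ θ (M.X 0 ω') : ℝ) ^ 2 else 0) ∂M.P := by
      refine integral_mono (M.integrable_sq_inner_ite θ (M.measurable_opt_X 0) k)
        (M.integrable_sq_inner_ite θ (M.measurable_policy_X i (M.est i ω) 0) k) fun ω' => ?_
      simp only [hpol, if_true]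
      split_ifs
      exacts [le_rfl, sq_nonneg _]
    have := q.hκ₈
    have h3 : 0 ≤ q.κ₈ * ‖θ‖ ^ 2 := by positivity
    linarith

end Model

/-! ### Consistency of the regression -/

namespace Model

variable {K d : ℕ} {q : Par K d} (M : Model q)

/-- A deterministic bound for `quad` at the estimation error, given inequalities for the noise on
a finite net. -/
lemma quad_err_le_of_net {n : ℕ} {k : Fin K} {ω : M.Ω} (hX : ∀ i, ‖M.X i ω‖ ≤ q.κ₆)
    {N : Finset (EuclideanSpace ℝ (Fin d))} {B μ T L : ℝ} (hT : ‖M.noiseSum (n + 1) k ω‖ ≤ T)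
    (hB : T + q.R ≤ q.κ₇ * B) (hμ : 0 ≤ μ)
    (hnet : ∀ θ : EuclideanSpace ℝ (Fin d), ‖θ‖ ≤ B → ∃ θ' ∈ N, ‖θ - θ'‖ ≤ μ)
    (hμT : μ * T ≤ 1 / 2)
    (hμn : q.κ₇ / 2 * (((n + 1 : ℕ) : ℝ) * (q.κ₆ ^ 2 * (μ * (2 * B + μ)))) ≤ 1 / 2)
    (hN : ∀ θ ∈ N, (inner ℝ θ (M.noiseSum (n + 1) k ω) : ℝ)
      ≤ q.κ₇ / 2 * M.quad (n + 1) k θ ω + L) :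
    M.quad (n + 1) k (M.err (n + 1) k ω) ω
      ≤ 2 * q.κ₇ * (L + 1) + ridgeParam (n + 1) * q.R ^ 2 := by
  have hκ₇ := q.hκ₇
  have hR := q.hR
  set e := M.err (n + 1) k ω with he
  set S := M.noiseSum (n + 1) k ω with hS
  set ρ := ridgeParam (n + 1) with hρ
  have hρ1 : 1 ≤ ρ := ridgeParam_ge n
  have hid := M.err_identity n k ω
  rw [← he, ← hS, ← hρ] at hid
  have hV := M.quad_nonneg (n + 1) k e ω
  have hβ : |(inner ℝ e (M.β k) : ℝ)| ≤ ‖e‖ * q.R :=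
    (abs_real_inner_le_norm _ _).trans (mul_le_mul_of_nonneg_left (M.hβ k) (norm_nonneg _))
  have hβ' : -(‖e‖ * q.R) ≤ inner ℝ e (M.β k) := (abs_le.1 hβ).1
  have heS : (inner ℝ e S : ℝ) ≤ ‖e‖ * ‖S‖ := real_inner_le_norm _ _
  -- A crude bound from the ridge term alone (ρ ≥ 1), needed only to place the rescaled error inside
  -- the ball covered by the net.
  have heB : ‖e‖ ≤ T + q.R := by
    by_contra hcon
    push Not at hcon
    have h1 : 0 < ‖e‖ := lt_of_le_of_lt (add_nonneg ((norm_nonneg S).trans hT) hR) hcon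
    have h2 : ρ * ‖e‖ ^ 2 ≤ ‖e‖ * ‖S‖ + ρ * (‖e‖ * q.R) := by nlinarith
    have h3 : ρ * ‖e‖ ≤ ‖S‖ + ρ * q.R := by
      have : ‖e‖ * (ρ * ‖e‖) ≤ ‖e‖ * (‖S‖ + ρ * q.R) := by nlinarith
      exact le_of_mul_le_mul_left this h1
    nlinarith [norm_nonneg S]
  -- At this scale the noise inequality, multiplied by κ₇, reads ⟨e, S⟩ ≤ quad(e)/2 + κ₇(L + 1), and
  -- half of quad(e) is absorbed on the left of the error identity.
  set θ := q.κ₇⁻¹ • e with hθ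
  have hθB : ‖θ‖ ≤ B := by
    rw [hθ, norm_smul, norm_inv, Real.norm_eq_abs, abs_of_pos hκ₇, inv_mul_le_iff₀ hκ₇]
    linarith
  obtain ⟨θ', hθ'N, hθ'⟩ := hnet θ hθB
  have h1 := hN θ' hθ'N
  have h2 : (inner ℝ θ S : ℝ) ≤ inner ℝ θ' S + 1 / 2 := by
    have : (inner ℝ (θ - θ') S : ℝ) ≤ ‖θ - θ'‖ * ‖S‖ := real_inner_le_norm _ _
    have h3 : ‖θ - θ'‖ * ‖S‖ ≤ μ * T := mul_le_mul hθ' hT (norm_nonneg _) hμ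
    rw [inner_sub_left] at this
    linarith
  have h3 : q.κ₇ / 2 * M.quad (n + 1) k θ' ω ≤ q.κ₇ / 2 * M.quad (n + 1) k θ ω + 1 / 2 := by
    have h4 := M.quad_le_quad (n + 1) k θ' θ hX
    have h5 : ‖θ' - θ‖ * (‖θ'‖ + ‖θ‖) ≤ μ * (2 * B + μ) := by
      have h6 : ‖θ'‖ ≤ B + μ := by
        have := norm_sub_norm_le θ' θ
        rw [norm_sub_rev] at this
        linarith
      rw [norm_sub_rev]
      exact mul_le_mul hθ' (by linarith) (by positivity) hμ
    have h6 : ((n + 1 : ℕ) : ℝ) * (q.κ₆ ^ 2 * (‖θ' - θ‖ * (‖θ'‖ + ‖θ‖)))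
        ≤ ((n + 1 : ℕ) : ℝ) * (q.κ₆ ^ 2 * (μ * (2 * B + μ))) := by gcongr
    have h7 := mul_le_mul_of_nonneg_left (h4.trans (add_le_add_right h6 _))
      (by positivity : 0 ≤ q.κ₇ / 2)
    linarith
  have h4 : M.quad (n + 1) k θ ω = q.κ₇⁻¹ ^ 2 * M.quad (n + 1) k e ω := M.quad_smul _ _ _ _ _
  have h5 : (inner ℝ θ S : ℝ) = q.κ₇⁻¹ * inner ℝ e S := by
    rw [hθ, inner_smul_left]; simp
  have h6 : (inner ℝ e S : ℝ) ≤ M.quad (n + 1) k e ω / 2 + q.κ₇ * (L + 1) := by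
    have h7 : q.κ₇⁻¹ * inner ℝ e S
        ≤ q.κ₇ / 2 * (q.κ₇⁻¹ ^ 2 * M.quad (n + 1) k e ω) + (L + 1) := by
      rw [← h4, ← h5]; linarith
    have h8 := mul_le_mul_of_nonneg_left h7 hκ₇.le
    have e1 : q.κ₇ * (q.κ₇⁻¹ * (inner ℝ e S : ℝ)) = inner ℝ e S := by field_simp
    have e2 : q.κ₇ * (q.κ₇ / 2 * (q.κ₇⁻¹ ^ 2 * M.quad (n + 1) k e ω) + (L + 1))
        = M.quad (n + 1) k e ω / 2 + q.κ₇ * (L + 1) := by field_simp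
    rwa [e1, e2] at h8
  have h7 : ρ * (‖e‖ * q.R) ≤ ρ * ‖e‖ ^ 2 + ρ * q.R ^ 2 / 2 := by
    have : ‖e‖ * q.R ≤ ‖e‖ ^ 2 + q.R ^ 2 / 2 := by nlinarith [sq_nonneg (‖e‖ - q.R), sq_nonneg ‖e‖]
    have := mul_le_mul_of_nonneg_left this (by linarith : 0 ≤ ρ)
    linarith
  have h8 := mul_le_mul_of_nonneg_left hβ' (by linarith : 0 ≤ ρ)
  linarith

lemma exp_neg_mul_log_natCast {n : ℕ} (hn : 0 < n) (Q : ℕ) :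
    Real.exp (-(Q * Real.log n)) = 1 / (n : ℝ) ^ Q := by
  have hn' : (0 : ℝ) < n := by exact_mod_cast hn
  rw [Real.exp_neg, mul_comm, Real.exp_mul, Real.exp_log hn', Real.rpow_natCast, one_div]

/-- The error is random, so the noise inequality is applied on a polynomially large net with L
proportional to log n. The ridge bias ρ‖β‖² is the dominant term and produces the cube of the
logarithm. -/
lemma prob_quad_err_gt_le (q : Par K d) (Q : ℕ) : ∃ C : ℝ, 0 < C ∧ ∀ (M : Model q) (n : ℕ)
    (k : Fin K), 0 < n → M.P.real {ω | C * (1 + Real.log n) ^ 3 < M.quad n k (M.err n k ω) ω}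
      ≤ C / (n : ℝ) ^ Q := by
  have hκ₆ := q.hκ₆
  have hκ₇ := q.hκ₇
  have hR := q.hR
  obtain ⟨B₀, hB₀⟩ := exists_nat_ge ((1 + q.R) / q.κ₇)
  -- The mesh will be of order n^(-(s+1))/m₀; this m₀ makes the discretisation errors of the noise
  -- term and of the design at most 1/2 each.
  obtain ⟨m₀, hm₀⟩ := exists_nat_ge (1 + 2 * d + q.κ₆ ^ 2 * q.κ₇ * (d * (2 * B₀ + d)))
  have hm1 : (1 : ℝ) ≤ m₀ := by
    refine le_trans ?_ hm₀
    have : 0 ≤ 2 * (d : ℝ) + q.κ₆ ^ 2 * q.κ₇ * (d * (2 * B₀ + d)) := by positivity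
    linarith
  have hm0 : 0 < m₀ := by
    have : (0 : ℝ) < m₀ := by linarith
    exact_mod_cast this
  -- The noise sum exceeds n^s with probability O(n^(-Q)) by Chebyshev. The net has O(n^((2s+1)d))
  -- points, each failing with probability n^(-D), so D adds Q to that exponent.
  set s := Q + 1 with hs
  set D : ℕ := (2 * s + 1) * d + Q with hD
  set C₁ : ℝ := ((2 * (B₀ * m₀) + 1 : ℕ) : ℝ) ^ d with hC₁
  set C₂ : ℝ := 2 * q.κ₇ * (D + 1) + q.R ^ 2 with hC₂
  have hC₁0 : 0 ≤ C₁ := by positivity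
  have hC₂0 : 0 < C₂ := by positivity
  have hC₃0 := noiseConst_nonneg q
  refine ⟨C₁ + C₂ + noiseConst q, by positivity, fun M n k hn => ?_⟩
  obtain ⟨l, rfl⟩ : ∃ l, n = l + 1 := ⟨n - 1, by omega⟩
  set n := l + 1 with hndef
  have hn1 : (1 : ℝ) ≤ (n : ℝ) := by exact_mod_cast hn
  have hn0 : (0 : ℝ) < (n : ℝ) := by linarith
  have hlog : 0 ≤ Real.log n := Real.log_natCast_nonneg n
  set L : ℝ := D * Real.log n with hL
  obtain ⟨N, hNcard, hNnet⟩ := exists_net d (B₀ * n ^ s) (m₀ * n ^ (s + 1)) (by positivity)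
  set μ : ℝ := d / ((m₀ * n ^ (s + 1) : ℕ) : ℝ) with hμ
  have hns1 : (1 : ℝ) ≤ (n : ℝ) ^ s := one_le_pow₀ hn1
  have hμ0 : 0 ≤ μ := by positivity
  have hμs : μ * (n * (n : ℝ) ^ s) = d / m₀ := by
    rw [hμ]
    push_cast
    rw [pow_succ]
    field_simp
  have hμT : μ * (n : ℝ) ^ s ≤ 1 / 2 := by
    have h1 : μ * (n : ℝ) ^ s ≤ μ * (n * (n : ℝ) ^ s) := by
      refine mul_le_mul_of_nonneg_left ?_ hμ0
      nlinarith
    rw [hμs] at h1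
    refine h1.trans ?_
    rw [div_le_iff₀ (by linarith)]
    have : 0 ≤ q.κ₆ ^ 2 * q.κ₇ * (d * (2 * B₀ + d)) := by positivity
    linarith
  have hμd : μ ≤ d := by
    rw [hμ]
    refine div_le_self (by positivity) ?_
    have : 1 ≤ m₀ * n ^ (s + 1) := Nat.succ_le_of_lt (by positivity)
    exact_mod_cast this
  have hμn : q.κ₇ / 2 * ((n : ℝ) * (q.κ₆ ^ 2 * (μ * (2 * ((B₀ * n ^ s : ℕ) : ℝ) + μ)))) ≤ 1 / 2 := by
    push_cast
    have h1 : 2 * (B₀ * (n : ℝ) ^ s) + μ ≤ (2 * B₀ + d) * (n : ℝ) ^ s := by nlinarith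
    calc q.κ₇ / 2 * ((n : ℝ) * (q.κ₆ ^ 2 * (μ * (2 * (B₀ * (n : ℝ) ^ s) + μ))))
        ≤ q.κ₇ / 2 * ((n : ℝ) * (q.κ₆ ^ 2 * (μ * ((2 * B₀ + d) * (n : ℝ) ^ s)))) := by gcongr
      _ = q.κ₇ / 2 * q.κ₆ ^ 2 * (2 * B₀ + d) * (μ * (n * (n : ℝ) ^ s)) := by ring
      _ = (q.κ₆ ^ 2 * q.κ₇ * (d * (2 * B₀ + d))) / m₀ / 2 := by rw [hμs]; ring
      _ ≤ 1 / 2 := by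
        gcongr
        rw [div_le_one (by linarith)]
        linarith [(by positivity : 0 ≤ 2 * (d : ℝ))]
  have hB : (n : ℝ) ^ s + q.R ≤ q.κ₇ * ((B₀ * n ^ s : ℕ) : ℝ) := by
    push_cast
    rw [div_le_iff₀ hκ₇] at hB₀
    nlinarith
  have hρ : ridgeParam n ≤ (1 + Real.log n) ^ 3 := by
    unfold ridgeParam
    nlinarith [pow_nonneg hlog 2]
  have hsub : ∀ᵐ ω ∂M.P, ω ∈ {ω | (C₁ + C₂ + noiseConst q) * (1 + Real.log n) ^ 3
        < M.quad n k (M.err n k ω) ω} →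
      ω ∈ {ω | (n : ℝ) ^ s < ‖M.noiseSum n k ω‖} ∪ ⋃ θ ∈ N,
        {ω | q.κ₇ / 2 * M.quad n k θ ω + L < inner ℝ θ (M.noiseSum n k ω)} := by
    filter_upwards [M.ae_norm_X_le_all] with ω hX hω
    by_contra hcon
    simp only [Set.mem_union, Set.mem_iUnion, Set.mem_ofPred_eq, not_or, not_exists, not_lt] at hcon
    have h := M.quad_err_le_of_net hX hcon.1 hB hμ0 hNnet hμT hμn
      (fun θ hθ => hcon.2 θ hθ)
    have h1 : 1 + Real.log n ≤ (1 + Real.log n) ^ 3 :=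
      le_self_pow₀ (by linarith) (by norm_num)
    have h2 : 2 * q.κ₇ * (L + 1) ≤ 2 * q.κ₇ * (D + 1) * (1 + Real.log n) ^ 3 := by
      have h3 : L + 1 ≤ (D + 1) * (1 + Real.log n) := by
        rw [hL]
        have : (0 : ℝ) ≤ D := Nat.cast_nonneg _
        nlinarith
      have h4 : (D + 1 : ℝ) * (1 + Real.log n) ≤ (D + 1) * (1 + Real.log n) ^ 3 := by gcongr
      have := mul_le_mul_of_nonneg_left (h3.trans h4) (by positivity : 0 ≤ 2 * q.κ₇)
      linarith
    have h3 := mul_le_mul_of_nonneg_right hρ (sq_nonneg q.R)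
    have h4 : 0 ≤ (C₁ + noiseConst q) * (1 + Real.log n) ^ 3 := by positivity
    replace hω : (C₁ + C₂ + noiseConst q) * (1 + Real.log n) ^ 3
        < M.quad n k (M.err n k ω) ω := hω
    have h5 : M.quad n k (M.err n k ω) ω ≤ C₂ * (1 + Real.log n) ^ 3 := by
      rw [hC₂]
      linarith
    linarith
  have hpowQ : (0 : ℝ) < (n : ℝ) ^ Q := by positivity
  calc _ ≤ _ := real_mono_ae hsub
    _ ≤ M.P.real {ω | (n : ℝ) ^ s < ‖M.noiseSum n k ω‖} + ∑ θ ∈ N,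
        M.P.real {ω | q.κ₇ / 2 * M.quad n k θ ω + L < inner ℝ θ (M.noiseSum n k ω)} :=
      (measureReal_union_le _ _).trans (add_le_add_right (measureReal_biUnion_finset_le _ _) _)
    _ ≤ noiseConst q / (n : ℝ) ^ Q + C₁ / (n : ℝ) ^ Q := by
      gcongr ?_ + ?_
      · refine (M.prob_noiseSum_norm_gt_le hn k (by positivity)).trans ?_
        rw [div_le_div_iff₀ (by positivity) hpowQ]
        have : (n : ℝ) * (n : ℝ) ^ Q ≤ ((n : ℝ) ^ s) ^ 2 := by
          rw [← pow_succ', ← pow_mul]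
          exact pow_le_pow_right₀ hn1 (by omega)
        calc noiseConst q * n * (n : ℝ) ^ Q = noiseConst q * (n * (n : ℝ) ^ Q) := by ring
          _ ≤ _ := mul_le_mul_of_nonneg_left this hC₃0
      · calc _ ≤ ∑ θ ∈ N, Real.exp (-L) :=
              Finset.sum_le_sum fun θ _ => M.prob_noiseSum_gt_le n k θ L
          _ = N.card * (1 / (n : ℝ) ^ D) := by
              rw [Finset.sum_const, nsmul_eq_mul, hL, exp_neg_mul_log_natCast hn]
          _ ≤ (C₁ * ((n : ℝ) ^ (2 * s + 1)) ^ d) * (1 / (n : ℝ) ^ D) := by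
              refine mul_le_mul_of_nonneg_right ?_ (by positivity)
              calc (N.card : ℝ) ≤ ((2 * (B₀ * n ^ s * (m₀ * n ^ (s + 1))) + 1 : ℕ) : ℝ) ^ d := by
                    exact_mod_cast hNcard
                _ ≤ (((2 * (B₀ * m₀) + 1 : ℕ) : ℝ) * (n : ℝ) ^ (2 * s + 1)) ^ d := by
                    refine pow_le_pow_left₀ (by positivity) ?_ d
                    have : (1 : ℝ) ≤ (n : ℝ) ^ (2 * s + 1) := one_le_pow₀ hn1
                    have e : (n : ℝ) ^ s * (n : ℝ) ^ (s + 1) = (n : ℝ) ^ (2 * s + 1) := by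
                      rw [← pow_add]; congr 1; omega
                    push_cast
                    calc 2 * (B₀ * (n : ℝ) ^ s * (m₀ * (n : ℝ) ^ (s + 1))) + 1
                        = 2 * (B₀ * m₀) * ((n : ℝ) ^ s * (n : ℝ) ^ (s + 1)) + 1 := by ring
                      _ ≤ _ := by rw [e]; linarith
                _ = _ := by rw [mul_pow]
          _ = C₁ / (n : ℝ) ^ Q := by
              rw [← pow_mul, hD, pow_add]
              field_simp
    _ ≤ _ := by
      rw [← add_div]
      exact div_le_div_of_nonneg_right (by linarith) hpowQ.le

/-- The regression coefficients are close to the true ones with large probability. -/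
lemma prob_not_close_le (q : Par K d) {δ : ℝ} (hδ : 0 < δ) (Q : ℕ) :
    ∃ C : ℝ, 0 < C ∧ ∀ (M : Model q) (n : ℕ), 0 < n →
      M.P.real {ω | ¬ M.Close δ (M.est n ω)} ≤ C / (n : ℝ) ^ Q := by
  obtain ⟨C₁, hC₁, h₁⟩ := prob_quad_err_gt_le q Q
  obtain ⟨C₂, c, hC₂, hc, h₂⟩ := prob_exists_quad_lt_forced_le q
  -- The first summand turns information · ‖e‖² ≤ C₁(1 + log n)³ into ‖e‖ ≤ δ; the second makes the
  -- exponential tail of the design smaller than n^(-Q).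
  set A : ℝ := (C₁ / δ ^ 2 + Q + 1) / c with hA
  have hA0 : 0 < A := by positivity
  obtain ⟨n₀, hn₀⟩ := eventually_atTop.1
    (eventually_all.2 fun k => eventually_le_card_forcedSet q.ha q.rule k hA0)
  refine ⟨K * (C₁ + C₂) + (n₀ : ℝ) ^ Q + 1, by positivity, fun M n hn => ?_⟩
  have hn1 : (1 : ℝ) ≤ (n : ℝ) := by exact_mod_cast hn
  have hpow : (0 : ℝ) < (n : ℝ) ^ Q := by positivity
  rcases lt_or_ge n n₀ with hlt | hge
  · refine measureReal_le_one.trans ?_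
    rw [le_div_iff₀ hpow, one_mul]
    have h1 : (n : ℝ) ^ Q ≤ (n₀ : ℝ) ^ Q :=
      pow_le_pow_left₀ (by positivity) (by exact_mod_cast hlt.le) Q
    have h2 : 0 ≤ K * (C₁ + C₂) := by positivity
    linarith
  have hlog : 0 ≤ Real.log n := Real.log_natCast_nonneg n
  set l3 := (1 + Real.log n) ^ 3 with hl3
  have hl3' : 1 + Real.log n ≤ l3 := le_self_pow₀ (by linarith) (by norm_num)
  have hsub : {ω | ¬ M.Close δ (M.est n ω)} ⊆ ⋃ k ∈ (Finset.univ : Finset (Fin K)),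
      ({ω | C₁ * l3 < M.quad n k (M.err n k ω) ω}
        ∪ {ω | ∃ θ, M.quad n k θ ω < c * (forcedSet q.a q.r k n).card * ‖θ‖ ^ 2}) := by
    intro ω hω
    by_contra hcon
    simp only [Set.mem_iUnion, Set.mem_union, Set.mem_ofPred_eq, Finset.mem_univ, exists_prop,
      true_and, not_exists, not_or, not_lt] at hcon
    refine hω fun k => ?_
    obtain ⟨h1, h2⟩ := hcon k
    have h3 := (h2 (M.err n k ω)).trans h1
    have h4 := hn₀ n hge k
    have h5 : (C₁ / δ ^ 2 + Q + 1) * l3 ≤ c * (forcedSet q.a q.r k n).card := by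
      have := mul_le_mul_of_nonneg_left h4 hc.le
      rw [hA, ← mul_assoc, mul_div_cancel₀ _ hc.ne'] at this
      exact this
    have hl30 : 0 < l3 := by linarith
    have h6 : C₁ / δ ^ 2 * l3 * ‖M.err n k ω‖ ^ 2 ≤ C₁ * l3 := by
      refine le_trans ?_ h3
      refine mul_le_mul_of_nonneg_right (le_trans ?_ h5) (by positivity)
      have : 0 ≤ ((Q : ℝ) + 1) * l3 := by positivity
      nlinarith
    have h7 : ‖M.err n k ω‖ ^ 2 ≤ δ ^ 2 := by
      have e : C₁ / δ ^ 2 * l3 * ‖M.err n k ω‖ ^ 2 = (C₁ * l3) * (‖M.err n k ω‖ ^ 2 / δ ^ 2) := by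
        field_simp
      rw [e] at h6
      have h8 : ‖M.err n k ω‖ ^ 2 / δ ^ 2 ≤ 1 := by
        by_contra h9
        push Not at h9
        have : 0 < C₁ * l3 := by positivity
        nlinarith
      rwa [div_le_one (by positivity)] at h8
    exact le_of_sq_le_sq h7 hδ.le
  have hterm : ∀ k, M.P.real ({ω | C₁ * l3 < M.quad n k (M.err n k ω) ω}
        ∪ {ω | ∃ θ, M.quad n k θ ω < c * (forcedSet q.a q.r k n).card * ‖θ‖ ^ 2})
      ≤ (C₁ + C₂) / (n : ℝ) ^ Q := by
    intro k
    refine (measureReal_union_le _ _).trans ?_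
    rw [add_div]
    refine add_le_add (h₁ M n k hn) ((h₂ M k n).trans ?_)
    rw [div_eq_mul_one_div, ← exp_neg_mul_log_natCast hn]
    refine mul_le_mul_of_nonneg_left (Real.exp_le_exp.2 (neg_le_neg ?_)) hC₂.le
    have h4 := hn₀ n hge k
    have h5 : (C₁ / δ ^ 2 + Q + 1) * l3 ≤ c * (forcedSet q.a q.r k n).card := by
      have := mul_le_mul_of_nonneg_left h4 hc.le
      rw [hA, ← mul_assoc, mul_div_cancel₀ _ hc.ne'] at this
      exact this
    refine le_trans ?_ h5
    have h6 : (Q : ℝ) * Real.log n ≤ Q * l3 := mul_le_mul_of_nonneg_left (by linarith) (Nat.cast_nonneg _)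
    have h7 : 0 ≤ (C₁ / δ ^ 2 + 1) * l3 := by positivity
    linarith
  calc _ ≤ _ := measureReal_mono hsub (measure_ne_top _ _)
    _ ≤ _ := measureReal_biUnion_finset_le _ _
    _ ≤ ∑ k : Fin K, (C₁ + C₂) / (n : ℝ) ^ Q := Finset.sum_le_sum fun k _ => hterm k
    _ = K * (C₁ + C₂) / (n : ℝ) ^ Q := by
      rw [Finset.sum_const, Finset.card_univ, Fintype.card_fin, nsmul_eq_mul]
      ring
    _ ≤ _ := by
      refine div_le_div_of_nonneg_right ?_ hpow.le
      have : (0 : ℝ) ≤ (n₀ : ℝ) ^ Q := by positivity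
      linarith

end Model

/-! ### The recursion for the dual vector -/

/-- The Euclidean norm of a vector of dual variables. -/
def nrm {K : ℕ} (h : Fin K → ℝ) : ℝ := Real.sqrt (∑ k, h k ^ 2)

/-- One step of the stochastic gradient method, if the alternative `j` is chosen. -/
def upd {K : ℕ} (p : Fin K → ℝ) (t : ℝ) (h : Fin K → ℝ) (j : Fin K) : Fin K → ℝ :=
  fun k => h k + t * (-(if k = j then 1 else 0) + p k)

lemma nrm_nonneg {K : ℕ} (h : Fin K → ℝ) : 0 ≤ nrm h := Real.sqrt_nonneg _

lemma sq_nrm {K : ℕ} (h : Fin K → ℝ) : nrm h ^ 2 = ∑ k, h k ^ 2 :=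
  Real.sq_sqrt (Finset.sum_nonneg fun _ _ => sq_nonneg _)

lemma abs_le_nrm {K : ℕ} (h : Fin K → ℝ) (j : Fin K) : |h j| ≤ nrm h := by
  refine abs_le_of_sq_le_sq ?_ (nrm_nonneg h)
  rw [sq_nrm]
  exact Finset.single_le_sum (f := fun k => h k ^ 2) (fun k _ => sq_nonneg _) (Finset.mem_univ j)

lemma sub_le_two_nrm {K : ℕ} (h : Fin K → ℝ) (j k : Fin K) : h j - h k ≤ 2 * nrm h := by
  have h1 := abs_le.1 (abs_le_nrm h j)
  have h2 := abs_le.1 (abs_le_nrm h k)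
  linarith

lemma nrm_le_of_sub_le {K : ℕ} {h : Fin K → ℝ} (h0 : ∑ k, h k = 0) {m : ℝ}
    (hm : ∀ j k, h j - h k ≤ m) : nrm h ≤ K * m := by
  rcases Nat.eq_zero_or_pos K with hK | hK
  · subst hK; simp [nrm]
  have hK' : (0 : ℝ) < K := by exact_mod_cast hK
  have hm0 : 0 ≤ m := by simpa using hm ⟨0, hK⟩ ⟨0, hK⟩
  have habs : ∀ j, |h j| ≤ m := by
    intro j
    have h1 : K * h j ≤ K * m := by
      have : ∑ k, (h j - h k) ≤ ∑ _k : Fin K, m := Finset.sum_le_sum fun k _ => hm j k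
      rw [Finset.sum_sub_distrib, h0] at this
      simpa using this
    have h2 : -(K * h j) ≤ K * m := by
      have : ∑ k, (h k - h j) ≤ ∑ _k : Fin K, m := Finset.sum_le_sum fun k _ => hm k j
      rw [Finset.sum_sub_distrib, h0] at this
      simpa using this
    rw [abs_le]
    constructor <;> nlinarith
  refine le_of_sq_le_sq ?_ (by positivity)
  rw [sq_nrm]
  calc ∑ k, h k ^ 2 ≤ ∑ _k : Fin K, m ^ 2 := Finset.sum_le_sum fun k _ => by
        have := abs_le.1 (habs k)
        exact sq_le_sq' this.1 this.2
    _ = K * m ^ 2 := by simp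
    _ ≤ (K * m) ^ 2 := by
        rw [mul_pow]
        refine mul_le_mul_of_nonneg_right ?_ (by positivity)
        exact_mod_cast Nat.le_self_pow (by norm_num) K

lemma sum_upd {K : ℕ} {p : Fin K → ℝ} (hp : p ∈ stdSimplex ℝ (Fin K)) (t : ℝ) (h : Fin K → ℝ)
    (j : Fin K) : ∑ k, upd p t h j k = ∑ k, h k := by
  simp only [upd, Finset.sum_add_distrib, ← Finset.mul_sum, Finset.sum_neg_distrib, hp.2]
  simp

/-- Expansion of the square; the increment is t times a difference of two probability vectors, of
squared norm at most 2. -/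
lemma sum_upd_sq_le {K : ℕ} {p : Fin K → ℝ} (hp : p ∈ stdSimplex ℝ (Fin K)) (t : ℝ)
    (h : Fin K → ℝ) (j : Fin K) :
    nrm (upd p t h j) ^ 2 ≤ nrm h ^ 2 - 2 * t * (h j - ∑ k, p k * h k) + 2 * t ^ 2 := by
  rw [sq_nrm, sq_nrm]
  have e : ∀ k, upd p t h j k ^ 2 = h k ^ 2
      + 2 * t * (p k * h k) - 2 * t * (if k = j then h k else 0)
      + t ^ 2 * (p k ^ 2 + if k = j then 1 - 2 * p k else 0) := by
    intro k
    simp only [upd]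
    split_ifs <;> ring
  have hp2 : ∑ k, p k ^ 2 ≤ 1 := by
    rw [← hp.2]
    refine Finset.sum_le_sum fun k _ => ?_
    have h1 : p k ≤ 1 := by
      rw [← hp.2]
      exact Finset.single_le_sum (fun k _ => hp.1 k) (Finset.mem_univ k)
    nlinarith [hp.1 k]
  simp only [e, Finset.sum_add_distrib, Finset.sum_sub_distrib, ← Finset.mul_sum,
    Finset.sum_ite_eq', Finset.mem_univ, if_true]
  nlinarith [hp.1 j, sq_nonneg t, mul_nonneg (sq_nonneg t) (hp.1 j)]

lemma abs_sum_mul_le_nrm {K : ℕ} {p : Fin K → ℝ} (hp : p ∈ stdSimplex ℝ (Fin K))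
    (h : Fin K → ℝ) : |∑ k, p k * h k| ≤ nrm h := by
  calc |∑ k, p k * h k| ≤ ∑ k, |p k * h k| := Finset.abs_sum_le_sum_abs _ _
    _ ≤ ∑ k, p k * nrm h := Finset.sum_le_sum fun k _ => by
        rw [abs_mul, abs_of_nonneg (hp.1 k)]
        exact mul_le_mul_of_nonneg_left (abs_le_nrm h k) (hp.1 k)
    _ = nrm h := by rw [← Finset.sum_mul, hp.2, one_mul]

lemma abs_sub_sum_le {K : ℕ} {p : Fin K → ℝ} (hp : p ∈ stdSimplex ℝ (Fin K))
    (h : Fin K → ℝ) (j : Fin K) : |h j - ∑ k, p k * h k| ≤ 2 * nrm h := by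
  refine (abs_sub _ _).trans ?_
  linarith [abs_le_nrm h j, abs_sum_mul_le_nrm hp h]

lemma nrm_upd_le {K : ℕ} {p : Fin K → ℝ} (hp : p ∈ stdSimplex ℝ (Fin K)) {t : ℝ} (ht : 0 ≤ t)
    (h : Fin K → ℝ) (j : Fin K) : nrm (upd p t h j) ≤ nrm h + 2 * t := by
  have h0 := nrm_nonneg h
  refine le_of_sq_le_sq ?_ (by positivity)
  refine (sum_upd_sq_le hp t h j).trans ?_
  have h1 := (abs_le.1 (abs_sub_sum_le hp h j)).1
  nlinarith

/-- Linearisation √(N² + 2Nx) ≤ N + x. Unlike the triangle inequality it keeps the signed first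
order term, which carries the drift. -/
lemma nrm_upd_le' {K : ℕ} {p : Fin K → ℝ} (hp : p ∈ stdSimplex ℝ (Fin K)) (t : ℝ)
    (h : Fin K → ℝ) (j : Fin K) (hh : 0 < nrm h) :
    nrm (upd p t h j)
      ≤ nrm h + (-(t * ((h j - ∑ k, p k * h k) / nrm h)) + t ^ 2 / nrm h) := by
  set x := -(t * ((h j - ∑ k, p k * h k) / nrm h)) + t ^ 2 / nrm h with hx
  have h1 := sum_upd_sq_le hp t h j
  have e : nrm h ^ 2 - 2 * t * (h j - ∑ k, p k * h k) + 2 * t ^ 2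
      = nrm h ^ 2 + 2 * nrm h * x := by
    rw [hx]; field_simp; ring
  rw [e] at h1
  have h2 : 0 ≤ nrm h + 2 * x := by
    have h3 : 0 ≤ nrm h * (nrm h + 2 * x) := by nlinarith [sq_nonneg (nrm (upd p t h j))]
    exact nonneg_of_mul_nonneg_right h3 hh
  refine le_of_sq_le_sq ?_ (by linarith)
  nlinarith [sq_nonneg x]

lemma measurable_nrm {K : ℕ} : Measurable (nrm : (Fin K → ℝ) → ℝ) := by
  unfold nrm
  fun_prop

lemma measurable_upd {K : ℕ} (p : Fin K → ℝ) (t : ℝ) : Measurable (Function.uncurry (upd p t)) := by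
  refine measurable_from_prod_countable_left fun j => ?_
  refine measurable_pi_lambda _ fun k => ?_
  have : Measurable fun h : Fin K → ℝ => h k := measurable_pi_apply k
  exact this.add_const (t * (-(if k = j then 1 else 0) + p k))

namespace Model

variable {K d : ℕ} {q : Par K d} (M : Model q)

/-- The dual update uses the plug-in decision even in forced periods, so exploration does not bias
the gradient. -/
lemma dev_succ (n : ℕ) (ω : M.Ω) : M.dev (n + 1) ω
    = upd M.p (q.α / (n + 1)) (M.dev n ω) (M.dec (M.est n ω) (M.X n ω)) := by
  funext k
  have : (M.est (n + 1) ω).1 k = (M.est n ω).1 k + q.α / (n + 1)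
      * (-(if k = M.dec (M.est n ω) (M.X n ω) then 1 else 0) + M.p k) := rfl
  simp only [dev, shiftDev, upd, this]
  ring

lemma sum_dev (n : ℕ) (ω : M.Ω) : ∑ k, M.dev n ω k = 0 := by
  induction n with
  | zero =>
    have : ∀ k, M.dev 0 ω k = (M.g0 k - M.gstar k) - (∑ j, (M.g0 j - M.gstar j)) / K := fun k => rfl
    simp only [this]
    rw [Finset.sum_sub_distrib (f := fun k => M.g0 k - M.gstar k), Finset.sum_const,
      Finset.card_univ, Fintype.card_fin, nsmul_eq_mul, mul_div_cancel₀, sub_self]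
    have := K_pos q
    positivity
  | succ n ih => rw [dev_succ, sum_upd M.data.p_mem, ih]

/-- A deterministic bound for the initial deviation. -/
def devConst (q : Par K d) : ℝ := K * (2 * q.R + 2 * q.R * q.κ₆)

lemma devConst_nonneg (q : Par K d) : 0 ≤ devConst q := by
  have := q.hR
  have := q.hκ₆
  unfold devConst
  positivity

lemma nrm_dev_zero_le (ω : M.Ω) : nrm (M.dev 0 ω) ≤ devConst q := by
  refine nrm_le_of_sub_le (M.sum_dev 0 ω) fun j k => ?_
  have : ∀ k, M.dev 0 ω k = M.g0 k - M.gstar k - (∑ j, (M.g0 j - M.gstar j)) / K := fun k => rfl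
  rw [this, this]
  have h1 := abs_le.1 (M.hg0 j)
  have h2 := abs_le.1 (M.hg0 k)
  have h3 := M.gstar_sub_le k j
  linarith

/-- The steps 2α/(i+1) sum to a logarithm. This sure bound is the starting value for the Lyapunov
argument and the price paid on exceptional events. -/
lemma nrm_dev_le (n : ℕ) (ω : M.Ω) :
    nrm (M.dev n ω) ≤ devConst q + 2 * q.α * (1 + Real.log n) := by
  have h : nrm (M.dev n ω) ≤ devConst q + 2 * q.α * (harmonic n : ℝ) := by
    induction n with
    | zero => simpa using M.nrm_dev_zero_le ω
    | succ n ih =>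
      rw [dev_succ]
      have hα := q.hα
      refine (nrm_upd_le M.data.p_mem (by positivity) _ _).trans ?_
      rw [harmonic_succ]
      push_cast
      rw [mul_add, div_eq_mul_inv]
      linarith
  refine h.trans ?_
  have h1 := harmonic_le_one_add_log n
  have := mul_le_mul_of_nonneg_left h1 (by linarith [q.hα] : 0 ≤ 2 * q.α)
  linarith

/-- Outside a ball the drift pulls the dual vector inward. -/
lemma exists_drift (q : Par K d) {δ : ℝ} (hδ : 0 < δ) : ∃ c δ₁ : ℝ, 0 < c ∧ c ≤ 1 ∧ 0 < δ₁ ∧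
    ∀ (M : Model q) (s : (Fin K → ℝ) × (Fin K → EuclideanSpace ℝ (Fin d))), M.Close δ₁ s →
      ∑ k, M.shiftDev s.1 k = 0 → δ ≤ nrm (M.shiftDev s.1) →
      c * nrm (M.shiftDev s.1)
        ≤ ∫ ω, (M.shiftDev s.1 (M.dec s (M.X 0 ω)) - M.shiftDev s.1 (M.opt (M.X 0 ω))) ∂M.P := by
  have hK : (0 : ℝ) < K := by exact_mod_cast K_pos q
  have hκ₁ := q.hκ₁
  have hκ₂ := q.hκ₂
  have hκ₅ := q.hκ₅
  have hκ₆ := q.hκ₆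
  set m₀ := δ / K with hm₀
  have hm₀0 : 0 < m₀ := by positivity
  set A := q.κ₂ * q.κ₅ * min m₀ q.κ₁ / 4 with hA
  have hA0 : 0 < A := by positivity
  -- A centred vector of norm at least δ has spread m ≥ m₀ = δ/K. The drift is at least A·m, of
  -- which the regression error takes A·m₀/2; what is left, A·m/2, dominates A/(2K) times the norm.
  refine ⟨min (A / (2 * K)) 1, A * m₀ / (4 * q.κ₆), by positivity, min_le_right _ _, by positivity,
    fun M s hs h0 hδs => ?_⟩
  set h := M.shiftDev s.1 with hh
  have : Nonempty (Fin K) := ⟨q.r 0⟩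
  obtain ⟨J, hJ⟩ := Finite.exists_max h
  obtain ⟨I, hI⟩ := Finite.exists_min h
  set m := h J - h I with hm
  have hle : nrm h ≤ K * m := nrm_le_of_sub_le h0 fun j k => by
    rw [hm]; linarith [hJ j, hI k]
  have hm₀m : m₀ ≤ m := by
    rw [hm₀, div_le_iff₀ hK]; linarith
  have hm0 : 0 < m := by linarith
  have hdr := M.drift_ge_spread hs hm0 (J := J) (I := I) le_rfl
  refine le_trans ?_ hdr
  have h1 : A * m ≤ q.κ₂ * q.κ₅ * (min m q.κ₁ / 2) * (m / 2) := by
    have : min m₀ q.κ₁ ≤ min m q.κ₁ := min_le_min_right _ hm₀m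
    rw [hA]
    calc _ = q.κ₂ * q.κ₅ * (min m₀ q.κ₁ / 2) * (m / 2) := by ring
      _ ≤ _ := by gcongr
  have h2 : 2 * q.κ₆ * (A * m₀ / (4 * q.κ₆)) = A * m₀ / 2 := by field_simp; ring
  rw [h2]
  have h3 : min (A / (2 * K)) 1 * nrm h ≤ A / (2 * K) * (K * m) :=
    mul_le_mul (min_le_left _ _) hle (nrm_nonneg h) (by positivity)
  have h4 : A / (2 * K) * (K * m) = A * m / 2 := by field_simp
  have h5 : A * m₀ ≤ A * m := mul_le_mul_of_nonneg_left hm₀m hA0.le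
  linarith

/-- One step estimate for the exponential Lyapunov function. -/
lemma lintegral_exp_nrm_upd_le {δ c t lam : ℝ} (hδ : 0 < δ) (hc : 0 < c) (hc1 : c ≤ 1)
    {s : (Fin K → ℝ) × (Fin K → EuclideanSpace ℝ (Fin d))}
    (hdrift : δ ≤ nrm (M.shiftDev s.1) → c * nrm (M.shiftDev s.1)
        ≤ ∫ ω, (M.shiftDev s.1 (M.dec s (M.X 0 ω)) - M.shiftDev s.1 (M.opt (M.X 0 ω))) ∂M.P)
    (ht : 0 ≤ t) (hlam : 0 ≤ lam) (htc : t ≤ c * δ / 4) (hτ : lam * t ≤ c / 16) :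
    ∫⁻ ω, ENNReal.ofReal (Real.exp (lam * nrm (upd M.p t (M.shiftDev s.1) (M.dec s (M.X 0 ω)))))
      ∂M.P ≤ ENNReal.ofReal (Real.exp (-(lam * t * c / 2))
        * Real.exp (lam * nrm (M.shiftDev s.1)) + Real.exp (lam * δ + 1)) := by
  have hp := M.data.p_mem
  set h := M.shiftDev s.1 with hh
  have hτ0 : 0 ≤ lam * t := by positivity
  -- Inside the ball no drift is available, but one step adds at most 2t to the norm, which the
  -- additive term exp(lam·δ + 1) covers.
  rcases lt_or_ge (nrm h) δ with hlt | hge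
  · calc _ ≤ ∫⁻ _, ENNReal.ofReal (Real.exp (lam * δ + 1)) ∂M.P := by
          refine lintegral_mono fun ω => ENNReal.ofReal_le_ofReal (Real.exp_le_exp.2 ?_)
          have h1 := nrm_upd_le hp ht h (M.dec s (M.X 0 ω))
          have h2 : nrm (upd M.p t h (M.dec s (M.X 0 ω))) ≤ δ + 2 * t := by linarith
          have h3 := mul_le_mul_of_nonneg_left h2 hlam
          linarith
      _ = ENNReal.ofReal (Real.exp (lam * δ + 1)) := by simp
      _ ≤ _ := ENNReal.ofReal_le_ofReal (by
          have := Real.exp_pos (-(lam * t * c / 2))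
          have := Real.exp_pos (lam * nrm h)
          nlinarith)
  · have hN : 0 < nrm h := by linarith
    set τ := lam * t with hτdef
    set v : Fin K → ℝ := fun j => (h j - ∑ k, M.p k * h k) / nrm h with hv
    have hv2 : ∀ j, |v j| ≤ 2 := by
      intro j
      rw [hv, abs_div, abs_of_pos hN, div_le_iff₀ hN]
      exact abs_sub_sum_le hp h j
    have hmeas := M.measurable_dec_X s 0
    have hvi := integrable_comp_fin (P := M.P) v hmeas
    -- First order optimality replaces p·h by E h(opt), which identifies the mean of v with the
    -- normalised drift.
    have hEv : c ≤ ∫ ω, v (M.dec s (M.X 0 ω)) ∂M.P := by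
      have e : ∀ j, v j = (nrm h)⁻¹ * (h j - ∑ k, M.p k * h k) := fun j => by
        rw [hv]; ring
      simp only [e]
      rw [integral_const_mul, integral_sub (integrable_comp_fin h hmeas) (integrable_const _),
        M.p_dot_eq h]
      simp only [integral_const, probReal_univ, smul_eq_mul, one_mul]
      have h1 := hdrift hge
      rw [integral_sub (integrable_comp_fin h hmeas)
        (integrable_comp_fin h (M.measurable_opt_X 0))] at h1
      rw [inv_mul_eq_div, le_div_iff₀ hN]
      exact h1
    have hpt : ∀ j, Real.exp (lam * nrm (upd M.p t h j))
        ≤ Real.exp (lam * nrm h + τ * c / 4) * (1 - τ * v j + 4 * τ ^ 2) := by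
      intro j
      have h1 := nrm_upd_le' hp t h j hN
      have h2 : t ^ 2 / nrm h ≤ t * c / 4 := by
        rw [div_le_iff₀ hN]
        have : t * t ≤ t * (c * nrm h / 4) := by
          refine mul_le_mul_of_nonneg_left (htc.trans ?_) ht
          have := mul_le_mul_of_nonneg_left hge hc.le
          linarith
        linarith
      have h3 : lam * nrm (upd M.p t h j) ≤ (lam * nrm h + τ * c / 4) + -(τ * v j) := by
        have := mul_le_mul_of_nonneg_left (h1.trans (add_le_add_right (add_le_add_right h2 _) _)) hlam
        rw [hτdef]
        linarith
      have h4 : |-(τ * v j)| ≤ 1 := by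
        rw [abs_neg, abs_mul, abs_of_nonneg hτ0]
        have := mul_le_mul hτ (hv2 j) (abs_nonneg _) (by positivity)
        linarith
      have h5 := (abs_le.1 (Real.abs_exp_sub_one_sub_id_le h4)).2
      have h6 : (-(τ * v j)) ^ 2 ≤ 4 * τ ^ 2 := by
        have h7 := abs_le.1 (hv2 j)
        have h8 : v j ^ 2 ≤ 4 := by nlinarith
        have := mul_le_mul_of_nonneg_left h8 (sq_nonneg τ)
        linarith
      calc _ ≤ _ := Real.exp_le_exp.2 h3
        _ = Real.exp (lam * nrm h + τ * c / 4) * Real.exp (-(τ * v j)) := Real.exp_add _ _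
        _ ≤ _ := mul_le_mul_of_nonneg_left (by linarith) (Real.exp_pos _).le
    have hi : Integrable (fun ω => Real.exp (lam * nrm h + τ * c / 4)
        * (1 - τ * v (M.dec s (M.X 0 ω)) + 4 * τ ^ 2)) M.P :=
      (((integrable_const _).sub (hvi.const_mul τ)).add (integrable_const _)).const_mul _
    calc _ ≤ ∫⁻ ω, ENNReal.ofReal (Real.exp (lam * nrm h + τ * c / 4)
        * (1 - τ * v (M.dec s (M.X 0 ω)) + 4 * τ ^ 2)) ∂M.P :=
          lintegral_mono fun ω => ENNReal.ofReal_le_ofReal (hpt _)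
      _ = ENNReal.ofReal (∫ ω, Real.exp (lam * nrm h + τ * c / 4)
        * (1 - τ * v (M.dec s (M.X 0 ω)) + 4 * τ ^ 2) ∂M.P) :=
          (ofReal_integral_eq_lintegral_ofReal hi (Eventually.of_forall fun ω =>
            (Real.exp_pos _).le.trans (hpt _))).symm
      _ ≤ _ := by
          refine ENNReal.ofReal_le_ofReal ?_
          have e : ∫ ω, (1 - τ * v (M.dec s (M.X 0 ω)) + 4 * τ ^ 2) ∂M.P
              = 1 - τ * (∫ ω, v (M.dec s (M.X 0 ω)) ∂M.P) + 4 * τ ^ 2 := by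
            have e1 : ∀ ω, 1 - τ * v (M.dec s (M.X 0 ω)) + 4 * τ ^ 2
                = (1 + 4 * τ ^ 2) - τ * v (M.dec s (M.X 0 ω)) := fun ω => by ring
            simp only [e1]
            rw [integral_sub (integrable_const _) (hvi.const_mul τ), integral_const_mul]
            simp only [integral_const, probReal_univ, smul_eq_mul, one_mul]
            ring
          rw [integral_const_mul, e]
          have h1 := mul_le_mul_of_nonneg_left hEv hτ0
          have h2 : 4 * τ ^ 2 ≤ τ * c / 4 := by nlinarith
          have h3 := Real.add_one_le_exp (-(τ * c * (3 / 4)))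
          have h4 : Real.exp (lam * nrm h + τ * c / 4) * Real.exp (-(τ * c * (3 / 4)))
              = Real.exp (-(τ * c / 2)) * Real.exp (lam * nrm h) := by
            rw [← Real.exp_add, ← Real.exp_add]; congr 1; ring
          have h5 : Real.exp (lam * nrm h + τ * c / 4)
              * (1 - τ * ∫ ω, v (M.dec s (M.X 0 ω)) ∂M.P + 4 * τ ^ 2)
              ≤ Real.exp (lam * nrm h + τ * c / 4) * Real.exp (-(τ * c * (3 / 4))) :=
            mul_le_mul_of_nonneg_left (by linarith) (Real.exp_pos _).le
          rw [h4] at h5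
          linarith [Real.exp_pos (lam * δ + 1)]

end Model

/-! ### Concentration of the dual vector -/

lemma log_sub_log_le_sum (a m : ℕ) :
    Real.log (a + m + 1) - Real.log (a + 1) ≤ ∑ i ∈ Finset.range m, 1 / ((a : ℝ) + i + 1) := by
  induction m with
  | zero => simp
  | succ m ih =>
    rw [Finset.sum_range_succ]
    push_cast
    have hx : (0 : ℝ) < a + m + 1 := by positivity
    have h := Real.log_le_sub_one_of_pos (x := ((a : ℝ) + (m + 1) + 1) / (a + m + 1))
      (by positivity)
    rw [Real.log_div (by positivity) hx.ne'] at h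
    have e : ((a : ℝ) + (m + 1) + 1) / (a + m + 1) - 1 = 1 / (a + m + 1) := by
      field_simp; ring
    linarith

namespace Model

variable {K d : ℕ} {q : Par K d} (M : Model q)

lemma measurableSet_close (δ : ℝ) {i n : ℕ} (h : i ≤ n) :
    MeasurableSet[M.past n] {ω | M.Close δ (M.est i ω)} := by
  have : {ω | M.Close δ (M.est i ω)} = ⋂ k, {ω | ‖M.err i k ω‖ ≤ δ} := by
    ext ω; simp [Close, err]
  rw [this]
  refine MeasurableSet.iInter fun k => ?_
  have h1 : Measurable[M.past n] (M.err i k) := (M.measurable_err i k).mono (M.past_mono h) le_rfl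
  exact (measurable_norm.comp h1) measurableSet_Iic

/-- The coefficients stay close to the true ones from period `a` on. -/
def StaysClose (δ : ℝ) (a m : ℕ) (ω : M.Ω) : Prop :=
  ∀ i ∈ Finset.range m, M.Close δ (M.est (a + i) ω)

lemma measurableSet_staysClose (δ : ℝ) (a m : ℕ) :
    MeasurableSet[M.past (a + m)] {ω | M.StaysClose δ a (m + 1) ω} := by
  have : {ω | M.StaysClose δ a (m + 1) ω}
      = ⋂ i ∈ Finset.range (m + 1), {ω | M.Close δ (M.est (a + i) ω)} := by
    ext ω; simp [StaysClose]
  rw [this]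
  refine Finset.measurableSet_biInter _ fun i hi => M.measurableSet_close δ ?_
  have := Finset.mem_range.1 hi
  omega

/-- Iteration of the one-step estimate on the event that the coefficients stay close. The initial
term decays by the product of the contractions, a power law in time, and each step adds at most
exp(lam·δ + 1). -/
lemma lintegral_exp_dev_le {δ c δ₁ lam Y : ℝ} (hδ : 0 < δ) (hc : 0 < c) (hc1 : c ≤ 1)
    (hdrift : ∀ s : (Fin K → ℝ) × (Fin K → EuclideanSpace ℝ (Fin d)), M.Close δ₁ s →
      ∑ k, M.shiftDev s.1 k = 0 → δ ≤ nrm (M.shiftDev s.1) → c * nrm (M.shiftDev s.1)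
        ≤ ∫ ω, (M.shiftDev s.1 (M.dec s (M.X 0 ω)) - M.shiftDev s.1 (M.opt (M.X 0 ω))) ∂M.P)
    (hlam : 0 ≤ lam) {a : ℕ} (htc : q.α / (a + 1) ≤ c * δ / 4)
    (hτ : lam * (q.α / (a + 1)) ≤ c / 16) (hY : ∀ ω, nrm (M.dev a ω) ≤ Y) (m : ℕ) :
    ∫⁻ ω, (if M.StaysClose δ₁ a m ω then
        ENNReal.ofReal (Real.exp (lam * nrm (M.dev (a + m) ω))) else 0) ∂M.P
      ≤ ENNReal.ofReal (Real.exp (lam * Y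
          - lam * q.α * c / 2 * ∑ i ∈ Finset.range m, 1 / ((a : ℝ) + i + 1))
        + m * Real.exp (lam * δ + 1)) := by
  have hα := q.hα
  induction m with
  | zero =>
    simp only [StaysClose, Finset.range_zero, Finset.notMem_empty, false_imp_iff, implies_true,
      if_true, Finset.sum_empty, mul_zero, sub_zero, Nat.cast_zero, zero_mul, add_zero]
    calc _ ≤ ∫⁻ _, ENNReal.ofReal (Real.exp (lam * Y)) ∂M.P :=
          lintegral_mono fun ω => ENNReal.ofReal_le_ofReal
            (Real.exp_le_exp.2 (mul_le_mul_of_nonneg_left (hY ω) hlam))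
      _ = _ := by simp
  | succ m ih =>
    set t : ℝ := q.α / ((a : ℝ) + m + 1) with ht
    have ht0 : 0 ≤ t := by positivity
    have hta : t ≤ q.α / (a + 1) := by
      rw [ht]
      refine div_le_div_of_nonneg_left hα.le (by positivity) ?_
      have : (0 : ℝ) ≤ m := Nat.cast_nonneg m
      linarith
    -- The event up to m + 1 involves the coefficients up to period a + m only, so it is known
    -- before that period's observation.
    set b : M.Ω → ENNReal := fun ω => if M.StaysClose δ₁ a (m + 1) ω then 1 else 0 with hb
    have hbm : Measurable[M.past (a + m)] b :=
      Measurable.ite (M.measurableSet_staysClose δ₁ a m) measurable_const measurable_const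
    have hA : Measurable[M.past (a + m)] fun ω => (b ω, M.est (a + m) ω) :=
      measurable_comp₂ (F := fun u v => (u, v)) measurable_id hbm (M.measurable_est (a + m))
    have hg : Measurable fun z : ((Fin K → ℝ) × (Fin K → EuclideanSpace ℝ (Fin d)))
        × EuclideanSpace ℝ (Fin d) => ENNReal.ofReal
          (Real.exp (lam * nrm (upd M.p t (M.shiftDev z.1.1) (M.dec z.1 z.2)))) := by
      refine ENNReal.measurable_ofReal.comp (Real.measurable_exp.comp (measurable_const.mul
        (measurable_nrm.comp ?_)))
      exact measurable_comp₂ (measurable_upd M.p t)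
        (M.measurable_shiftDev.comp (measurable_fst.comp measurable_fst)) M.measurable_dec
    set f : ENNReal × ((Fin K → ℝ) × (Fin K → EuclideanSpace ℝ (Fin d))) →
        EuclideanSpace ℝ (Fin d) × (Fin K → ℝ) → ENNReal := fun u o =>
          u.1 * ENNReal.ofReal
            (Real.exp (lam * nrm (upd M.p t (M.shiftDev u.2.1) (M.dec u.2 o.1)))) with hf
    have hfm : Measurable (Function.uncurry f) := by
      have h1 : Measurable fun z : (ENNReal × ((Fin K → ℝ) × (Fin K → EuclideanSpace ℝ (Fin d))))
          × (EuclideanSpace ℝ (Fin d) × (Fin K → ℝ)) => (z.1.2, z.2.1) :=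
        (measurable_snd.comp measurable_fst).prodMk (measurable_fst.comp measurable_snd)
      have h2 := hg.comp h1
      exact (measurable_fst.comp measurable_fst).mul h2
    have hstep := M.lintegral_step hA hfm
    set ih' := fun ω => (if M.StaysClose δ₁ a m ω then
        ENNReal.ofReal (Real.exp (lam * nrm (M.dev (a + m) ω))) else 0) with hih
    set e₁ := Real.exp (-(lam * t * c / 2)) with he₁
    set e₂ := Real.exp (lam * δ + 1) with he₂
    have he₁0 : 0 < e₁ := Real.exp_pos _
    have he₂0 : 0 < e₂ := Real.exp_pos _
    calc _ = ∫⁻ ω, f (b ω, M.est (a + m) ω) (M.obs (a + m) ω) ∂M.P := by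
          refine lintegral_congr fun ω => ?_
          have h1 : M.dev (a + (m + 1)) ω
              = upd M.p t (M.dev (a + m) ω) (M.dec (M.est (a + m) ω) (M.X (a + m) ω)) := by
            rw [← add_assoc, dev_succ]
            push_cast
            rfl
          simp only [hf, hb, h1]
          split_ifs <;> simp [dev, obs]
      _ = ∫⁻ ω, ∫⁻ ω', f (b ω, M.est (a + m) ω) (M.obs 0 ω') ∂M.P ∂M.P := hstep
      _ ≤ ∫⁻ ω, (ENNReal.ofReal e₁ * ih' ω + ENNReal.ofReal e₂) ∂M.P := by
          refine lintegral_mono fun ω => ?_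
          by_cases hE : M.StaysClose δ₁ a (m + 1) ω
          · have hcl : M.Close δ₁ (M.est (a + m) ω) := hE m (by simp)
            have hE' : M.StaysClose δ₁ a m ω := fun i hi =>
              hE i (Finset.mem_range.2 ((Finset.mem_range.1 hi).trans m.lt_succ_self))
            have h1 := M.lintegral_exp_nrm_upd_le (s := M.est (a + m) ω) hδ hc hc1
              (hdrift _ hcl (M.sum_dev _ ω)) ht0 hlam (hta.trans htc)
              ((mul_le_mul_of_nonneg_left hta hlam).trans hτ)
            simp only [hf, hb, hih, if_pos hE, if_pos hE', one_mul]
            refine h1.trans (le_of_eq ?_)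
            rw [ENNReal.ofReal_add (by positivity) he₂0.le, ENNReal.ofReal_mul he₁0.le]
            rfl
          · simp only [hf, hb, if_neg hE, zero_mul]
            simp
      _ = ENNReal.ofReal e₁ * ∫⁻ ω, ih' ω ∂M.P + ENNReal.ofReal e₂ := by
          rw [lintegral_add_right _ measurable_const, lintegral_const_mul']
          · simp
          · exact ENNReal.ofReal_ne_top
      _ ≤ ENNReal.ofReal e₁ * ENNReal.ofReal (Real.exp (lam * Y
          - lam * q.α * c / 2 * ∑ i ∈ Finset.range m, 1 / ((a : ℝ) + i + 1))
        + m * e₂) + ENNReal.ofReal e₂ := by gcongr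
      _ = ENNReal.ofReal (e₁ * (Real.exp (lam * Y
          - lam * q.α * c / 2 * ∑ i ∈ Finset.range m, 1 / ((a : ℝ) + i + 1))
        + m * e₂) + e₂) := by
          rw [← ENNReal.ofReal_mul he₁0.le, ← ENNReal.ofReal_add (by positivity) he₂0.le]
      _ ≤ _ := by
          refine ENNReal.ofReal_le_ofReal ?_
          have he₁1 : e₁ ≤ 1 := Real.exp_le_one_iff.2 (by
            have : 0 ≤ lam * t * c / 2 := by positivity
            linarith)
          have h1 : e₁ * Real.exp (lam * Y
              - lam * q.α * c / 2 * ∑ i ∈ Finset.range m, 1 / ((a : ℝ) + i + 1))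
              = Real.exp (lam * Y
              - lam * q.α * c / 2 * ∑ i ∈ Finset.range (m + 1), 1 / ((a : ℝ) + i + 1)) := by
            rw [he₁, ← Real.exp_add, Finset.sum_range_succ, ht]
            congr 1
            ring
          have h2 : e₁ * (m * e₂) ≤ 1 * (m * e₂) :=
            mul_le_mul_of_nonneg_right he₁1 (by positivity)
          rw [mul_add, h1]
          push_cast
          linarith

lemma prob_staysClose_nrm_gt_le {δ c δ₁ lam Y : ℝ} (hδ : 0 < δ) (hc : 0 < c) (hc1 : c ≤ 1)
    (hdrift : ∀ s : (Fin K → ℝ) × (Fin K → EuclideanSpace ℝ (Fin d)), M.Close δ₁ s →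
      ∑ k, M.shiftDev s.1 k = 0 → δ ≤ nrm (M.shiftDev s.1) → c * nrm (M.shiftDev s.1)
        ≤ ∫ ω, (M.shiftDev s.1 (M.dec s (M.X 0 ω)) - M.shiftDev s.1 (M.opt (M.X 0 ω))) ∂M.P)
    (hlam : 0 ≤ lam) {a : ℕ} (htc : q.α / (a + 1) ≤ c * δ / 4)
    (hτ : lam * (q.α / (a + 1)) ≤ c / 16) (hY : ∀ ω, nrm (M.dev a ω) ≤ Y) (m : ℕ) :
    M.P.real {ω | M.StaysClose δ₁ a m ω ∧ 2 * δ < nrm (M.dev (a + m) ω)}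
      ≤ (Real.exp (lam * Y
          - lam * q.α * c / 2 * ∑ i ∈ Finset.range m, 1 / ((a : ℝ) + i + 1))
        + m * Real.exp (lam * δ + 1)) * Real.exp (-(2 * lam * δ)) := by
  have h := M.lintegral_exp_dev_le hδ hc hc1 hdrift hlam htc hτ hY m
  set W := Real.exp (lam * Y
          - lam * q.α * c / 2 * ∑ i ∈ Finset.range m, 1 / ((a : ℝ) + i + 1))
        + m * Real.exp (lam * δ + 1) with hW
  have hW0 : 0 ≤ W := by positivity
  set B := {ω | M.StaysClose δ₁ a m ω ∧ 2 * δ < nrm (M.dev (a + m) ω)} with hB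
  have hmeas : MeasurableSet[M.past (a + m)] {ω | M.StaysClose δ₁ a m ω} := by
    have : {ω | M.StaysClose δ₁ a m ω}
        = ⋂ i ∈ Finset.range m, {ω | M.Close δ₁ (M.est (a + i) ω)} := by
      ext ω; simp [StaysClose]
    rw [this]
    refine Finset.measurableSet_biInter _ fun i hi => M.measurableSet_close δ₁ ?_
    have := Finset.mem_range.1 hi
    omega
  have hf : Measurable fun ω => (if M.StaysClose δ₁ a m ω then
        ENNReal.ofReal (Real.exp (lam * nrm (M.dev (a + m) ω))) else 0) := by
    refine Measurable.ite (M.past_le _ _ hmeas) ?_ measurable_const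
    have h1 : Measurable (M.dev (a + m)) := (M.measurable_dev (a + m)).mono (M.past_le _) le_rfl
    exact ENNReal.measurable_ofReal.comp (Real.measurable_exp.comp (measurable_const.mul
        (measurable_nrm.comp h1)))
  have h1 := mul_meas_ge_le_lintegral (μ := M.P) hf (ENNReal.ofReal (Real.exp (2 * lam * δ)))
  have h2 : M.P B ≤ M.P {x | ENNReal.ofReal (Real.exp (2 * lam * δ)) ≤
      (if M.StaysClose δ₁ a m x then
        ENNReal.ofReal (Real.exp (lam * nrm (M.dev (a + m) x))) else 0)} := by
    refine measure_mono fun ω hω => ?_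
    rw [Set.mem_ofPred_eq, if_pos hω.1]
    refine ENNReal.ofReal_le_ofReal (Real.exp_le_exp.2 ?_)
    have := mul_le_mul_of_nonneg_left hω.2.le hlam
    linarith
  have h3 : ENNReal.ofReal (Real.exp (2 * lam * δ)) * M.P B ≤ ENNReal.ofReal W :=
    ((mul_le_mul_right h2 _).trans h1).trans h
  have h4 : Real.exp (2 * lam * δ) * M.P.real B ≤ W := by
    have := ENNReal.toReal_mono ENNReal.ofReal_ne_top h3
    rwa [ENNReal.toReal_mul, ENNReal.toReal_ofReal (Real.exp_pos _).le,
      ENNReal.toReal_ofReal hW0] at this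
  rw [Real.exp_neg, ← div_eq_mul_inv, le_div_iff₀ (Real.exp_pos _)]
  linarith

lemma exists_root_le {N : ℕ} (hN : 0 < N) (n : ℕ) :
    ∃ a : ℕ, a ^ N ≤ n ∧ n < (a + 1) ^ N := by
  have h0 : 0 ^ N ≤ n := by rw [zero_pow hN.ne']; exact n.zero_le
  refine ⟨Nat.findGreatest (fun k => k ^ N ≤ n) n,
    Nat.findGreatest_spec (P := fun k => k ^ N ≤ n) n.zero_le h0, ?_⟩
  by_contra hcon
  push Not at hcon
  have h1 : Nat.findGreatest (fun k => k ^ N ≤ n) n + 1 ≤ n :=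
    (Nat.le_self_pow hN.ne' _).trans hcon
  have := Nat.le_findGreatest (P := fun k => k ^ N ≤ n) h1 hcon
  omega

/-- The deviation of the dual vector is small with large probability. -/
lemma prob_nrm_dev_gt_le (q : Par K d) {δ : ℝ} (hδ : 0 < δ) : ∃ C : ℝ, 0 < C ∧
    ∀ (M : Model q) (n : ℕ), 0 < n →
      M.P.real {ω | 2 * δ < nrm (M.dev n ω)} ≤ C / (n : ℝ) ^ 3 := by
  have hα := q.hα
  obtain ⟨c, δ₁, hc, hc1, hδ₁, hdrift⟩ := exists_drift q hδ
  -- The argument starts at a ≈ n^(1/N). The steps from a to n sum to about α(N - 1)·log a, so the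
  -- accumulated drift is at least about 3α·log a and outweighs the sure bound 2α·log a at time a.
  obtain ⟨N, hN⟩ := exists_nat_ge (6 / c + 2)
  have hN1 : (1 : ℝ) ≤ N := by
    have : 0 < 6 / c := by positivity
    linarith
  have hN0 : 0 < N := by exact_mod_cast lt_of_lt_of_le zero_lt_one hN1
  have hNc : 3 ≤ (N - 1) * c / 2 := by
    have h1 : 6 / c + 1 ≤ N - 1 := by linarith
    have h2 := mul_le_mul_of_nonneg_right h1 hc.le
    rw [add_mul, div_mul_cancel₀ _ hc.ne'] at h2
    linarith
  -- Closeness must hold at fewer than n times, each later than n^(1/N); the exponent 4N leaves n ·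
  -- n⁻⁴ = n⁻³.
  obtain ⟨C', hC', hclose⟩ := prob_not_close_le q hδ₁ (4 * N)
  have hev : ∀ᶠ a : ℕ in atTop, 0 < a ∧ q.α / (a + 1) ≤ c * δ / 4 ∧
      4 * N * Real.log (a + 1) / δ * (q.α / (a + 1)) ≤ c / 16 ∧
      devConst q + 2 * q.α + q.α * c / 2 ≤ q.α * Real.log a := by
    have ht : Tendsto (fun a : ℕ => (a : ℝ) + 1) atTop atTop :=
      tendsto_atTop_add_const_right _ _ tendsto_natCast_atTop_atTop
    have h1 : Tendsto (fun a : ℕ => q.α / ((a : ℝ) + 1)) atTop (nhds 0) :=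
      tendsto_const_nhds.div_atTop ht
    have h2 : Tendsto (fun a : ℕ => 4 * N * Real.log (a + 1) / δ * (q.α / ((a : ℝ) + 1)))
        atTop (nhds 0) := by
      have h3 : Tendsto (fun x : ℝ => Real.log x / x) atTop (nhds 0) :=
        Real.isLittleO_log_id_atTop.tendsto_div_nhds_zero
      have h4 := (h3.comp ht).const_mul (4 * N * q.α / δ)
      rw [mul_zero] at h4
      refine h4.congr fun a => ?_
      simp only [Function.comp]
      ring
    have h3 : Tendsto (fun a : ℕ => q.α * Real.log a) atTop atTop :=
      (Real.tendsto_log_atTop.comp tendsto_natCast_atTop_atTop).const_mul_atTop hα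
    filter_upwards [eventually_gt_atTop 0, h1.eventually_le_const (by positivity : 0 < c * δ / 4),
      h2.eventually_le_const (by positivity : 0 < c / 16), h3.eventually_ge_atTop _]
      with a ha1 ha2 ha3 ha4 using ⟨ha1, ha2, ha3, ha4⟩
  obtain ⟨m₀, hm₀⟩ := eventually_atTop.1 hev
  refine ⟨1 + Real.exp 1 + C' * 2 ^ (4 * N) + ((m₀ : ℝ) ^ N) ^ 3, by positivity,
    fun M n hn => ?_⟩
  have hn1 : (1 : ℝ) ≤ (n : ℝ) := by exact_mod_cast hn
  have hn0 : (0 : ℝ) < (n : ℝ) := by linarith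
  have hpow : (0 : ℝ) < (n : ℝ) ^ 3 := by positivity
  obtain ⟨a, ha, han⟩ := exists_root_le hN0 n
  rcases lt_or_ge a m₀ with hlt | hge
  · refine measureReal_le_one.trans ?_
    rw [le_div_iff₀ hpow, one_mul]
    have h1 : (n : ℝ) ≤ (m₀ : ℝ) ^ N := by
      have : n ≤ m₀ ^ N := han.le.trans (Nat.pow_le_pow_left hlt N)
      exact_mod_cast this
    have h2 := pow_le_pow_left₀ hn0.le h1 3
    have h3 : 0 ≤ 1 + Real.exp 1 + C' * 2 ^ (4 * N) := by positivity
    linarith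
  obtain ⟨ha0, hac, haτ, haY⟩ := hm₀ a hge
  have haR : (1 : ℝ) ≤ a := by exact_mod_cast ha0
  have hapos : (0 : ℝ) < a := by linarith
  have hle : a ≤ n := (Nat.le_self_pow hN0.ne' a).trans ha
  have hlogn : 0 ≤ Real.log n := Real.log_natCast_nonneg n
  have hloga : 0 ≤ Real.log a := Real.log_natCast_nonneg a
  -- Then exp(-2·lam·δ) = n⁻⁸, while the additive terms total at most e·n⁵, leaving n⁻³. As log n ≤
  -- N log(a + 1), lam times the step α/(a + 1) is still small.
  set lam := 4 * Real.log n / δ with hlam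
  have hlam0 : 0 ≤ lam := by positivity
  have hlogn1 : Real.log n ≤ N * Real.log (a + 1) := by
    rw [← Real.log_pow]
    exact Real.log_le_log hn0 (by exact_mod_cast han.le)
  have hlogn2 : N * Real.log a ≤ Real.log n := by
    rw [← Real.log_pow]
    exact Real.log_le_log (by positivity) (by exact_mod_cast ha)
  have hτ : lam * (q.α / (a + 1)) ≤ c / 16 := by
    refine le_trans ?_ haτ
    refine mul_le_mul_of_nonneg_right ?_ (by positivity)
    rw [hlam]
    refine div_le_div_of_nonneg_right ?_ hδ.le
    linarith
  obtain ⟨m, rfl⟩ := Nat.exists_eq_add_of_le hle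
  have hmain := M.prob_staysClose_nrm_gt_le hδ hc hc1 (hdrift M) hlam0 hac hτ (M.nrm_dev_le a) m
  set n := a + m with hndef
  have hlamδ : lam * δ = 4 * Real.log n := by rw [hlam]; field_simp
  have hS := log_sub_log_le_sum a m
  have hS' : (N - 1) * Real.log a - 1 ≤ ∑ i ∈ Finset.range m, 1 / ((a : ℝ) + i + 1) := by
    refine le_trans ?_ hS
    have h1 : Real.log n ≤ Real.log (a + m + 1) := by
      refine Real.log_le_log hn0 ?_
      rw [hndef]; push_cast; linarith
    have h2 : Real.log (a + 1) ≤ Real.log a + 1 := by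
      have h3 := Real.log_le_sub_one_of_pos (x := ((a : ℝ) + 1) / a) (by positivity)
      rw [Real.log_div (by positivity) hapos.ne'] at h3
      have e : ((a : ℝ) + 1) / a - 1 = 1 / a := by field_simp; ring
      have : 1 / (a : ℝ) ≤ 1 := by rw [div_le_one hapos]; exact haR
      linarith
    linarith
  have hexp : lam * (devConst q + 2 * q.α * (1 + Real.log a))
          - lam * q.α * c / 2 * ∑ i ∈ Finset.range m, 1 / ((a : ℝ) + i + 1) ≤ 0 := by
    have h1 : q.α * c / 2 * ((N - 1) * Real.log a - 1)
        ≤ q.α * c / 2 * ∑ i ∈ Finset.range m, 1 / ((a : ℝ) + i + 1) :=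
      mul_le_mul_of_nonneg_left hS' (by positivity)
    have h2 : q.α * Real.log a * 3 ≤ q.α * Real.log a * ((N - 1) * c / 2) :=
      mul_le_mul_of_nonneg_left hNc (by positivity)
    have h3 : devConst q + 2 * q.α * (1 + Real.log a)
        - q.α * c / 2 * ∑ i ∈ Finset.range m, 1 / ((a : ℝ) + i + 1) ≤ 0 := by linarith
    have := mul_nonpos_of_nonneg_of_nonpos hlam0 h3
    linarith
  have hexp1 := Real.exp_le_one_iff.2 hexp
  have e8 : Real.exp (-(2 * lam * δ)) = 1 / (n : ℝ) ^ 8 := by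
    rw [← exp_neg_mul_log_natCast hn 8]
    congr 1
    push_cast
    linarith
  have e4 : Real.exp (lam * δ + 1) = (n : ℝ) ^ 4 * Real.exp 1 := by
    rw [Real.exp_add, hlamδ, mul_comm 4, Real.exp_mul, Real.exp_log hn0]
    norm_cast
  have hb1 : M.P.real {ω | M.StaysClose δ₁ a m ω ∧ 2 * δ < nrm (M.dev n ω)}
      ≤ (1 + Real.exp 1) / (n : ℝ) ^ 3 := by
    refine hmain.trans ?_
    rw [e8, e4, mul_one_div, div_le_div_iff₀ (by positivity) hpow]
    have hm : (m : ℝ) ≤ n := by rw [hndef]; push_cast; linarith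
    have he := Real.exp_pos 1
    have h1 : (m : ℝ) * ((n : ℝ) ^ 4 * Real.exp 1) ≤ n * ((n : ℝ) ^ 4 * Real.exp 1) :=
      mul_le_mul_of_nonneg_right hm (by positivity)
    have h2 : (1 : ℝ) ≤ (n : ℝ) ^ 5 := one_le_pow₀ hn1
    calc _ ≤ ((n : ℝ) ^ 5 + n * ((n : ℝ) ^ 4 * Real.exp 1)) * (n : ℝ) ^ 3 :=
          mul_le_mul_of_nonneg_right (add_le_add (hexp1.trans h2) h1) hpow.le
      _ = _ := by ring
  have hb2 : M.P.real {ω | ¬ M.StaysClose δ₁ a m ω} ≤ C' * 2 ^ (4 * N) / (n : ℝ) ^ 3 := by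
    have hsub : {ω | ¬ M.StaysClose δ₁ a m ω}
        ⊆ ⋃ i ∈ Finset.range m, {ω | ¬ M.Close δ₁ (M.est (a + i) ω)} := by
      intro ω hω
      simpa [StaysClose] using hω
    have hterm : ∀ i ∈ Finset.range m, M.P.real {ω | ¬ M.Close δ₁ (M.est (a + i) ω)}
        ≤ C' / (a : ℝ) ^ (4 * N) := fun i _ => by
      refine (hclose M (a + i) (by omega)).trans ?_
      refine div_le_div_of_nonneg_left hC'.le (by positivity) ?_
      refine pow_le_pow_left₀ hapos.le ?_ _
      push_cast
      linarith [(Nat.cast_nonneg i : (0 : ℝ) ≤ i)]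
    have hpa : (n : ℝ) ^ 4 ≤ 2 ^ (4 * N) * (a : ℝ) ^ (4 * N) := by
      rw [← mul_pow, mul_comm 4 N, pow_mul]
      refine pow_le_pow_left₀ hn0.le ?_ 4
      have h1 : (n : ℝ) ≤ ((a : ℝ) + 1) ^ N := by exact_mod_cast han.le
      exact h1.trans (pow_le_pow_left₀ (by positivity) (by linarith) N)
    calc _ ≤ _ := measureReal_mono hsub (measure_ne_top _ _)
      _ ≤ _ := measureReal_biUnion_finset_le _ _
      _ ≤ ∑ _i ∈ Finset.range m, C' / (a : ℝ) ^ (4 * N) := Finset.sum_le_sum hterm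
      _ = m * C' / (a : ℝ) ^ (4 * N) := by simp [mul_div_assoc]
      _ ≤ _ := by
        rw [div_le_div_iff₀ (by positivity) hpow]
        have hm : (m : ℝ) ≤ n := by rw [hndef]; push_cast; linarith
        calc (m : ℝ) * C' * (n : ℝ) ^ 3 ≤ n * C' * (n : ℝ) ^ 3 := by gcongr
          _ = C' * (n : ℝ) ^ 4 := by ring
          _ ≤ C' * (2 ^ (4 * N) * (a : ℝ) ^ (4 * N)) := by gcongr
          _ = _ := by ring
  have hsub : {ω | 2 * δ < nrm (M.dev n ω)}
      ⊆ {ω | M.StaysClose δ₁ a m ω ∧ 2 * δ < nrm (M.dev n ω)}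
        ∪ {ω | ¬ M.StaysClose δ₁ a m ω} := by
    intro ω hω
    by_cases h : M.StaysClose δ₁ a m ω
    · exact Or.inl ⟨h, hω⟩
    · exact Or.inr h
  calc _ ≤ _ := measureReal_mono hsub (measure_ne_top _ _)
    _ ≤ _ := measureReal_union_le _ _
    _ ≤ _ := add_le_add hb1 hb2
    _ ≤ _ := by
      rw [← add_div]
      refine div_le_div_of_nonneg_right ?_ hpow.le
      have : (0 : ℝ) ≤ ((m₀ : ℝ) ^ N) ^ 3 := by positivity
      linarith

end Model

/-! ### Linear growth of the information -/

namespace Model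

variable {K d : ℕ} {q : Par K d} (M : Model q)

lemma measurableSet_nrm_dev_le (δ : ℝ) (n : ℕ) :
    MeasurableSet[M.past n] {ω | nrm (M.dev n ω) ≤ δ} :=
  (measurable_nrm.comp (M.measurable_dev n)) measurableSet_Iic

/-- In all but the forced periods, the decisions are informative about all alternatives once the
estimates are close to the truth. -/
lemma exists_informative (q : Par K d) : ∃ δ > 0, ∃ δ₁ > 0, ∀ (M : Model q) (k : Fin K) (i : ℕ),
    ¬ IsForced K q.a i →
      M.Informative k i {ω | nrm (M.dev i ω) ≤ 2 * δ ∧ M.Close δ₁ (M.est i ω)} := by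
  have hκ₁ := q.hκ₁
  have hκ₃ := q.hκ₃
  have hκ₆ := q.hκ₆
  have hκ₈ := q.hκ₈
  -- With this w, wrong decisions cost at most κ₈/2 of the restricted second moment; dual and
  -- regression errors share w.
  set w := q.κ₈ / (2 * q.κ₆ ^ 2 * ((K : ℝ) ^ 2 * q.κ₃ + 1 / q.κ₁)) with hw
  have hw0 : 0 < w := by positivity
  refine ⟨w / 8, by positivity, w / (4 * q.κ₆), by positivity, fun M k i hi => ⟨?_, ?_⟩⟩
  · exact (M.measurableSet_nrm_dev_le _ i).inter (M.measurableSet_close _ le_rfl)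
  · rintro ω ⟨h1, h2⟩ θ
    have hpol : ∀ x, M.policy i (M.est i ω) x = M.dec (M.est i ω) x := fun x => if_neg hi
    simp only [hpol]
    refine le_trans ?_ (M.moment_dec_ge k θ (M.measurable_dec_X (M.est i ω) 0))
    refine mul_le_mul_of_nonneg_right ?_ (sq_nonneg _)
    have h3 := M.prob_dec_ne_opt_le h2 hw0.le fun j l => by
      have h4 := sub_le_two_nrm (M.dev i ω) j l
      have h5 : 2 * q.κ₆ * (w / (4 * q.κ₆)) = w / 2 := by field_simp; ring
      rw [h5]
      change M.dev i ω j - M.dev i ω l + w / 2 ≤ w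
      linarith
    have h4 := mul_le_mul_of_nonneg_left h3 (sq_nonneg q.κ₆)
    have h5 : q.κ₆ ^ 2 * (((K : ℝ) ^ 2 * q.κ₃ + 1 / q.κ₁) * w) = q.κ₈ / 2 := by
      rw [hw]; field_simp
    linarith

/-- Unforced periods in the second half of the time are at least n/4 in number, and there the
estimates have already settled. Each period fails with probability O(n⁻³), hence some period with
O(n⁻²), and the design bound fails only exponentially rarely. -/
lemma prob_exists_quad_lt_le (q : Par K d) : ∃ c C : ℝ, 0 < c ∧ 0 < C ∧
    ∀ (M : Model q) (n : ℕ), 0 < n →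
      M.P.real {ω | ∃ k θ, M.quad n k θ ω < c * n * ‖θ‖ ^ 2} ≤ C / (n : ℝ) ^ 2 := by
  obtain ⟨δ, hδ, δ₁, hδ₁, hinf⟩ := exists_informative q
  obtain ⟨C₁, hC₁, h₁⟩ := prob_nrm_dev_gt_le q hδ
  obtain ⟨C₂, hC₂, h₂⟩ := prob_not_close_le q hδ₁ 3
  obtain ⟨C₃, c, hC₃, hc, h₃⟩ := prob_exists_quadOn_lt_le q
  obtain ⟨n₀, hn₀⟩ := eventually_atTop.1
    (eventually_card_forced_le (K := K) q.ha (by norm_num : (0 : ℝ) < 1 / 4))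
  set A := 64 * (C₁ + C₂) + K * (C₃ * (2 * (4 / c) ^ 2)) with hA
  have hA0 : 0 < A := by positivity
  refine ⟨c / 4, A + ((n₀ : ℝ) + 2) ^ 2, by positivity, by positivity, fun M n hn => ?_⟩
  have hn1 : (1 : ℝ) ≤ (n : ℝ) := by exact_mod_cast hn
  have hn0 : (0 : ℝ) < (n : ℝ) := by linarith
  have hpow : (0 : ℝ) < (n : ℝ) ^ 2 := by positivity
  rcases lt_or_ge n (n₀ + 2) with hlt | hge
  · refine measureReal_le_one.trans ?_
    rw [le_div_iff₀ hpow, one_mul]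
    have : (n : ℝ) ≤ (n₀ : ℝ) + 2 := by exact_mod_cast hlt.le
    have := pow_le_pow_left₀ hn0.le this 2
    linarith
  set J := (Finset.Ico (n / 2) n).filter fun i => ¬ IsForced K q.a i with hJ
  have hJsub : J ⊆ Finset.range n := fun i hi => by
    have := (Finset.mem_Ico.1 (Finset.mem_filter.1 hi).1).2
    exact Finset.mem_range.2 this
  have hJcard : (n : ℝ) / 4 ≤ J.card := by
    have h1 := hn₀ n (by omega)
    have h2 : (Finset.Ico (n / 2) n).card ≤ J.card
        + ((Finset.range n).filter fun i => IsForced K q.a i).card := by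
      rw [← Finset.card_filter_add_card_filter_not (s := Finset.Ico (n / 2) n)
        (fun i => IsForced K q.a i), add_comm]
      refine Nat.add_le_add_left (Finset.card_le_card fun i hi => ?_) _
      have := Finset.mem_filter.1 hi
      exact Finset.mem_filter.2 ⟨Finset.mem_range.2 (Finset.mem_Ico.1 this.1).2, this.2⟩
    rw [Nat.card_Ico] at h2
    have h3 : n ≤ 2 * (J.card
        + ((Finset.range n).filter fun i => IsForced K q.a i).card) := by omega
    have h4 : (n : ℝ) ≤ 2 * ((J.card : ℝ)
        + (((Finset.range n).filter fun i => IsForced K q.a i).card : ℝ)) := by exact_mod_cast h3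
    linarith
  have hJle : (J.card : ℝ) ≤ n := by
    have := Finset.card_le_card hJsub
    rw [Finset.card_range] at this
    exact_mod_cast this
  set G : ℕ → Set M.Ω := fun i => {ω | nrm (M.dev i ω) ≤ 2 * δ ∧ M.Close δ₁ (M.est i ω)} with hG
  have hsub : {ω | ∃ k θ, M.quad n k θ ω < c / 4 * n * ‖θ‖ ^ 2}
      ⊆ (⋃ i ∈ J, ({ω | 2 * δ < nrm (M.dev i ω)} ∪ {ω | ¬ M.Close δ₁ (M.est i ω)}))
        ∪ ⋃ k ∈ (Finset.univ : Finset (Fin K)),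
          {ω | (∀ i ∈ J, ω ∈ G i) ∧ ∃ θ, M.quadOn J k θ ω < c * J.card * ‖θ‖ ^ 2} := by
    rintro ω ⟨k, θ, h⟩
    by_cases hall : ∀ i ∈ J, ω ∈ G i
    · right
      simp only [Set.mem_iUnion, Finset.mem_univ, exists_prop, true_and]
      refine ⟨k, hall, θ, (M.quadOn_le_quad hJsub k θ ω).trans_lt (h.trans_le ?_)⟩
      refine mul_le_mul_of_nonneg_right ?_ (sq_nonneg _)
      have := mul_le_mul_of_nonneg_left hJcard hc.le
      linarith
    · left
      push Not at hall
      obtain ⟨i, hi, hiG⟩ := hall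
      simp only [Set.mem_iUnion, exists_prop]
      refine ⟨i, hi, ?_⟩
      by_contra hcon
      simp only [Set.mem_union, Set.mem_ofPred_eq, not_or, not_lt, not_not] at hcon
      exact hiG hcon
  have hb1 : ∀ i ∈ J, M.P.real ({ω | 2 * δ < nrm (M.dev i ω)} ∪ {ω | ¬ M.Close δ₁ (M.est i ω)})
      ≤ 64 * (C₁ + C₂) / (n : ℝ) ^ 3 := by
    intro i hi
    have hi2 := (Finset.mem_Ico.1 (Finset.mem_filter.1 hi).1).1
    have hi0 : 0 < i := by omega
    have hi4 : (n : ℝ) ≤ 4 * i := by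
      have : n ≤ 4 * i := by omega
      exact_mod_cast this
    have hiR : (0 : ℝ) < i := by exact_mod_cast hi0
    refine (measureReal_union_le _ _).trans ((add_le_add (h₁ M i hi0) (h₂ M i hi0)).trans ?_)
    rw [← add_div, div_le_div_iff₀ (by positivity) (by positivity)]
    have := pow_le_pow_left₀ hn0.le hi4 3
    calc (C₁ + C₂) * (n : ℝ) ^ 3 ≤ (C₁ + C₂) * (4 * i) ^ 3 := by gcongr
      _ = _ := by ring
  have hb2 : ∀ k, M.P.real {ω | (∀ i ∈ J, ω ∈ G i)
        ∧ ∃ θ, M.quadOn J k θ ω < c * J.card * ‖θ‖ ^ 2}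
      ≤ C₃ * (2 * (4 / c) ^ 2) / (n : ℝ) ^ 2 := by
    intro k
    refine (h₃ M k J G fun i hi => hinf M k i (Finset.mem_filter.1 hi).2).trans ?_
    rw [mul_div_assoc]
    refine mul_le_mul_of_nonneg_left ?_ hC₃.le
    set x := c / 4 * n with hx
    have hx0 : 0 < x := by positivity
    have h1 : Real.exp (-(c * J.card)) ≤ Real.exp (-x) := by
      refine Real.exp_le_exp.2 (neg_le_neg ?_)
      have := mul_le_mul_of_nonneg_left hJcard hc.le
      linarith
    refine h1.trans ?_
    have h2 := Real.quadratic_le_exp_of_nonneg hx0.le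
    have h3 : x ^ 2 / 2 ≤ Real.exp x := by linarith
    have e : 2 * (4 / c) ^ 2 / (n : ℝ) ^ 2 = 1 / (x ^ 2 / 2) := by
      rw [hx]; field_simp
    rw [e, Real.exp_neg, ← one_div]
    exact one_div_le_one_div_of_le (by positivity) h3
  calc _ ≤ _ := measureReal_mono hsub (measure_ne_top _ _)
    _ ≤ _ := measureReal_union_le _ _
    _ ≤ (∑ i ∈ J, 64 * (C₁ + C₂) / (n : ℝ) ^ 3)
        + ∑ k : Fin K, C₃ * (2 * (4 / c) ^ 2) / (n : ℝ) ^ 2 :=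
      add_le_add ((measureReal_biUnion_finset_le _ _).trans (Finset.sum_le_sum hb1))
        ((measureReal_biUnion_finset_le _ _).trans (Finset.sum_le_sum fun k _ => hb2 k))
    _ = J.card * (64 * (C₁ + C₂) / (n : ℝ) ^ 3) + K * (C₃ * (2 * (4 / c) ^ 2) / (n : ℝ) ^ 2) := by
      simp
    _ ≤ n * (64 * (C₁ + C₂) / (n : ℝ) ^ 3) + K * (C₃ * (2 * (4 / c) ^ 2) / (n : ℝ) ^ 2) := by
      gcongr
    _ = A / (n : ℝ) ^ 2 := by rw [hA]; field_simp
    _ ≤ _ := by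
      refine div_le_div_of_nonneg_right ?_ hpow.le
      have : 0 ≤ ((n₀ : ℝ) + 2) ^ 2 := by positivity
      linarith

end Model

/-! ### Rates of convergence -/

lemma ridgeParam_nonneg (n : ℕ) : 0 ≤ ridgeParam n := by
  have := pow_nonneg (Real.log_natCast_nonneg n) 3
  unfold ridgeParam
  linarith

lemma log_sq_le {n : ℕ} (hn : 0 < n) : (1 + Real.log n) ^ 2 ≤ 9 * n := by
  have hn1 : (1 : ℝ) ≤ (n : ℝ) := by exact_mod_cast hn
  have hl := Real.log_natCast_nonneg n
  have h1 := Real.log_le_rpow_div (x := (n : ℝ)) (by positivity) (ε := 1 / 2) (by norm_num)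
  rw [← Real.sqrt_eq_rpow] at h1
  have h2 : 1 ≤ √(n : ℝ) := Real.one_le_sqrt.2 hn1
  have h3 : 1 + Real.log n ≤ 3 * √(n : ℝ) := by linarith
  have := pow_le_pow_left₀ (by linarith) h3 2
  rwa [mul_pow, Real.sq_sqrt (by positivity), (by norm_num : (3 : ℝ) ^ 2 = 9)] at this

/-- The ridge bias is O(√n), no larger than the noise sum, so regularisation does not spoil the
rate. Here 217 = 1 + 6³, from log n ≤ 6n^(1/6). -/
lemma ridgeParam_sq_le {n : ℕ} (hn : 0 < n) : ridgeParam n ^ 2 ≤ 217 ^ 2 * n := by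
  have hn1 : (1 : ℝ) ≤ (n : ℝ) := by exact_mod_cast hn
  have hl := Real.log_natCast_nonneg n
  have h1 := Real.log_le_rpow_div (x := (n : ℝ)) (by positivity) (ε := 1 / 6) (by norm_num)
  have h2 : (((n : ℝ) ^ ((1 : ℝ) / 6)) ^ 3) = √(n : ℝ) := by
    rw [← Real.rpow_natCast, ← Real.rpow_mul (by positivity), Real.sqrt_eq_rpow]
    norm_num
  have h3 : Real.log n ^ 3 ≤ 216 * √(n : ℝ) := by
    have h4 : Real.log n ≤ 6 * (n : ℝ) ^ ((1 : ℝ) / 6) := by linarith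
    have := pow_le_pow_left₀ hl h4 3
    rwa [mul_pow, h2, (by norm_num : (6 : ℝ) ^ 3 = 216)] at this
  have h4 : 1 ≤ √(n : ℝ) := Real.one_le_sqrt.2 hn1
  have h5 : ridgeParam n ≤ 217 * √(n : ℝ) := by unfold ridgeParam; linarith
  have := pow_le_pow_left₀ (ridgeParam_nonneg n) h5 2
  rwa [mul_pow, Real.sq_sqrt (by positivity)] at this

namespace Model

variable {K d : ℕ} {q : Par K d} (M : Model q)

/-- The Euclidean norm of the matrix of the errors of the regression coefficients. -/
def errNrm (s : (Fin K → ℝ) × (Fin K → EuclideanSpace ℝ (Fin d))) : ℝ :=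
  Real.sqrt (∑ k, ‖s.2 k - M.β k‖ ^ 2)

lemma errNrm_nonneg (s : (Fin K → ℝ) × (Fin K → EuclideanSpace ℝ (Fin d))) :
    0 ≤ M.errNrm s := Real.sqrt_nonneg _

lemma sq_errNrm (s : (Fin K → ℝ) × (Fin K → EuclideanSpace ℝ (Fin d))) :
    M.errNrm s ^ 2 = ∑ k, ‖s.2 k - M.β k‖ ^ 2 :=
  Real.sq_sqrt (Finset.sum_nonneg fun _ _ => sq_nonneg _)

lemma close_errNrm (s : (Fin K → ℝ) × (Fin K → EuclideanSpace ℝ (Fin d))) :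
    M.Close (M.errNrm s) s := fun k => by
  refine le_of_sq_le_sq ?_ (M.errNrm_nonneg s)
  rw [sq_errNrm]
  exact Finset.single_le_sum (f := fun k => ‖s.2 k - M.β k‖ ^ 2) (fun k _ => sq_nonneg _)
    (Finset.mem_univ k)

lemma errNrm_le {δ : ℝ} (hδ : 0 ≤ δ) {s : (Fin K → ℝ) × (Fin K → EuclideanSpace ℝ (Fin d))}
    (hs : M.Close δ s) : M.errNrm s ≤ K * δ := by
  refine le_of_sq_le_sq ?_ (by positivity)
  rw [sq_errNrm]
  calc ∑ k, ‖s.2 k - M.β k‖ ^ 2 ≤ ∑ _k : Fin K, δ ^ 2 :=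
        Finset.sum_le_sum fun k _ => pow_le_pow_left₀ (norm_nonneg _) (hs k) 2
    _ = K * δ ^ 2 := by simp
    _ ≤ (K * δ) ^ 2 := by
        rw [mul_pow]
        refine mul_le_mul_of_nonneg_right ?_ (by positivity)
        exact_mod_cast Nat.le_self_pow (by norm_num) K

lemma measurable_errNrm : Measurable M.errNrm := by
  unfold errNrm
  refine Measurable.sqrt (Finset.measurable_sum _ fun k _ => ?_)
  exact ((((measurable_pi_apply k).comp measurable_snd).sub measurable_const).norm).pow_const 2

/-- The estimates are close to the truth, and the regression errors are bounded in terms of the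
noise at the rate of a nondegenerate regression. -/
def Good (η c : ℝ) (n : ℕ) (ω : M.Ω) : Prop :=
  nrm (M.dev n ω) ≤ η ∧ M.Close η (M.est n ω) ∧
    ∀ k, ‖M.err n k ω‖ * (c * n) ≤ ‖M.noiseSum n k ω‖ + ridgeParam n * q.R

lemma measurableSet_good (η c : ℝ) (n : ℕ) : MeasurableSet {ω | M.Good η c n ω} := by
  have h1 := M.past_le n _ (M.measurableSet_nrm_dev_le η n)
  have h2 := M.past_le n _ (M.measurableSet_close η (le_refl n))
  have h3 : MeasurableSet (⋂ k, {ω | ‖M.err n k ω‖ * (c * n)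
      ≤ ‖M.noiseSum n k ω‖ + ridgeParam n * q.R}) := by
    refine MeasurableSet.iInter fun k => ?_
    have h4 : Measurable (M.err n k) := (M.measurable_err n k).mono (M.past_le n) le_rfl
    have h5 : Measurable (M.noiseSum n k) := (M.measurable_noiseSum n k).mono (M.past_le n) le_rfl
    exact measurableSet_le (h4.norm.mul_const _) (h5.norm.add_const _)
  have : {ω | M.Good η c n ω} = {ω | nrm (M.dev n ω) ≤ η} ∩ ({ω | M.Close η (M.est n ω)}
      ∩ ⋂ k, {ω | ‖M.err n k ω‖ * (c * n) ≤ ‖M.noiseSum n k ω‖ + ridgeParam n * q.R}) := by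
    ext ω; simp [Good]
  rw [this]
  exact h1.inter (h2.inter h3)

lemma norm_err_mul_le {n : ℕ} (hn : 0 < n) {k : Fin K} {ω : M.Ω} {x : ℝ}
    (h : x * ‖M.err n k ω‖ ^ 2 ≤ M.quad n k (M.err n k ω) ω) :
    ‖M.err n k ω‖ * x ≤ ‖M.noiseSum n k ω‖ + ridgeParam n * q.R := by
  obtain ⟨l, rfl⟩ : ∃ l, n = l + 1 := ⟨n - 1, by omega⟩
  have hid := M.err_identity l k ω
  set e := M.err (l + 1) k ω
  set S := M.noiseSum (l + 1) k ω
  set ρ := ridgeParam (l + 1)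
  have hρ : 0 ≤ ρ := ridgeParam_nonneg _
  have hR := q.hR
  rcases (norm_nonneg e).eq_or_lt with he | he
  · rw [← he, zero_mul]; positivity
  have h1 : (inner ℝ e S : ℝ) ≤ ‖e‖ * ‖S‖ := real_inner_le_norm _ _
  have hβ : |(inner ℝ e (M.β k) : ℝ)| ≤ ‖e‖ * q.R :=
    (abs_real_inner_le_norm _ _).trans (mul_le_mul_of_nonneg_left (M.hβ k) (norm_nonneg _))
  have h2 := mul_le_mul_of_nonneg_left (abs_le.1 hβ).1 hρ
  have h3 : 0 ≤ ρ * ‖e‖ ^ 2 := by positivity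
  have h4 : ‖e‖ * (‖e‖ * x) ≤ ‖e‖ * (‖S‖ + ρ * q.R) := by linarith
  exact le_of_mul_le_mul_left h4 he

/-- The information constant c precedes η: the closeness required differs between the recursion and
the final estimate, whereas the rate of the information does not. -/
lemma prob_not_good_le (q : Par K d) : ∃ c : ℝ, 0 < c ∧ ∀ η : ℝ, 0 < η → ∃ C : ℝ, 0 < C ∧
    ∀ (M : Model q) (n : ℕ), 0 < n →
      M.P.real {ω | ¬ M.Good η c n ω} ≤ C / (n : ℝ) ^ 2 := by
  obtain ⟨c, C₃, hc, hC₃, h₃⟩ := prob_exists_quad_lt_le q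
  refine ⟨c, hc, fun η hη => ?_⟩
  obtain ⟨C₁, hC₁, h₁⟩ := prob_nrm_dev_gt_le q (half_pos hη)
  obtain ⟨C₂, hC₂, h₂⟩ := prob_not_close_le q hη 2
  refine ⟨C₁ + C₂ + C₃, by positivity, fun M n hn => ?_⟩
  have hn1 : (1 : ℝ) ≤ (n : ℝ) := by exact_mod_cast hn
  have hsub : {ω | ¬ M.Good η c n ω} ⊆ ({ω | 2 * (η / 2) < nrm (M.dev n ω)}
      ∪ {ω | ¬ M.Close η (M.est n ω)}) ∪ {ω | ∃ k θ, M.quad n k θ ω < c * n * ‖θ‖ ^ 2} := by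
    intro ω hω
    by_contra hcon
    simp only [Set.mem_union, Set.mem_ofPred_eq, not_or, not_lt, not_not, not_exists] at hcon
    refine hω ⟨by linarith [hcon.1.1], hcon.1.2, fun k => ?_⟩
    exact M.norm_err_mul_le hn (hcon.2 k _)
  calc _ ≤ _ := measureReal_mono hsub (measure_ne_top _ _)
    _ ≤ _ := (measureReal_union_le _ _).trans (add_le_add_left (measureReal_union_le _ _) _)
    _ ≤ C₁ / (n : ℝ) ^ 2 + C₂ / (n : ℝ) ^ 2 + C₃ / (n : ℝ) ^ 2 := by
      refine add_le_add (add_le_add ((h₁ M n hn).trans ?_) (h₂ M n hn)) (h₃ M n hn)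
      exact div_le_div_of_nonneg_left hC₁.le (by positivity)
        (pow_le_pow_right₀ hn1 (by norm_num))
    _ = _ := by ring

/-- The squared error of the regression coefficients on the good event. -/
def goodSqErr (η c : ℝ) (n : ℕ) (ω : M.Ω) : ℝ :=
  if M.Good η c n ω then M.errNrm (M.est n ω) ^ 2 else 0

lemma goodSqErr_nonneg (η c : ℝ) (n : ℕ) (ω : M.Ω) : 0 ≤ M.goodSqErr η c n ω := by
  unfold goodSqErr
  split_ifs <;> positivity

lemma measurable_est_amb (n : ℕ) : Measurable (M.est n) :=
  (M.measurable_est n).mono (M.past_le n) le_rfl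

lemma integrable_goodSqErr {η : ℝ} (hη : 0 ≤ η) (c : ℝ) (n : ℕ) :
    Integrable (M.goodSqErr η c n) M.P := by
  have hm : Measurable (M.goodSqErr η c n) :=
    Measurable.ite (M.measurableSet_good η c n)
      ((M.measurable_errNrm.comp (M.measurable_est_amb n)).pow_const 2) measurable_const
  refine Integrable.of_bound hm.aestronglyMeasurable ((K * η) ^ 2)
    (Eventually.of_forall fun ω => ?_)
  rw [Real.norm_eq_abs, abs_of_nonneg (M.goodSqErr_nonneg η c n ω)]
  unfold goodSqErr
  split_ifs with h
  · exact pow_le_pow_left₀ (M.errNrm_nonneg _) (M.errNrm_le hη h.2.1) 2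
  · positivity

/-- On the good event ‖e‖ ≤ (‖S‖ + ρR)/(cn), and both terms of the numerator have second moment
O(n). -/
lemma integral_goodSqErr_le {η c : ℝ} (hη : 0 ≤ η) (hc : 0 < c) {n : ℕ} (hn : 0 < n) :
    ∫ ω, M.goodSqErr η c n ω ∂M.P
      ≤ (K * (2 * (noiseConst q + 217 ^ 2 * q.R ^ 2) / c ^ 2)) / n := by
  have hn0 : (0 : ℝ) < (n : ℝ) := by exact_mod_cast hn
  have hi : ∀ k, Integrable (fun ω => 2 * (‖M.noiseSum n k ω‖ ^ 2 + (ridgeParam n * q.R) ^ 2)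
      / (c * n) ^ 2) M.P := fun k =>
    (((M.integrable_norm_noiseSum_sq hn k).1.add (integrable_const _)).const_mul 2).div_const _
  calc _ ≤ ∫ ω, ∑ k, 2 * (‖M.noiseSum n k ω‖ ^ 2 + (ridgeParam n * q.R) ^ 2)
        / (c * n) ^ 2 ∂M.P := by
        refine integral_mono (M.integrable_goodSqErr hη c n)
          (integrable_finsetSum _ fun k _ => hi k) fun ω => ?_
        simp only [goodSqErr]
        split_ifs with h
        · rw [sq_errNrm]
          refine Finset.sum_le_sum fun k _ => ?_
          rw [le_div_iff₀ (by positivity), ← mul_pow]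
          have h1 := pow_le_pow_left₀ (by positivity) (h.2.2 k) 2
          refine h1.trans ?_
          linarith [sq_nonneg (‖M.noiseSum n k ω‖ - ridgeParam n * q.R)]
        · positivity
    _ = ∑ k, 2 * ((∫ ω, ‖M.noiseSum n k ω‖ ^ 2 ∂M.P) + (ridgeParam n * q.R) ^ 2)
        / (c * n) ^ 2 := by
        rw [integral_finsetSum _ fun k _ => hi k]
        refine Finset.sum_congr rfl fun k _ => ?_
        rw [integral_div, integral_const_mul,
          integral_add (M.integrable_norm_noiseSum_sq hn k).1 (integrable_const _)]
        simp
    _ ≤ ∑ _k : Fin K, 2 * (noiseConst q * n + 217 ^ 2 * n * q.R ^ 2) / (c * n) ^ 2 := by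
        refine Finset.sum_le_sum fun k _ => ?_
        rw [mul_pow]
        have h1 := (M.integrable_norm_noiseSum_sq hn k).2
        have h2 := ridgeParam_sq_le hn
        gcongr
    _ = _ := by
        rw [Finset.sum_const, Finset.card_univ, Fintype.card_fin, nsmul_eq_mul]
        field_simp

/-! ### Mean square recursion for the dual vector -/

/-- A deterministic bound for the deviation of the dual vector. -/
def devBound (q : Par K d) (n : ℕ) : ℝ := devConst q + 2 * q.α * (1 + Real.log n)

lemma devBound_nonneg (q : Par K d) (n : ℕ) : 0 ≤ devBound q n := by
  have h1 := devConst_nonneg q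
  have h2 := Real.log_natCast_nonneg n
  have h3 := q.hα
  unfold devBound
  positivity

lemma devBound_sq_le (q : Par K d) {n : ℕ} (hn : 0 < n) :
    devBound q n ^ 2 ≤ 9 * (devConst q + 2 * q.α) ^ 2 * n := by
  have h1 := devConst_nonneg q
  have h2 := Real.log_natCast_nonneg n
  have h3 := q.hα
  have h4 : devBound q n ≤ (devConst q + 2 * q.α) * (1 + Real.log n) := by
    unfold devBound
    have := mul_nonneg h1 h2
    linarith
  have h5 := pow_le_pow_left₀ (devBound_nonneg q n) h4 2
  rw [mul_pow] at h5
  have h6 := mul_le_mul_of_nonneg_left (log_sq_le hn) (sq_nonneg (devConst q + 2 * q.α))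
  linarith

lemma measurable_nrm_dev (n : ℕ) : Measurable fun ω => nrm (M.dev n ω) :=
  measurable_nrm.comp ((M.measurable_dev n).mono (M.past_le n) le_rfl)

lemma integrable_nrm_dev_sq (n : ℕ) : Integrable (fun ω => nrm (M.dev n ω) ^ 2) M.P := by
  refine Integrable.of_bound ((M.measurable_nrm_dev n).pow_const 2).aestronglyMeasurable
    (devBound q n ^ 2) (Eventually.of_forall fun ω => ?_)
  rw [Real.norm_eq_abs, abs_of_nonneg (sq_nonneg _)]
  exact pow_le_pow_left₀ (nrm_nonneg _) (M.nrm_dev_le n ω) 2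

/-- Local strong monotonicity on the good event; off it only the trivial bound -2|h| holds, and the
indicator term, through 2|h| ≤ 1 + |h|² and the sure bound on |h|, restores the inequality. -/
lemma drift_dev_ge {η c : ℝ} (hη : 0 < η)
    (hη1 : 2 * η + 2 * q.κ₆ * (K * η) < min q.κ₁ q.κ₄) (n : ℕ) (ω : M.Ω) :
    q.κ₂ * q.κ₅ * nrm (M.dev n ω) ^ 2
        - (K : ℝ) ^ 2 * (2 * q.κ₂ * q.κ₅ + q.κ₃) * (2 * q.κ₆) ^ 2 * M.goodSqErr η c n ω
        - {ω | ¬ M.Good η c n ω}.indicator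
            (fun _ => 2 + (1 + q.κ₂ * q.κ₅) * devBound q n ^ 2) ω
      ≤ ∫ ω', (M.dev n ω (M.dec (M.est n ω) (M.X 0 ω'))
          - ∑ k, M.p k * M.dev n ω k) ∂M.P := by
  have hκ₂ := q.hκ₂
  have hκ₃ := q.hκ₃
  have hκ₅ := q.hκ₅
  have hκ₆ := q.hκ₆
  have hK : (0 : ℝ) ≤ K := Nat.cast_nonneg K
  have hmeas := M.measurable_dec_X (M.est n ω) 0
  have h0 := nrm_nonneg (M.dev n ω)
  have hL := M.nrm_dev_le n ω
  have hL0 := devBound_nonneg q n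
  change nrm (M.dev n ω) ≤ devBound q n at hL
  by_cases hG : M.Good η c n ω
  · have hmin := lt_min_iff.1 hη1
    have hδ := M.errNrm_le hη.le hG.2.1
    have hδ' : 2 * q.κ₆ * M.errNrm (M.est n ω) ≤ 2 * q.κ₆ * (K * η) :=
      mul_le_mul_of_nonneg_left hδ (by positivity)
    have hp : 0 ≤ 2 * q.κ₆ * (K * η) := by positivity
    have h1 := M.drift_ge_local (M.errNrm_nonneg _) (M.close_errNrm (M.est n ω)) (M.sum_dev n ω)
      (w := 2 * η) (fun j k => (sub_le_two_nrm (M.dev n ω) j k).trans (by linarith [hG.1]))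
      (by linarith) (by linarith) (by linarith)
    have e : ∫ ω', (M.dev n ω (M.dec (M.est n ω) (M.X 0 ω')) - ∑ k, M.p k * M.dev n ω k) ∂M.P
        = ∫ ω', (M.shiftDev (M.est n ω).1 (M.dec (M.est n ω) (M.X 0 ω'))
          - M.shiftDev (M.est n ω).1 (M.opt (M.X 0 ω'))) ∂M.P := by
      rw [integral_sub (integrable_comp_fin _ hmeas) (integrable_const _),
        integral_sub (integrable_comp_fin _ hmeas)
          (integrable_comp_fin _ (M.measurable_opt_X 0)), M.p_dot_eq (M.dev n ω)]
      simp only [integral_const, probReal_univ, smul_eq_mul, one_mul]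
      rfl
    rw [e]
    refine le_trans ?_ h1
    have hn : ω ∉ {ω | ¬ M.Good η c n ω} := fun h => h hG
    rw [Set.indicator_of_notMem hn, goodSqErr, if_pos hG, sq_nrm]
    have e2 : ∀ k, M.dev n ω k = M.shiftDev (M.est n ω).1 k := fun k => rfl
    simp only [e2]
    rw [mul_pow _ (M.errNrm _)]
    linarith
  · have hn : ω ∈ {ω | ¬ M.Good η c n ω} := hG
    rw [Set.indicator_of_mem hn, goodSqErr, if_neg hG]
    have h1 : -(2 * nrm (M.dev n ω)) ≤ ∫ ω', (M.dev n ω (M.dec (M.est n ω) (M.X 0 ω'))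
        - ∑ k, M.p k * M.dev n ω k) ∂M.P := by
      calc -(2 * nrm (M.dev n ω)) = ∫ _, -(2 * nrm (M.dev n ω)) ∂M.P := by simp
        _ ≤ _ := integral_mono (integrable_const _)
          ((integrable_comp_fin _ hmeas).sub (integrable_const _)) fun ω' =>
            (abs_le.1 (abs_sub_sum_le M.data.p_mem (M.dev n ω) _)).1
    refine le_trans ?_ h1
    have h2 := pow_le_pow_left₀ h0 hL 2
    have h3 := mul_le_mul_of_nonneg_left h2 (by positivity : 0 ≤ 1 + q.κ₂ * q.κ₅)
    nlinarith [sq_nonneg (nrm (M.dev n ω) - 1)]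

lemma integral_nrm_dev_succ_sq_le (n : ℕ) :
    ∫ ω, nrm (M.dev (n + 1) ω) ^ 2 ∂M.P ≤ ∫ ω, nrm (M.dev n ω) ^ 2 ∂M.P
      - 2 * (q.α / (n + 1)) * (∫ ω, ∫ ω', (M.dev n ω (M.dec (M.est n ω) (M.X 0 ω'))
          - ∑ k, M.p k * M.dev n ω k) ∂M.P ∂M.P) + 2 * (q.α / (n + 1)) ^ 2 ∧
    Integrable (fun ω => ∫ ω', (M.dev n ω (M.dec (M.est n ω) (M.X 0 ω'))
          - ∑ k, M.p k * M.dev n ω k) ∂M.P) M.P := by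
  set t := q.α / ((n : ℝ) + 1) with ht
  set f : ((Fin K → ℝ) × (Fin K → EuclideanSpace ℝ (Fin d))) →
      EuclideanSpace ℝ (Fin d) × (Fin K → ℝ) → ℝ := fun s o =>
    M.shiftDev s.1 (M.dec s o.1) - ∑ k, M.p k * M.shiftDev s.1 k with hf
  have hev : Measurable (Function.uncurry fun (v : Fin K → ℝ) (j : Fin K) => v j) :=
    measurable_from_prod_countable_left fun j => measurable_pi_apply j
  have hfm : Measurable (Function.uncurry f) := by
    have h1 : Measurable fun z : ((Fin K → ℝ) × (Fin K → EuclideanSpace ℝ (Fin d)))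
        × (EuclideanSpace ℝ (Fin d) × (Fin K → ℝ)) => M.shiftDev z.1.1 :=
      M.measurable_shiftDev.comp (measurable_fst.comp measurable_fst)
    have h2 : Measurable fun z : ((Fin K → ℝ) × (Fin K → EuclideanSpace ℝ (Fin d)))
        × (EuclideanSpace ℝ (Fin d) × (Fin K → ℝ)) => M.dec z.1 z.2.1 :=
      measurable_comp₂ M.measurable_dec measurable_fst (measurable_fst.comp measurable_snd)
    exact (measurable_comp₂ hev h1 h2).sub (Finset.measurable_sum _ fun k _ =>
      ((measurable_pi_apply k).comp h1).const_mul _)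
  have hi : Integrable (fun ω => f (M.est n ω) (M.obs n ω)) M.P := by
    have h1 : Measurable fun ω => f (M.est n ω) (M.obs n ω) :=
      hfm.comp ((M.measurable_est_amb n).prodMk (M.measurable_obs n))
    refine Integrable.of_bound h1.aestronglyMeasurable (2 * devBound q n)
      (Eventually.of_forall fun ω => ?_)
    rw [Real.norm_eq_abs]
    refine (abs_sub_sum_le M.data.p_mem (M.dev n ω) _).trans ?_
    have := M.nrm_dev_le n ω
    change nrm (M.dev n ω) ≤ devBound q n at this
    linarith
  obtain ⟨h1, h2⟩ := M.integral_step (M.measurable_est n) hfm hi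
  refine ⟨?_, h1⟩
  have h3 : ∫ ω, nrm (M.dev (n + 1) ω) ^ 2 ∂M.P ≤ ∫ ω, (nrm (M.dev n ω) ^ 2
      - 2 * t * f (M.est n ω) (M.obs n ω) + 2 * t ^ 2) ∂M.P := by
    refine integral_mono (M.integrable_nrm_dev_sq (n + 1))
      (((M.integrable_nrm_dev_sq n).sub (hi.const_mul _)).add (integrable_const _)) fun ω => ?_
    simp only [dev_succ]
    exact sum_upd_sq_le M.data.p_mem t (M.dev n ω) _
  refine h3.trans (le_of_eq ?_)
  have h4 : Integrable (fun ω => nrm (M.dev n ω) ^ 2 - 2 * t * f (M.est n ω) (M.obs n ω)) M.P :=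
    (M.integrable_nrm_dev_sq n).sub (hi.const_mul _)
  rw [integral_add h4 (integrable_const _),
    integral_sub (M.integrable_nrm_dev_sq n) (hi.const_mul _), integral_const_mul, h2]
  simp only [integral_const, probReal_univ, smul_eq_mul, one_mul]
  rfl

/-- The claim B/n reproduces itself because (1 - 2/(n+1))/n + 1/(n+1)² ≤ 1/(n+1). The contraction
factor vanishes at n = 1, so it is nonnegative throughout. -/
lemma le_div_of_recursion {u : ℕ → ℝ} {B : ℝ} (h1 : u 1 ≤ B)
    (h : ∀ n : ℕ, 0 < n → u (n + 1) ≤ (1 - 2 / ((n : ℝ) + 1)) * u n + B / ((n : ℝ) + 1) ^ 2)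
    (hB : 0 ≤ B) (n : ℕ) (hn : 0 < n) : u n ≤ B / n := by
  induction n, hn using Nat.le_induction with
  | base => simpa using h1
  | succ n hn ih =>
    have hn1 : (1 : ℝ) ≤ (n : ℝ) := by exact_mod_cast hn
    refine (h n hn).trans ?_
    have h2 : 0 ≤ 1 - 2 / ((n : ℝ) + 1) := by
      rw [sub_nonneg, div_le_one (by positivity)]; linarith
    have h3 := mul_le_mul_of_nonneg_left ih h2
    refine (add_le_add_left h3 _).trans ?_
    push_cast
    have e : (1 - 2 / ((n : ℝ) + 1)) * (B / n) + B / ((n : ℝ) + 1) ^ 2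
        = B / ((n : ℝ) + 1) - B / (n * ((n : ℝ) + 1) ^ 2) := by
      field_simp; ring
    rw [e]
    have : 0 ≤ B / (n * ((n : ℝ) + 1) ^ 2) := by positivity
    linarith

/-- The mean squared deviation of the dual vector decays like `1 / n`. -/
lemma integral_nrm_dev_sq_le (q : Par K d) : ∃ B : ℝ, 0 ≤ B ∧ ∀ (M : Model q) (n : ℕ), 0 < n →
    ∫ ω, nrm (M.dev n ω) ^ 2 ∂M.P ≤ B / n := by
  have hα := q.hα
  have hα' := q.hα'
  have hκ₁ := q.hκ₁
  have hκ₂ := q.hκ₂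
  have hκ₃ := q.hκ₃
  have hκ₄ := q.hκ₄
  have hκ₅ := q.hκ₅
  have hκ₆ := q.hκ₆
  have hR := q.hR
  have hnc := noiseConst_nonneg q
  have hdc := devConst_nonneg q
  obtain ⟨c, hc, hgood⟩ := prob_not_good_le q
  set η := min q.κ₁ q.κ₄ / (4 * (1 + q.κ₆ * K)) with hη
  have hη0 : 0 < η := by positivity
  have hη1 : 2 * η + 2 * q.κ₆ * (K * η) < min q.κ₁ q.κ₄ := by
    have e : 2 * η + 2 * q.κ₆ * (K * η) = min q.κ₁ q.κ₄ / 2 := by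
      rw [hη]; field_simp; ring
    have : 0 < min q.κ₁ q.κ₄ := lt_min hκ₁ hκ₄
    linarith
  obtain ⟨C, hC, hCle⟩ := hgood η hη0
  set A₁ := (K : ℝ) ^ 2 * (2 * q.κ₂ * q.κ₅ + q.κ₃) * (2 * q.κ₆) ^ 2 with hA₁
  set A₂ := K * (2 * (noiseConst q + 217 ^ 2 * q.R ^ 2) / c ^ 2) with hA₂
  set A₃ := 2 + (1 + q.κ₂ * q.κ₅) * (9 * (devConst q + 2 * q.α) ^ 2) with hA₃
  have hA₁0 : 0 ≤ A₁ := by positivity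
  have hA₂0 : 0 ≤ A₂ := by positivity
  have hA₃0 : 0 ≤ A₃ := by positivity
  set B₀ := A₁ * A₂ + A₃ * C with hB₀
  set B := 4 * q.α * B₀ + 2 * q.α ^ 2 + devBound q 1 ^ 2 with hB
  have hB0 : 0 ≤ B := by positivity
  refine ⟨B, hB0, fun M n hn => le_div_of_recursion (u := fun n => ∫ ω, nrm (M.dev n ω) ^ 2 ∂M.P)
    ?_ ?_ hB0 n hn⟩
  · calc _ ≤ ∫ _, devBound q 1 ^ 2 ∂M.P := integral_mono (M.integrable_nrm_dev_sq 1)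
          (integrable_const _) fun ω => pow_le_pow_left₀ (nrm_nonneg _) (M.nrm_dev_le 1 ω) 2
      _ = devBound q 1 ^ 2 := by simp
      _ ≤ B := by
        rw [hB]
        have : 0 ≤ 4 * q.α * B₀ + 2 * q.α ^ 2 := by positivity
        linarith
  · clear n hn
    intro n hn
    have hn1 : (1 : ℝ) ≤ (n : ℝ) := by exact_mod_cast hn
    have hn0 : (0 : ℝ) < (n : ℝ) := by linarith
    obtain ⟨h1, hint⟩ := M.integral_nrm_dev_succ_sq_le n
    set I := ∫ ω, ∫ ω', (M.dev n ω (M.dec (M.est n ω) (M.X 0 ω'))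
          - ∑ k, M.p k * M.dev n ω k) ∂M.P ∂M.P with hI
    set u := ∫ ω, nrm (M.dev n ω) ^ 2 ∂M.P with hu
    have hu0 : 0 ≤ u := integral_nonneg fun ω => sq_nonneg _
    have hbad : MeasurableSet {ω | ¬ M.Good η c n ω} := (M.measurableSet_good η c n).compl
    have hI1 : q.κ₂ * q.κ₅ * u - B₀ / n ≤ I := by
      set L := 2 + (1 + q.κ₂ * q.κ₅) * devBound q n ^ 2 with hL
      have hL0 : 0 ≤ L := by positivity
      have hLn : L ≤ A₃ * n := by
        have h2 := mul_le_mul_of_nonneg_left (devBound_sq_le q hn)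
          (by positivity : 0 ≤ 1 + q.κ₂ * q.κ₅)
        rw [hL, hA₃]
        linarith
      have i1 : Integrable (fun ω => q.κ₂ * q.κ₅ * nrm (M.dev n ω) ^ 2) M.P :=
        (M.integrable_nrm_dev_sq n).const_mul _
      have i2 : Integrable (fun ω => A₁ * M.goodSqErr η c n ω) M.P :=
        (M.integrable_goodSqErr hη0.le c n).const_mul _
      have i3 : Integrable (fun ω => {ω | ¬ M.Good η c n ω}.indicator (fun _ => L) ω) M.P :=
        (integrable_const L).indicator hbad
      have h2 := integral_mono ((i1.sub i2).sub i3) hint fun ω => M.drift_dev_ge hη0 hη1 n ω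
      have i12 : Integrable (fun ω => q.κ₂ * q.κ₅ * nrm (M.dev n ω) ^ 2
        - A₁ * M.goodSqErr η c n ω) M.P := i1.sub i2
      have e : ∫ ω, (q.κ₂ * q.κ₅ * nrm (M.dev n ω) ^ 2 - A₁ * M.goodSqErr η c n ω
          - {ω | ¬ M.Good η c n ω}.indicator (fun _ => L) ω) ∂M.P
          = q.κ₂ * q.κ₅ * u - A₁ * (∫ ω, M.goodSqErr η c n ω ∂M.P)
            - M.P.real {ω | ¬ M.Good η c n ω} * L := by
        rw [integral_sub i12 i3, integral_sub i1 i2, integral_const_mul, integral_const_mul,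
          integral_indicator_const_real hbad]
      have h3 : A₁ * (∫ ω, M.goodSqErr η c n ω ∂M.P) ≤ A₁ * (A₂ / n) :=
        mul_le_mul_of_nonneg_left (M.integral_goodSqErr_le hη0.le hc hn) hA₁0
      -- The bad event has probability O(n⁻²) and the loss on it is polylogarithmic, here bounded by
      -- O(n); the product is O(1/n).
      have h4 : M.P.real {ω | ¬ M.Good η c n ω} * L ≤ C / (n : ℝ) ^ 2 * (A₃ * n) :=
        mul_le_mul (hCle M n hn) hLn hL0 (by positivity)
      have e2 : C / (n : ℝ) ^ 2 * (A₃ * n) = A₃ * C / n := by field_simp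
      have e3 : B₀ / n = A₁ * (A₂ / n) + A₃ * C / n := by rw [hB₀]; ring
      have h5 : q.κ₂ * q.κ₅ * u - A₁ * (∫ ω, M.goodSqErr η c n ω ∂M.P)
            - M.P.real {ω | ¬ M.Good η c n ω} * L ≤ I := by
        rw [← e]; exact h2
      linarith
    set t := q.α / ((n : ℝ) + 1) with ht
    have ht0 : 0 ≤ t := by positivity
    have h2 := mul_le_mul_of_nonneg_left hI1 (by positivity : 0 ≤ 2 * t)
    -- This is where the lower bound on α enters: it makes the contraction coefficient at least
    -- 2/(n+1).
    have h3 : 2 / ((n : ℝ) + 1) * u ≤ 2 * t * (q.κ₂ * q.κ₅ * u) := by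
      have e : 2 * t * (q.κ₂ * q.κ₅ * u)
          = 2 / ((n : ℝ) + 1) * u * (q.α * (q.κ₂ * q.κ₅)) := by rw [ht]; ring
      rw [e]
      exact le_mul_of_one_le_right (by positivity) hα'
    have h4 : 2 * t * (B₀ / n) ≤ 4 * q.α * B₀ / ((n : ℝ) + 1) ^ 2 := by
      have e : 2 * t * (B₀ / n) = 2 * q.α * B₀ / (((n : ℝ) + 1) * n) := by
        rw [ht]; field_simp
      rw [e, div_le_div_iff₀ (by positivity) (by positivity)]
      have : ((n : ℝ) + 1) ≤ 2 * n := by linarith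
      have h5 : 0 ≤ 2 * q.α * B₀ * ((n : ℝ) + 1) := by positivity
      have := mul_le_mul_of_nonneg_left this h5
      linarith
    have h5 : 2 * t ^ 2 = 2 * q.α ^ 2 / ((n : ℝ) + 1) ^ 2 := by rw [ht]; field_simp
    have h6 : B / ((n : ℝ) + 1) ^ 2 = 4 * q.α * B₀ / ((n : ℝ) + 1) ^ 2
        + 2 * q.α ^ 2 / ((n : ℝ) + 1) ^ 2 + devBound q 1 ^ 2 / ((n : ℝ) + 1) ^ 2 := by
      rw [hB]; ring
    have h7 : 0 ≤ devBound q 1 ^ 2 / ((n : ℝ) + 1) ^ 2 := by positivity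
    linarith

/-! ### From mean squares to the error probability -/

/-- The probability of a wrong plug-in decision decays like `1 / √n`. -/
lemma prob_dec_ne_opt_at_le (q : Par K d) : ∃ D : ℝ, 0 < D ∧ ∀ (M : Model q) (n : ℕ), 0 < n →
    M.P.real {ω | M.dec (M.est n ω) (M.X n ω) ≠ M.opt (M.X n ω)} ≤ D / √(n : ℝ) := by
  have hκ₁ := q.hκ₁
  have hκ₃ := q.hκ₃
  have hκ₆ := q.hκ₆
  have hR := q.hR
  have hnc := noiseConst_nonneg q
  obtain ⟨B, hB, hdev⟩ := integral_nrm_dev_sq_le q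
  obtain ⟨c, hc, hgood⟩ := prob_not_good_le q
  obtain ⟨C, hC, hbadle⟩ := hgood 1 one_pos
  set A₂ := K * (2 * (noiseConst q + 217 ^ 2 * q.R ^ 2) / c ^ 2) with hA₂
  have hA₂0 : 0 ≤ A₂ := by positivity
  set E := (K : ℝ) ^ 2 * q.κ₃ + 1 / q.κ₁ with hE
  have hE0 : 0 < E := by positivity
  refine ⟨C + E * (B + 1 + q.κ₆ * (A₂ + 1)), by positivity, fun M n hn => ?_⟩
  have hn1 : (1 : ℝ) ≤ (n : ℝ) := by exact_mod_cast hn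
  have hn0 : (0 : ℝ) < (n : ℝ) := by linarith
  set r := √(n : ℝ) with hr
  have hr1 : 1 ≤ r := Real.one_le_sqrt.2 hn1
  have hr0 : 0 < r := by linarith
  have hrn : r ^ 2 = n := Real.sq_sqrt hn0.le
  set f : ((Fin K → ℝ) × (Fin K → EuclideanSpace ℝ (Fin d))) →
      EuclideanSpace ℝ (Fin d) × (Fin K → ℝ) → ℝ := fun s o =>
    {z : Fin K × Fin K | z.1 ≠ z.2}.indicator (fun _ => (1 : ℝ)) (M.dec s o.1, M.opt o.1) with hf
  have hfm : Measurable (Function.uncurry f) := by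
    have h1 : Measurable ({z : Fin K × Fin K | z.1 ≠ z.2}.indicator fun _ => (1 : ℝ)) :=
      measurable_of_finite _
    have h2 : Measurable fun z : ((Fin K → ℝ) × (Fin K → EuclideanSpace ℝ (Fin d)))
        × (EuclideanSpace ℝ (Fin d) × (Fin K → ℝ)) => M.dec z.1 z.2.1 :=
      measurable_comp₂ M.measurable_dec measurable_fst (measurable_fst.comp measurable_snd)
    have h3 : Measurable fun z : ((Fin K → ℝ) × (Fin K → EuclideanSpace ℝ (Fin d)))
        × (EuclideanSpace ℝ (Fin d) × (Fin K → ℝ)) => M.opt z.2.1 :=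
      M.measurable_opt.comp (measurable_fst.comp measurable_snd)
    exact h1.comp (h2.prodMk h3)
  have hfint : ∀ {A : M.Ω → (Fin K → ℝ) × (Fin K → EuclideanSpace ℝ (Fin d))} (_ : Measurable A)
      (m : ℕ), Integrable (fun ω => f (A ω) (M.obs m ω)) M.P ∧
        ∫ ω, f (A ω) (M.obs m ω) ∂M.P
          = M.P.real {ω | M.dec (A ω) (M.X m ω) ≠ M.opt (M.X m ω)} := by
    intro A hA m
    have hms : MeasurableSet {ω | M.dec (A ω) (M.X m ω) ≠ M.opt (M.X m ω)} :=
      (measurableSet_eq_fun (measurable_comp₂ M.measurable_dec hA (M.measurable_X m))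
        (M.measurable_opt_X m)).compl
    have e : (fun ω => f (A ω) (M.obs m ω))
        = {ω | M.dec (A ω) (M.X m ω) ≠ M.opt (M.X m ω)}.indicator fun _ => (1 : ℝ) := by
      funext ω
      rfl
    constructor
    · rw [e]; exact (integrable_const _).indicator hms
    · calc _ = ∫ ω, {ω | M.dec (A ω) (M.X m ω) ≠ M.opt (M.X m ω)}.indicator
            (fun _ => (1 : ℝ)) ω ∂M.P := by rw [← e]
        _ = _ := by rw [integral_indicator_const_real hms, mul_one]
  obtain ⟨hi, he⟩ := hfint (M.measurable_est_amb n) n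
  obtain ⟨hi', he'⟩ := M.integral_step (M.measurable_est n) hfm hi
  rw [← he, he']
  set bad := {ω | ¬ M.Good 1 c n ω} with hbad
  have hbadm : MeasurableSet bad := (M.measurableSet_good 1 c n).compl
  have hpt : ∀ ω, ∫ ω', f (M.est n ω) (M.obs 0 ω') ∂M.P
      ≤ bad.indicator (fun _ => (1 : ℝ)) ω
        + (E * r * nrm (M.dev n ω) ^ 2 + (E * q.κ₆ * r * M.goodSqErr 1 c n ω
          + E * (1 + q.κ₆) / r)) := by
    intro ω
    rw [(hfint (A := fun _ => M.est n ω) measurable_const 0).2]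
    -- With r = √n this trades first moments for second moments of order 1/n, at the final rate
    -- 1/√n.
    have hsq : ∀ x : ℝ, 2 * x ≤ r * x ^ 2 + 1 / r := by
      intro x
      have h1 : 0 ≤ (r * x - 1) ^ 2 / r := by positivity
      have h2 : (r * x - 1) ^ 2 / r = r * x ^ 2 - 2 * x + 1 / r := by field_simp; ring
      linarith
    have hsqe : 0 ≤ M.goodSqErr 1 c n ω := M.goodSqErr_nonneg 1 c n ω
    by_cases hG : M.Good 1 c n ω
    · rw [Set.indicator_of_notMem (fun h : ω ∈ bad => h hG), goodSqErr, if_pos hG, zero_add]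
      set y := M.errNrm (M.est n ω) with hy
      have hy0 : 0 ≤ y := M.errNrm_nonneg _
      set x := nrm (M.dev n ω) with hx
      have hx0 : 0 ≤ x := nrm_nonneg _
      have h1 := M.prob_dec_ne_opt_le (w := 2 * x + 2 * q.κ₆ * y) (M.close_errNrm (M.est n ω))
        (by positivity) fun j l => add_le_add_left (sub_le_two_nrm (M.dev n ω) j l) _
      refine h1.trans ?_
      have h2 : q.κ₆ * (2 * y) ≤ q.κ₆ * (r * y ^ 2 + 1 / r) :=
        mul_le_mul_of_nonneg_left (hsq y) hκ₆.le
      have h3 : E * (2 * x + 2 * q.κ₆ * y)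
          ≤ E * ((r * x ^ 2 + 1 / r) + q.κ₆ * (r * y ^ 2 + 1 / r)) :=
        mul_le_mul_of_nonneg_left (by linarith [hsq x]) hE0.le
      refine h3.trans (le_of_eq ?_)
      ring
    · rw [Set.indicator_of_mem (show ω ∈ bad from hG)]
      have : 0 ≤ E * r * nrm (M.dev n ω) ^ 2 + (E * q.κ₆ * r * M.goodSqErr 1 c n ω
          + E * (1 + q.κ₆) / r) := by positivity
      linarith [measureReal_le_one (μ := M.P)
        (s := {ω_1 | M.dec (M.est n ω) (M.X 0 ω_1) ≠ M.opt (M.X 0 ω_1)})]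
  have i1 : Integrable (bad.indicator fun _ => (1 : ℝ)) M.P := (integrable_const _).indicator hbadm
  have i2 : Integrable (fun ω => E * r * nrm (M.dev n ω) ^ 2) M.P :=
    (M.integrable_nrm_dev_sq n).const_mul _
  have i3 : Integrable (fun ω => E * q.κ₆ * r * M.goodSqErr 1 c n ω) M.P :=
    (M.integrable_goodSqErr zero_le_one c n).const_mul _
  have i4 : Integrable (fun ω => E * q.κ₆ * r * M.goodSqErr 1 c n ω + E * (1 + q.κ₆) / r) M.P :=
    i3.add (integrable_const _)
  have i5 : Integrable (fun ω => E * r * nrm (M.dev n ω) ^ 2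
      + (E * q.κ₆ * r * M.goodSqErr 1 c n ω + E * (1 + q.κ₆) / r)) M.P := i2.add i4
  have hint := integral_mono hi' (i1.add i5) hpt
  refine hint.trans ?_
  have e : ∫ ω, (bad.indicator (fun _ => (1 : ℝ)) ω + (E * r * nrm (M.dev n ω) ^ 2
      + (E * q.κ₆ * r * M.goodSqErr 1 c n ω + E * (1 + q.κ₆) / r))) ∂M.P
      = M.P.real bad + (E * r * (∫ ω, nrm (M.dev n ω) ^ 2 ∂M.P)
        + (E * q.κ₆ * r * (∫ ω, M.goodSqErr 1 c n ω ∂M.P) + E * (1 + q.κ₆) / r)) := by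
    rw [integral_add i1 i5, integral_add i2 i4, integral_add i3 (integrable_const _),
      integral_const_mul, integral_const_mul, integral_indicator_const_real hbadm]
    simp
  refine e.le.trans ?_
  have h1 : M.P.real bad ≤ C / r := by
    refine (hbadle M n hn).trans (div_le_div_of_nonneg_left hC.le hr0 ?_)
    rw [← hrn]
    calc r ≤ r ^ 4 := le_self_pow₀ hr1 (by norm_num)
      _ = (r ^ 2) ^ 2 := by ring
  have h2 : E * r * (∫ ω, nrm (M.dev n ω) ^ 2 ∂M.P) ≤ E * r * (B / n) :=
    mul_le_mul_of_nonneg_left (hdev M n hn) (by positivity)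
  have h3 : E * q.κ₆ * r * (∫ ω, M.goodSqErr 1 c n ω ∂M.P) ≤ E * q.κ₆ * r * (A₂ / n) :=
    mul_le_mul_of_nonneg_left (M.integral_goodSqErr_le zero_le_one hc hn) (by positivity)
  have e2 : (C + E * (B + 1 + q.κ₆ * (A₂ + 1))) / r
      = C / r + (E * r * (B / n) + (E * q.κ₆ * r * (A₂ / n) + E * (1 + q.κ₆) / r)) := by
    rw [← hrn]; field_simp; ring
  rw [e2]
  linarith

end Model

end SemidiscreteOT

end

/-! ### Threshold for α and conclusion -/

theorem theorem3 (κ₁ κ₂ κ₃ κ₄ κ₅ κ₆ κ₇ κ₈ : ℝ) (hκ₁ : 0 < κ₁) (hκ₂ : 0 < κ₂) (hκ₃ : 0 < κ₃)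
    (hκ₄ : 0 < κ₄) (hκ₅ : 0 < κ₅) (hκ₆ : 0 < κ₆) (hκ₇ : 0 < κ₇) (hκ₈ : 0 < κ₈) :
    ∃ αbar : ℝ, 0 < αbar ∧
      ∀ (K d : ℕ) (α a R : ℝ) (r : ℕ → Fin K), αbar < α → 0 < a →
        SemidiscreteOT.IsExplorationRule a r →
        ∃ D : ℝ, 0 < D ∧
          ∀ (Ω : Type*) [MeasurableSpace Ω] (P : Measure Ω) [IsProbabilityMeasure P]
            (amin : (Fin K → ℝ) → Fin K) (p : Fin K → ℝ)
            (β : Fin K → EuclideanSpace ℝ (Fin d)) (gstar : Fin K → ℝ)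
            (X : ℕ → Ω → EuclideanSpace ℝ (Fin d)) (ε : ℕ → Fin K → Ω → ℝ)
            (g0 : Fin K → ℝ) (b0 : Fin K → EuclideanSpace ℝ (Fin d)),
            SemidiscreteOT.IsArgminRule amin →
            SemidiscreteOT.IsDataModel P p β gstar X ε →
            SemidiscreteOT.AbsContDifferences P β (X 0) →
            SemidiscreteOT.IsRich P κ₁ κ₂ κ₃ κ₄ κ₅ κ₆ β gstar (X 0) →
            SemidiscreteOT.IsCondSubGaussian P κ₇ X ε →
            (∀ k, κ₈ ≤ SemidiscreteOT.lambdaMin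
              (SemidiscreteOT.restrictedMoment P amin β gstar (X 0) k)) →
            (∀ k, ‖β k‖ ≤ R) → (∀ k, |g0 k| ≤ R) →
            ∀ n : ℕ,
              P.real {ω |
                SemidiscreteOT.plugIn amin
                    (SemidiscreteOT.run amin α a r p β g0 b0
                      (fun m => X m ω) (fun m k => ε m k ω) n)
                    (X n ω)
                  ≠ amin (SemidiscreteOT.adjustedCost β gstar (X n ω))}
                ≤ D / Real.sqrt ((n : ℝ) + 1) := by
  refine ⟨1 / (κ₂ * κ₅), by positivity, fun K d α a R r hα ha hr => ?_⟩
  have hα0 : 0 < α := lt_trans (by positivity) hα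
  have hα' : 1 ≤ α * (κ₂ * κ₅) := by
    rw [div_lt_iff₀ (by positivity)] at hα
    exact hα.le
  obtain ⟨D, hD, h⟩ := SemidiscreteOT.Model.prob_dec_ne_opt_at_le
    (SemidiscreteOT.Par.mk (K := K) (d := d) κ₁ κ₂ κ₃ κ₄ κ₅ κ₆ κ₇ κ₈ α a |R| r
      hκ₁ hκ₂ hκ₃ hκ₄ hκ₅ hκ₆ hκ₇ hκ₈ hα0 hα' ha (abs_nonneg R) hr)
  -- The index n stands for period n + 1: the factor 2 passes from √n to √(n + 1), and the summand 1
  -- covers n = 0, where only the trivial bound is available.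
  refine ⟨2 * D + 1, by positivity, ?_⟩
  intro Ω _ P _ amin p β gstar X ε g0 b0 hamin hdata _ hrich hsub hlam hβ hg0 n
  have h1 := h
    { Ω, P, amin, p, β, gstar, X, ε, g0, b0, hamin
      data := hdata
      rich := hrich
      subG := hsub
      lam := hlam
      hβ := fun k => (hβ k).trans (le_abs_self R)
      hg0 := fun k => (hg0 k).trans (le_abs_self R) } n
  rcases Nat.eq_zero_or_pos n with rfl | hn
  · refine measureReal_le_one.trans ?_
    simp only [Nat.cast_zero, zero_add, Real.sqrt_one, div_one]
    linarith
  · refine (h1 hn).trans ?_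
    have hn1 : (1 : ℝ) ≤ n := by exact_mod_cast hn
    have hn0 : (0 : ℝ) < n := by linarith
    rw [div_le_div_iff₀ (Real.sqrt_pos.2 hn0) (Real.sqrt_pos.2 (by linarith))]
    have h2 : √((n : ℝ) + 1) ≤ 2 * √(n : ℝ) := by
      rw [Real.sqrt_le_left (by positivity), mul_pow, Real.sq_sqrt hn0.le]
      linarith
    have h3 := mul_le_mul_of_nonneg_left h2 hD.le
    have h4 := Real.sqrt_nonneg (n : ℝ)
    linarith
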